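/- **Definitions.** All graphs are finite and simple. $e(G)$ is the number of edges of $G$, $G\vee G'$ denotes the join, $I_s$ the edgeless graph on $s$ vertices, and $T_2(m)$ the balanced complete bipartite graph on $m$ vertices. Let $H$ be a bipartite graph and $t\ge 5$ an odd integer. An *odd-ballooning* $H(t)$ of $H$ is obtained by choosing for every edge $e$ of $H$ an odd integer $\ell_e\ge t$ and replacing $e$ by a cycle of length $\ell_e$ that contains $e$, where the new vertices of the different cycles are all different. Fix such an $H(t)$. Let $\mathcal M=\mathcal M_2(H(t))$ be the family of minimal graphs $M$ (with respect to taking subgraphs) such that, for some $s$, $(M\cup I_s)\vee I_s$ contains a copy of $H(t)$. A covering of a graph is a set of vertices that meets all edges; $\beta(M)$ is the minimum size of a covering of $M$, and $\gamma(M)$ the minimum size of an independent covering of a bipartite graph $M$. Put - $\tilde q(H)=\min\{\gamma(M): M\in\mathcal M \text{ bipartite}\}$; - $k(H)=\min\{d_M(x)\}$, over all bipartite $M\in\mathcal M$, all independent coverings $S$ of $M$ with $|S|=\tilde q(H)$, and all $x\in S$; - $\tilde{\mathcal B}(H)$: the set of all graphs $M[C]$, where $M\in\mathcal M$ and $C$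 is a covering of $M$ with $|C|<\tilde q(H)$; if $\beta(M)\ge \tilde q(H)$ for all $M\in\mathcal M$, then $\tilde{\mathcal B}(H)=\{K_{\tilde q(H)}\}$ instead. For a family $\mathcal L$ of graphs, $\mathrm{ex}(m,\mathcal L)$ is the maximum number of edges of a graph on $m$ vertices containing no member of $\mathcal L$ as a subgraph, and $\mathrm{EX}(m,\mathcal L)$ is the set of graphs attaining it. Let $F(n,q)=I_{q-1}\vee T_2(n-q+1)$ and $f(n,q)=e(F(n,q))$. Let $\mathcal F(n,q,k,\mathcal L)$ be the set of graphs (up to isomorphism) obtained from $F(n,q)$ by putting a copy of $K_{k,k}$ in one class of $T_2(n-q+1)$ and a member of $\mathrm{EX}(q-1,\mathcal L)$ in $I_{q-1}$. **Theorem.** Let $H$ be a bipartite graph, $t\ge5$ an odd integer, $H(t)$ an odd-ballooning of $H$ as above, and $c_0\in(\tfrac12,1]$ a constant. Then for all sufficiently large $n$ and $b$ (depending on $H(t)$ and $c_0$) the following holds. Let $G$ be a graph of order $n$ with a partition $V(G)=V_0\cup V_1\cup V_2$ such that 1. there exist $V_1'\subseteq V_1$ and $V_2'\subseteq V_2$ with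 $|V_1'|=|V_2'|=b$ such that $G[V_1'\cup V_2']=T_2(2b)$ with classes $V_1'$ and $V_2'$; 2. $|V_0|=\tilde q(H)-1$, and each vertex of $V_0$ is adjacent to each vertex of $V_1'\cup V_2'$; 3. for $i=1,2$, each vertex of $V_i\setminus V_i'$ is adjacent to at least $c_0|V_{3-i}'|$ vertices of $V_{3-i}'$ and to no vertex of $V_i'$. If $G$ is $H(t)$-free, then $$e(G)\le f(n,\tilde q(H))+\mathrm{ex}(\tilde q(H)-1,\tilde{\mathcal B}(H))+(k(H)-1)^2,$$ and equality holds if and only if $G\in\mathcal F(n,\tilde q(H),k(H)-1,\tilde{\mathcal B}(H))$. -/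

import Mathlib

namespace OddBalloon

/-- Number of edges of a graph (always used for graphs on finite vertex sets). -/
noncomputable def numEdges {V : Type*} (G : SimpleGraph V) : ℕ := G.edgeSet.ncard

/-- The join `G ∨ H`: disjoint copies of `G` and `H` plus all edges between them. -/
def join {V W : Type*} (G : SimpleGraph V) (H : SimpleGraph W) : SimpleGraph (V ⊕ W) :=
  (G ⊕g H) ⊔ completeBipartiteGraph V W

/-- The odd-ballooning of `H` with prescribed cycle lengths: every edge `e` of `H` is kept, and its
two ends are also joined by a path through `ℓ e - 2` new vertices, so that `e` lies on a cycle of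
length `ℓ e`; the new vertices belonging to different edges are different. -/
def ballooning {V : Type*} (H : SimpleGraph V) (ℓ : H.edgeSet → ℕ) :
    SimpleGraph (V ⊕ (Σ e : H.edgeSet, Fin (ℓ e - 2))) :=
  SimpleGraph.fromRel fun x y =>
    match x, y with
    | Sum.inl u, Sum.inl v => H.Adj u v
    | Sum.inl u, Sum.inr ⟨e, i⟩ =>
        (u = (Quot.out e.1).1 ∧ (i : ℕ) = 0) ∨ (u = (Quot.out e.1).2 ∧ (i : ℕ) + 1 = ℓ e - 2)
    | Sum.inr ⟨e, i⟩, Sum.inr ⟨f, j⟩ => e = f ∧ (i : ℕ) + 1 = (j : ℕ)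
    | Sum.inr _, Sum.inl _ => False

/-- Finite graphs, up to relabelling of the vertices. Families of graphs are sets of these. -/
abbrev FinGraph : Type := Σ m : ℕ, SimpleGraph (Fin m)

/-- For some `s`, the graph `(M ∪ I_s) ∨ I_s` contains a copy of `L`. -/
def Completes {V W : Type*} (L : SimpleGraph V) (M : SimpleGraph W) : Prop :=
  ∃ s : ℕ, L.IsContained
    (join (M ⊕g (⊥ : SimpleGraph (Fin s))) (⊥ : SimpleGraph (Fin s)))

/-- The 2-decomposition family `𝓜₂(L)`: the graphs `M` such that `(M ∪ I_s) ∨ I_s` contains `L` for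
some `s`, and no proper subgraph of `M` has this property. -/
def decompFamily {V : Type*} (L : SimpleGraph V) : Set FinGraph :=
  {M | Completes L M.2 ∧ ∀ M' : M.2.Subgraph, Completes L M'.coe → M' = ⊤}

/-- An independent covering: an independent set of vertices meeting all edges. -/
def IsIndepCovering {V : Type*} (G : SimpleGraph V) (S : Set V) : Prop :=
  G.IsIndepSet S ∧ G.IsVertexCover S

/-- `γ(G)`: the least size of an independent covering of the (bipartite) graph `G`. -/
noncomputable def indepCoverNum {V : Type*} (G : SimpleGraph V) : ℕ :=
  sInf {c | ∃ S : Set V, IsIndepCovering G S ∧ S.ncard = c}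

/-- The independent covering number `q(𝓛) = min {γ(L) : L ∈ 𝓛 bipartite}`. -/
noncomputable def qNum (𝓛 : Set FinGraph) : ℕ :=
  sInf {c | ∃ L ∈ 𝓛, L.2.IsBipartite ∧ indepCoverNum L.2 = c}

/-- `(L, S)` with `L ∈ 𝓛` bipartite and `S` a member of the independent covering family `𝓢(𝓛)`
coming from `L`, that is, an independent covering of `L` of size `q(𝓛)`. -/
def IsMinIndepCovering (𝓛 : Set FinGraph) (L : FinGraph) (S : Set (Fin L.1)) : Prop :=
  L ∈ 𝓛 ∧ L.2.IsBipartite ∧ IsIndepCovering L.2 S ∧ S.ncard = qNum 𝓛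

/-- `min {d_L(x) : x ∈ S, S ∈ 𝓢(𝓛)}`, where `S` is an independent covering of `L ∈ 𝓛`. -/
noncomputable def kNum (𝓛 : Set FinGraph) : ℕ :=
  sInf {d | ∃ (L : FinGraph) (S : Set (Fin L.1)), IsMinIndepCovering 𝓛 L S ∧
    ∃ x ∈ S, (L.2.neighborSet x).ncard = d}

open Classical in
/-- The subgraph covering family `𝓑(𝓛)`: the graphs induced by a (not necessarily independent)
covering, of size less than `q(𝓛)`, of some `L ∈ 𝓛`; if `β(L) ≥ q(𝓛)` for all `L ∈ 𝓛`, it is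
`{K_{q(𝓛)}}` instead. -/
noncomputable def coveringFamily (𝓛 : Set FinGraph) : Set FinGraph :=
  if ∀ L ∈ 𝓛, (qNum 𝓛 : ℕ∞) ≤ L.2.vertexCoverNum then {⟨qNum 𝓛, ⊤⟩}
  else {Q | ∃ L ∈ 𝓛, ∃ C : Set (Fin L.1), L.2.IsVertexCover C ∧ C.ncard < qNum 𝓛 ∧
    Nonempty (Q.2 ≃g L.2.induce C)}

/-- `G` contains no member of `𝓛` as a (not necessarily induced) subgraph. -/
def FamilyFree (𝓛 : Set FinGraph) {V : Type*} (G : SimpleGraph V) : Prop :=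
  ∀ L ∈ 𝓛, L.2.Free G

/-- The Turán number `ex(n, 𝓛)`. -/
noncomputable def ex (n : ℕ) (𝓛 : Set FinGraph) : ℕ :=
  sSup {m | ∃ G : SimpleGraph (Fin n), FamilyFree 𝓛 G ∧ numEdges G = m}

/-- `EX(n, 𝓛)`: the extremal graphs on `n` vertices for `𝓛`. -/
def EX (n : ℕ) (𝓛 : Set FinGraph) : Set (SimpleGraph (Fin n)) :=
  {G | FamilyFree 𝓛 G ∧ numEdges G = ex n 𝓛}

/-- `f(n, q)`: the number of edges of `F(n, q) = I_{q-1} ∨ T_2(n-q+1)`. -/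
noncomputable def fNum (n q : ℕ) : ℕ :=
  numEdges (join (⊥ : SimpleGraph (Fin (q - 1))) (SimpleGraph.turanGraph (n - (q - 1)) 2))

/-- Membership in `𝓕(n, q, k, 𝓛)`, up to isomorphism: the graph is obtained from
`I_{q-1} ∨ T_2(n-q+1)` by putting a copy of `K_{k,k}` in one class of `T_2(n-q+1)` (the classes of
`turanGraph _ 2` are the residue classes modulo 2) and a member of `EX(q-1, 𝓛)` in `I_{q-1}`. -/
def InF (n q k : ℕ) (𝓛 : Set FinGraph) {V : Type*} (G : SimpleGraph V) : Prop :=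
  ∃ Q ∈ EX (q - 1) 𝓛, ∃ φ : Fin k ⊕ Fin k ↪ Fin (n - (q - 1)),
    (∃ r : ℕ, ∀ x, (φ x : ℕ) % 2 = r) ∧
    Nonempty (G ≃g join Q
      (SimpleGraph.turanGraph (n - (q - 1)) 2 ⊔
        (completeBipartiteGraph (Fin k) (Fin k)).map φ))

end OddBalloon

/-! Split the edges of `G` along `V₀`, `V₁`, `V₂`. The part inside `V₀` contributes at most `ex (q -
1) 𝓑`, because a graph `M[C]` inside `V₀` extends to the ballooning (`Host.familyFree_induce`). The
edges at `V₀` and a complete bipartite graph between the classes account for `fNum n q`. It remains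
to show that the edges inside the two classes exceed the missing edges between them by at most `(k -
1) ^ 2`.

To use freeness, `q` and `k` are read off from `H` (`exists_indepSet_of_qNum_ne_zero`). A bipartite
member of the decomposition family with an independent covering is, in effect, an independent set
`S` of `H(t)` whose removal leaves a bipartite graph. Such an `S` of least size consists of an
independent set `I` of `H` and one new vertex for each edge of `H` not covered by `I`; if `I` covers
everything, some `x ∈ I` has `d_H(x) ≤ k`. In that case put `I \ {x}` into `V₀` and `x` at a vertex
`v` of a class. Each cycle through `x` then needs one edge inside a class to correct its parity, and
`k` disjoint such edges, at `v` or reachable from `v`, produce `H(t)`. If some edge of `H` is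
uncovered, a single edge inside a class produces `H(t)`. Either way `FewGadgets` holds with `h = k -
1`. The vertices without a prescribed place are embedded greedily through Hall's theorem
(`Host.isContained`); `c₀ > 1/2` supplies common neighbours for two prescribed vertices.

The rest is extremal graph theory under `FewGadgets`. If only one class has edges, or no edge
between the classes is missing, then degree plus outside matching is at most `h` at every
nonisolated vertex, which gives `h ^ 2` with equality only for `K_{h,h}` (`card_edgeFinset_le_sq`).
If both classes have edges and some pairs are missing, a vertex of `W` with no missing pair bounds
the matching number by `h`. A bound in terms of matching number and maximum degree, obtained from
Gallai's lemma, then gives `h ^ 2` plus the number of vertices of degree `h`, and these vertices are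
outnumbered by the missing pairs (`numEdges_mono_lt`). -/

namespace OddBalloon

open Finset

/-! ### Edges versus matching number and maximum degree, through Gallai's lemma -/

section MatchingNumber

/-- A matching of `Γ`, given by one end `a ∈ A` of each edge and the other end `f a`. -/
structure OrientedMatching {V : Type*} (Γ : SimpleGraph V) (A : Finset V) (f : V → V) : Prop where
  inj : Set.InjOn f A
  adj : ∀ a ∈ A, Γ.Adj a (f a)
  disj : ∀ a ∈ A, f a ∉ A

/-- A matching of `Γ`, given by the involution that exchanges the ends of its edges. -/
structure MatchingInvolution {V : Type*} (Γ : SimpleGraph V) (f : V → V) : Prop where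
  invol : ∀ x, f (f x) = x
  adj : ∀ x, f x ≠ x → Γ.Adj x (f x)

namespace MatchingInvolution

variable {V : Type*} {Γ : SimpleGraph V} {f : V → V}

/-- The vertices covered by the matching. -/
def moved [Fintype V] [DecidableEq V] (f : V → V) : Finset V := {x | f x ≠ x}

@[simp]
theorem mem_moved [Fintype V] [DecidableEq V] {f : V → V} {x : V} : x ∈ moved f ↔ f x ≠ x := by
  simp [moved]

theorem id (Γ : SimpleGraph V) : MatchingInvolution Γ id := ⟨fun _ => rfl, fun _ h => (h rfl).elim⟩

theorem mono {Γ' : SimpleGraph V} (h : MatchingInvolution Γ f) (hle : Γ ≤ Γ') :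
    MatchingInvolution Γ' f := ⟨h.invol, fun x hx => hle (h.adj x hx)⟩

/-- Match `x` with `y` and leave the former partner of `y` unmatched. -/
theorem rematch [DecidableEq V] (h : MatchingInvolution Γ f) {x y : V} (hxy : Γ.Adj x y)
    (hx : f x = x) :
    MatchingInvolution Γ (fun w => if w = x then y else if w = y then x else if w = f y then w
      else f w) := by
  have hne := hxy.ne
  have hinv := h.invol
  have hadj := h.adj
  have hs := hxy.symm
  refine ⟨fun w => ?_, fun w hw => ?_⟩
  · have := hinv w
    have := hinv y
    grind
  · have := hadj w
    grind

variable [Fintype V] [LinearOrder V]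

theorem orientedMatching (h : MatchingInvolution Γ f) :
    OrientedMatching Γ {x | x < f x} f := by
  refine ⟨fun a _ b _ hab => ?_, fun a ha => ?_, fun a ha => ?_⟩
  · rw [← h.invol a, hab, h.invol]
  · simp only [Finset.mem_filter, Finset.mem_univ, true_and] at ha
    exact h.adj a ha.ne'
  · simp only [Finset.mem_filter, Finset.mem_univ, true_and, h.invol] at ha ⊢
    exact ha.not_gt

theorem card_moved (h : MatchingInvolution Γ f) :
    #(moved f) = 2 * #{x | x < f x} := by
  have h1 : #{x | f x < x} = #{x | x < f x} := by
    refine Finset.card_nbij' f f ?_ ?_ ?_ ?_ <;> intro a <;> simp [h.invol]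
  have h2 : moved f = ({x | x < f x} : Finset V) ∪ ({x | f x < x} : Finset V) := by
    ext x
    simp only [mem_moved, Finset.mem_filter, Finset.mem_univ, true_and, Finset.mem_union]
    rw [ne_comm, lt_or_lt_iff_ne]
  rw [h2, Finset.card_union_of_disjoint, h1]
  · ring
  · rw [Finset.disjoint_filter]
    exact fun x _ hx => hx.not_gt

/-- Gallai: if each vertex is missed by a maximum matching, then the relation `no maximum
matching misses both` is a transitive relation. -/
theorem not_both_fixed_trans {ν : ℕ} (hν : ∀ f, MatchingInvolution Γ f → #(moved f) ≤ 2 * ν)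
    {u t v : V} (huv : u ≠ v)
    (ht : ∃ f, MatchingInvolution Γ f ∧ #(moved f) = 2 * ν ∧ f t = t)
    (hut : ∀ f, MatchingInvolution Γ f → #(moved f) = 2 * ν → ¬(f u = u ∧ f t = t))
    (htv : ∀ f, MatchingInvolution Γ f → #(moved f) = 2 * ν → ¬(f t = t ∧ f v = v)) :
    ∀ f, MatchingInvolution Γ f → #(moved f) = 2 * ν → ¬(f u = u ∧ f v = v) := by
  rintro M hM hMc ⟨hMu, hMv⟩
  -- `N` shares as many edges with `M` as possible among the maximum matchings missing `t`. It must
  -- cover `u` and `v`, which `M` misses; since both cover equally many vertices, at least two are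
  -- covered by `M` only, hence one different from `t`.
  obtain ⟨N, hN, hmax⟩ := Set.Finite.exists_maximalFor (fun N : V → V => #{x | M x = N x ∧ M x ≠ x})
    {N | MatchingInvolution Γ N ∧ #(moved N) = 2 * ν ∧ N t = t} (Set.toFinite _) ht
  obtain ⟨hNi, hNc, hNt⟩ := hN
  have hNu : N u ≠ u := fun h => hut N hNi hNc ⟨h, hNt⟩
  have hNv : N v ≠ v := fun h => htv N hNi hNc ⟨hNt, h⟩
  obtain ⟨x, hx, hxt⟩ : ∃ x, x ∈ moved M \ moved N ∧ x ≠ t := by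
    have h1 : #(moved M \ moved N) =
        #(moved N \ moved M) :=
      Finset.card_sdiff_comm (hMc.trans hNc.symm)
    have h2 : 1 < #(moved N \ moved M) := by
      rw [Finset.one_lt_card]
      exact ⟨u, by simp [hNu, hMu], v, by simp [hNv, hMv], huv⟩
    rw [← h1] at h2
    exact Finset.exists_mem_ne h2 t
  simp only [Finset.mem_sdiff, mem_moved, not_not] at hx
  obtain ⟨hMx, hNx⟩ := hx
  set y := M x with hy
  have hxy := hM.adj x hMx
  have hMy : M y = x := hM.invol x
  have hR := hNi.rematch hxy hNx
  set N' : V → V := fun w => if w = x then y else if w = y then x else if w = N y then w else N w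
    with hN'
  -- Otherwise the edge `xy` of `M` could be added to `N`.
  have hNy : N y ≠ y := by
    intro hNy
    have h3 : insert x (insert y (moved N)) ⊆ moved N' := by
      intro w hw
      simp only [Finset.mem_insert, mem_moved] at hw ⊢
      simp only [hN']
      grind
    have h4 := Finset.card_le_card h3
    rw [Finset.card_insert_of_notMem, Finset.card_insert_of_notMem] at h4
    · have := hν _ hR
      omega
    · simp [hNy]
    · simp [hNx, hMx.symm]
  have hNNy := hNi.invol y
  have h5 : moved N' = insert x ((moved N).erase (N y)) := by
    ext w
    simp only [Finset.mem_insert, mem_moved, Finset.mem_erase]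
    simp only [hN']
    grind
  have h6 : #(moved N') = 2 * ν := by
    rw [h5, Finset.card_insert_of_notMem, Finset.card_erase_of_mem, hNc]
    · have : 0 < #(moved N) := Finset.card_pos.2 ⟨u, by simp [hNu]⟩
      omega
    · simp only [mem_moved, hNNy]
      exact hNy.symm
    · simp [hNx]
  have h7 : N' t = t := by
    simp only [hN']
    grind
  -- Exchanging the edge of `N` at `y` for `xy` gains an edge of `M` and loses none, as `M` pairs
  -- `y` with `x`. This contradicts the choice of `N`.
  have h8 : ({w | M w = N w ∧ M w ≠ w} : Finset V) ⊂
      ({w | M w = N' w ∧ M w ≠ w} : Finset V) := by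
    rw [Finset.ssubset_iff_of_subset]
    · refine ⟨x, by simp [hN', ← hy, hMx], ?_⟩
      simp only [Finset.mem_filter, Finset.mem_univ, true_and, not_and, hNx]
      exact fun h => absurd (hy.trans h) hMx
    · intro w hw
      simp only [Finset.mem_filter, Finset.mem_univ, true_and, hN'] at hw ⊢
      have := hM.invol w
      grind
  have h9 := hmax ⟨hR, h6, h7⟩ (Finset.card_le_card h8.subset)
  exact absurd (Finset.card_lt_card h8) (not_lt.2 h9)

/-- Two adjacent vertices are never both missed, since their edge could be added; transitivity
carries this along the walk. So a maximum matching misses at most one vertex of each component. -/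
theorem not_both_fixed_of_reachable {ν : ℕ}
    (hν : ∀ f, MatchingInvolution Γ f → #(moved f) ≤ 2 * ν)
    (hmiss : ∀ t, ∃ f, MatchingInvolution Γ f ∧ #(moved f) = 2 * ν ∧ f t = t)
    {u v : V} (p : Γ.Walk u v) (huv : u ≠ v) :
    ∀ f, MatchingInvolution Γ f → #(moved f) = 2 * ν → ¬(f u = u ∧ f v = v) := by
  have hadj : ∀ a b, Γ.Adj a b → ∀ f, MatchingInvolution Γ f → #(moved f) = 2 * ν →
      ¬(f a = a ∧ f b = b) := by
    rintro a b hab f hf hfc ⟨ha, hb⟩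
    have hR := hf.rematch hab ha
    have h3 : insert a (insert b (moved f)) ⊆
        moved (fun w => if w = a then b else if w = b then a else if w = f b then w else f w) := by
      intro w hw
      have := hab.ne
      simp only [Finset.mem_insert, mem_moved] at hw ⊢
      grind
    have h4 := Finset.card_le_card h3
    rw [Finset.card_insert_of_notMem, Finset.card_insert_of_notMem] at h4
    · have := hν _ hR
      omega
    · simp [hb]
    · simp [ha, hab.ne]
  induction p with
  | nil => exact (huv rfl).elim
  | @cons a b c hab p ih =>
    by_cases hbc : b = c
    · subst hbc
      exact hadj _ _ hab
    · exact not_both_fixed_trans hν huv (hmiss b) (hadj _ _ hab) (ih hbc)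

end MatchingInvolution

open MatchingInvolution

variable {V : Type*} [Fintype V] [LinearOrder V]

/-- By Gallai's lemma a component with `c + 1` vertices has at least `c` of them covered. Apart from
the exceptional vertices its degrees are at most `min Δ c`, and `(c + 1) * min Δ c ≤ c * (Δ + 1)`.
Summing over the components bounds twice the number of edges. -/
theorem card_edgeFinset_le_of_all_missed {Γ : SimpleGraph V} [DecidableRel Γ.Adj] {Δ ν : ℕ}
    {R : Finset V} (hdeg : ∀ v, v ∉ R → Γ.degree v ≤ Δ) (hR : ∀ v ∈ R, Γ.degree v ≤ Δ + 1)
    (hν : ∀ f, MatchingInvolution Γ f → #(moved f) ≤ 2 * ν)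
    (hatt : ∃ f, MatchingInvolution Γ f ∧ #(moved f) = 2 * ν)
    (hmiss : ∀ t, ∃ f, MatchingInvolution Γ f ∧ #(moved f) = 2 * ν ∧ f t = t) :
    #Γ.edgeFinset ≤ ν * (Δ + 1) + #R := by
  classical
  obtain ⟨f, hf, hfc⟩ := hatt
  have hcomp : ∀ C : Γ.ConnectedComponent,
      ∑ v with Γ.connectedComponentMk v = C, Γ.degree v ≤
        ∑ v with Γ.connectedComponentMk v = C,
          ((if f v ≠ v then Δ + 1 else 0) + if v ∈ R then 1 else 0) := by
    intro C
    set T : Finset V := {v | Γ.connectedComponentMk v = C} with hT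
    have h1 : ∀ v ∈ T, Γ.degree v + 1 ≤ #T := by
      intro v hv
      rw [← Γ.card_neighborFinset_eq_degree v, ← Finset.card_insert_of_notMem (a := v)]
      · refine Finset.card_le_card fun w hw => ?_
        rw [Finset.mem_insert] at hw
        rcases hw with rfl | hw
        · exact hv
        · simp only [hT, Finset.mem_filter, Finset.mem_univ, true_and] at hv ⊢
          rw [← hv]
          rw [SimpleGraph.mem_neighborFinset] at hw
          exact SimpleGraph.ConnectedComponent.sound hw.symm.reachable
      · simp
    have h2 : #{v ∈ T | ¬ f v ≠ v} ≤ 1 := by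
      rw [Finset.card_le_one]
      intro a ha b hb
      simp only [hT, Finset.mem_filter, Finset.mem_univ, true_and, not_not] at ha hb
      by_contra hab
      obtain ⟨p⟩ := SimpleGraph.ConnectedComponent.exact (ha.1.trans hb.1.symm)
      exact MatchingInvolution.not_both_fixed_of_reachable hν hmiss p hab f hf hfc ⟨ha.2, hb.2⟩
    have h3 := Finset.card_filter_add_card_filter_not (s := T) (fun v => f v ≠ v)
    rw [Finset.sum_add_distrib, ← Finset.sum_filter, Finset.sum_const, smul_eq_mul]
    have h4 : ∑ v ∈ T, Γ.degree v ≤ ∑ v ∈ T, (min Δ (#T - 1) + if v ∈ R then 1 else 0) := by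
      refine Finset.sum_le_sum fun v hv => ?_
      have := h1 v hv
      by_cases hvR : v ∈ R
      · have := hR v hvR
        simp only [hvR, if_true]
        omega
      · have := hdeg v hvR
        simp only [hvR, if_false]
        omega
    rw [Finset.sum_add_distrib, Finset.sum_const, smul_eq_mul] at h4
    refine h4.trans (Nat.add_le_add_right ?_ _)
    have h5 : #T ≤ #{v ∈ T | f v ≠ v} + 1 := by omega
    rcases Nat.eq_zero_or_pos (#T) with h0 | h0
    · simp [h0]
    obtain ⟨c, hc⟩ : ∃ c, #T = c + 1 := ⟨#T - 1, by omega⟩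
    rw [hc] at h5 ⊢
    refine le_trans ?_ (Nat.mul_le_mul_right (Δ + 1) (by omega : c ≤ #{v ∈ T | f v ≠ v}))
    rw [Nat.add_sub_cancel]
    rcases le_total Δ c with h | h
    · rw [min_eq_left h]
      nlinarith
    · rw [min_eq_right h]
      nlinarith
  have h6 : ∑ v, Γ.degree v ≤ ∑ v, ((if f v ≠ v then Δ + 1 else 0) + if v ∈ R then 1 else 0) := by
    rw [← Finset.sum_fiberwise (s := Finset.univ) (g := Γ.connectedComponentMk),
      ← Finset.sum_fiberwise (s := Finset.univ) (g := Γ.connectedComponentMk)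
        (f := fun v => (if f v ≠ v then Δ + 1 else 0) + if v ∈ R then 1 else 0)]
    exact Finset.sum_le_sum fun C _ => hcomp C
  rw [Γ.sum_degrees_eq_twice_card_edges, Finset.sum_add_distrib, ← Finset.sum_filter,
    Finset.sum_const, smul_eq_mul,
    show #{v | f v ≠ v} = 2 * ν from hfc, ← Finset.sum_filter, Finset.sum_const, smul_eq_mul,
    Finset.filter_mem_eq_inter, Finset.univ_inter] at h6
  nlinarith

/-- A graph with matching number at most `ν` and with all degrees at most `Δ`, up to exceptional
vertices of degree `Δ + 1`. -/
theorem card_edgeFinset_le_of_matching_le {Δ ν : ℕ} (Γ : SimpleGraph V) [DecidableRel Γ.Adj]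
    {R : Finset V} (hdeg : ∀ v, v ∉ R → Γ.degree v ≤ Δ) (hR : ∀ v ∈ R, Γ.degree v ≤ Δ + 1)
    (hν : ∀ f, MatchingInvolution Γ f → #(moved f) ≤ 2 * ν) :
    #Γ.edgeFinset ≤ ν * (Δ + 1) + #R := by
  induction ν generalizing Γ R with
  | zero =>
    refine card_edgeFinset_le_of_all_missed hdeg hR hν ⟨_root_.id, .id Γ, by simp [moved]⟩ fun t =>
      ⟨_root_.id, .id Γ, by simp [moved]⟩
  | succ ν ih =>
    by_cases hatt : ∃ f, MatchingInvolution Γ f ∧ #(moved f) = 2 * (ν + 1)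
    · by_cases hmiss : ∀ t, ∃ f, MatchingInvolution Γ f ∧ #(moved f) = 2 * (ν + 1) ∧ f t = t
      · exact card_edgeFinset_le_of_all_missed hdeg hR hν hatt hmiss
      · push Not at hmiss
        -- Every maximum matching covers `v`, so deleting the edges at `v` lowers the matching
        -- number, at a cost of at most `Δ + 1` edges.
        obtain ⟨v, hv⟩ := hmiss
        classical
        have hle : Γ.deleteIncidenceSet v ≤ Γ := Γ.deleteIncidenceSet_le v
        have h1 := ih (Γ.deleteIncidenceSet v) (R := R.erase v) ?_ ?_ ?_
        · have h2 := Γ.card_edgeFinset_deleteIncidenceSet v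
          by_cases hvR : v ∈ R
          · have := Finset.card_erase_add_one hvR
            have := hR v hvR
            nlinarith [Nat.sub_le_iff_le_add.1 h2.ge]
          · rw [Finset.erase_eq_of_notMem hvR] at h1
            have := hdeg v hvR
            nlinarith [Nat.sub_le_iff_le_add.1 h2.ge]
        · intro w hw
          by_cases hwv : w = v
          · subst hwv
            rw [(SimpleGraph.degree_eq_zero _ _).2]
            · exact Nat.zero_le _
            · intro u hu
              rw [SimpleGraph.deleteIncidenceSet_adj] at hu
              exact hu.2.1 rfl
          · exact (SimpleGraph.degree_le_of_le hle).trans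
              (hdeg w fun h => hw (Finset.mem_erase.2 ⟨hwv, h⟩))
        · exact fun w hw => (SimpleGraph.degree_le_of_le hle).trans
            (hR w (Finset.mem_of_mem_erase hw))
        · intro f hf
          have h3 := hf.mono hle
          have h4 := hν f h3
          have h5 : f v = v := by
            by_contra h
            have := hf.adj v h
            rw [SimpleGraph.deleteIncidenceSet_adj] at this
            exact this.2.1 rfl
          have h6 : #(moved f) ≠ 2 * (ν + 1) := fun h => hv f h3 h h5
          rw [hf.card_moved] at *
          omega
    · push Not at hatt
      have h1 := ih Γ hdeg hR fun f hf => by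
        have h4 := hν f hf
        have h6 := hatt f hf
        rw [hf.card_moved] at *
        omega
      nlinarith

end MatchingNumber

/-! ### The bound `h ^ 2` and uniqueness of `K_{h,h}` -/

section SquareBound

variable {V : Type*} [DecidableEq V] {Γ : SimpleGraph V}

/-- The matching avoids the closed neighbourhood of `v`. -/
def AvoidsNeighbors (Γ : SimpleGraph V) (v : V) (A : Finset V) (f : V → V) : Prop :=
  ∀ a ∈ A, a ≠ v ∧ f a ≠ v ∧ ¬Γ.Adj v a ∧ ¬Γ.Adj v (f a)

theorem OrientedMatching.insert_update {A : Finset V} {f : V → V} (h : OrientedMatching Γ A f)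
    {p r : V} (hpr : Γ.Adj p r) (hp : p ∉ A ∪ A.image f) (hr : r ∉ A ∪ A.image f) :
    OrientedMatching Γ (insert p A) (Function.update f p r) := by
  simp only [Finset.mem_union, Finset.mem_image, not_or, not_exists, not_and] at hp hr
  have hu : ∀ a ∈ A, Function.update f p r a = f a := fun a ha =>
    Function.update_of_ne (ne_of_mem_of_not_mem ha hp.1) _ _
  refine ⟨?_, ?_, ?_⟩
  · intro a ha b hb hab
    rw [Finset.mem_coe, Finset.mem_insert] at ha hb
    rcases ha with rfl | ha <;> rcases hb with rfl | hb
    · rfl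
    · rw [hu b hb, Function.update_self] at hab
      exact (hr.2 b hb hab.symm).elim
    · rw [hu a ha, Function.update_self] at hab
      exact (hr.2 a ha hab).elim
    · rw [hu a ha, hu b hb] at hab
      exact h.inj ha hb hab
  · intro a ha
    rw [Finset.mem_insert] at ha
    rcases ha with rfl | ha
    · simpa using hpr
    · rw [hu a ha]
      exact h.adj a ha
  · intro a ha
    rw [Finset.mem_insert] at ha ⊢
    rcases ha with rfl | ha
    · rw [Function.update_self]
      exact fun h => h.elim (fun h => hpr.ne h.symm) hr.1
    · rw [hu a ha]
      exact fun h' => h'.elim (hp.2 a ha) (h.disj a ha)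

variable [Fintype V] [DecidableRel Γ.Adj]

theorem card_incidenceFinset_union_add_one_le {a b : V} (hab : Γ.Adj a b) :
    #(Γ.incidenceFinset a ∪ Γ.incidenceFinset b) + 1 ≤ Γ.degree a + Γ.degree b := by
  rw [← Γ.card_incidenceFinset_eq_degree, ← Γ.card_incidenceFinset_eq_degree,
    ← Finset.card_union_add_card_inter]
  refine Nat.add_le_add_left (Finset.card_pos.2 ⟨s(a, b), ?_⟩) _
  simp [SimpleGraph.mk'_mem_incidenceSet_iff, hab]

/-- Edge count through the neighbourhood of `v` and a maximal matching avoiding it. -/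
theorem exists_matching_edgeFinset_subset (Γ : SimpleGraph V) [DecidableRel Γ.Adj] (v : V) :
    ∃ A f, OrientedMatching Γ A f ∧ AvoidsNeighbors Γ v A f ∧
      Γ.edgeFinset ⊆ ((Γ.neighborFinset v).biUnion fun u => Γ.incidenceFinset u) ∪
        A.biUnion fun a => Γ.incidenceFinset a ∪ Γ.incidenceFinset (f a) := by
  -- With the matching as large as possible, an edge meeting neither a neighbour of `v` nor the
  -- matching could be added. Edges at `v` itself have a neighbour of `v` as their other end.
  obtain ⟨⟨A, f⟩, ⟨hA, hv⟩, hmax⟩ := Set.Finite.exists_maximalFor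
    (fun p : Finset V × (V → V) => #p.1)
    {p | OrientedMatching Γ p.1 p.2 ∧ AvoidsNeighbors Γ v p.1 p.2} (Set.toFinite _)
    ⟨(∅, id), ⟨by simp, by simp, by simp⟩, by simp [AvoidsNeighbors]⟩
  refine ⟨A, f, hA, hv, fun e he => ?_⟩
  induction e with | h p r => ?_
  rw [SimpleGraph.mem_edgeFinset, SimpleGraph.mem_edgeSet] at he
  simp only [Finset.mem_union, Finset.mem_biUnion, SimpleGraph.mem_neighborFinset,
    SimpleGraph.mem_incidenceFinset, SimpleGraph.mk'_mem_incidenceSet_iff]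
  by_contra hcon
  push Not at hcon
  obtain ⟨h1, h2⟩ := hcon
  have hvp : ¬Γ.Adj v p := fun h => (h1 p h he).1 rfl
  have hvr : ¬Γ.Adj v r := fun h => (h1 r h he).2 rfl
  have hpv : p ≠ v := fun h => hvr (h ▸ he)
  have hrv : r ≠ v := fun h => hvp (h ▸ he.symm)
  have hp : p ∉ A ∪ A.image f := by
    intro h
    rw [Finset.mem_union, Finset.mem_image] at h
    rcases h with h | ⟨a, ha, rfl⟩
    · exact ((h2 p h).1 he).1 rfl
    · exact ((h2 a ha).2 he).1 rfl
  have hr : r ∉ A ∪ A.image f := by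
    intro h
    rw [Finset.mem_union, Finset.mem_image] at h
    rcases h with h | ⟨a, ha, rfl⟩
    · exact ((h2 r h).1 he).2 rfl
    · exact ((h2 a ha).2 he).2 rfl
  have hpA : p ∉ A := fun h => hp (Finset.mem_union_left _ h)
  have hav : AvoidsNeighbors Γ v (insert p A) (Function.update f p r) := by
    intro a ha
    rw [Finset.mem_insert] at ha
    by_cases hap : a = p
    · subst hap
      simpa using ⟨hpv, hrv, hvp, hvr⟩
    · rw [Function.update_of_ne hap]
      exact hv a (ha.resolve_left hap)
  have h3 := hmax (j := (insert p A, Function.update f p r)) ⟨hA.insert_update he hp hr, hav⟩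
    (by simp [Finset.card_insert_of_notMem hpA])
  simp [Finset.card_insert_of_notMem hpA] at h3

/-- If the degree of each nonisolated vertex `v` and the size of each matching avoiding the closed
neighbourhood of `v` add up to at most `h`, then there are at most `h ^ 2` edges, with equality only
for `K_{h,h}`. -/
theorem card_edgeFinset_le_sq {h : ℕ} (Γ : SimpleGraph V) [DecidableRel Γ.Adj]
    (hP : ∀ v, 0 < Γ.degree v → ∀ A f, OrientedMatching Γ A f → AvoidsNeighbors Γ v A f →
      Γ.degree v + #A ≤ h) :
    #Γ.edgeFinset ≤ h ^ 2 ∧ (#Γ.edgeFinset = h ^ 2 → ∃ X Y : Finset V, Disjoint X Y ∧ #X = h ∧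
      #Y = h ∧ ∀ a b, Γ.Adj a b ↔ (a ∈ X ∧ b ∈ Y) ∨ (a ∈ Y ∧ b ∈ X)) := by
  by_cases hbot : ∀ v, Γ.degree v = 0
  · have hn : ∀ a b, ¬Γ.Adj a b := fun a b hab => (SimpleGraph.degree_eq_zero _ _).1 (hbot a) b hab
    have h0 : #Γ.edgeFinset = 0 := by
      rw [Finset.card_eq_zero, Finset.eq_empty_iff_forall_notMem]
      intro e he
      induction e with | h p r => ?_
      exact hn p r (by simpa using he)
    refine ⟨by omega, fun he => ⟨∅, ∅, by simp, ?_, ?_, by simpa using hn⟩⟩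
    all_goals
      rw [h0] at he
      rw [Finset.card_empty, (pow_eq_zero_iff two_ne_zero).1 he.symm]
  push Not at hbot
  obtain ⟨v, hv, hmax⟩ := Finset.exists_max_image Finset.univ (fun v => Γ.degree v)
    ⟨hbot.choose, Finset.mem_univ _⟩
  replace hmax : ∀ w, Γ.degree w ≤ Γ.degree v := fun w => hmax w (Finset.mem_univ w)
  have hv0 : 0 < Γ.degree v := (Nat.pos_of_ne_zero hbot.choose_spec).trans_le (hmax _)
  obtain ⟨A, f, hA, hav, hsub⟩ := exists_matching_edgeFinset_subset Γ v
  have hm := hP v hv0 A f hA hav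
  have hN : #((Γ.neighborFinset v).biUnion fun u => Γ.incidenceFinset u) ≤ Γ.degree v * Γ.degree v := by
    refine (Finset.card_biUnion_le_card_mul _ _ (Γ.degree v) fun u _ => ?_).trans_eq ?_
    · rw [Γ.card_incidenceFinset_eq_degree]
      exact hmax u
    · rw [Γ.card_neighborFinset_eq_degree]
  have hM : #(A.biUnion fun a => Γ.incidenceFinset a ∪ Γ.incidenceFinset (f a)) ≤
      #A * (2 * Γ.degree v - 1) := by
    refine Finset.card_biUnion_le_card_mul _ _ _ fun a ha => ?_
    have := card_incidenceFinset_union_add_one_le (hA.adj a ha)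
    have := hmax a
    have := hmax (f a)
    omega
  have hE : #Γ.edgeFinset ≤ Γ.degree v * Γ.degree v + #A * (2 * Γ.degree v - 1) :=
    (Finset.card_le_card hsub).trans ((Finset.card_union_le _ _).trans (Nat.add_le_add hN hM))
  obtain ⟨d, hd⟩ : ∃ d, Γ.degree v = d + 1 := ⟨Γ.degree v - 1, by omega⟩
  -- For `d = d(v)` maximal and `a = |A|`, `d² + a(2d - 1) = (d + a)² - a² - a`. Hence equality also
  -- forces the matching to be empty.
  have hE' : #Γ.edgeFinset + #A * #A + #A ≤ h ^ 2 := by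
    have : (Γ.degree v + #A) ^ 2 ≤ h ^ 2 := Nat.pow_le_pow_left hm 2
    rw [hd] at hE this
    rw [show 2 * (d + 1) - 1 = 2 * d + 1 by omega] at hE
    nlinarith
  refine ⟨by omega, fun he => ?_⟩
  have hA0 : #A = 0 := by omega
  have hdh : Γ.degree v = h := by
    rw [hA0, he] at hE
    rw [hA0] at hm
    nlinarith
  rw [Finset.card_eq_zero] at hA0
  -- every vertex of degree `h` has the following property
  have key : ∀ w, Γ.degree w = h → (∀ p r, Γ.Adj p r → Γ.Adj w p ∨ Γ.Adj w r) ∧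
      (∀ p r, Γ.Adj w p → Γ.Adj w r → ¬Γ.Adj p r) ∧ ∀ p, Γ.Adj w p → Γ.degree p = h := by
    intro w hw
    obtain ⟨A, f, hA, hav, hsub⟩ := exists_matching_edgeFinset_subset Γ w
    have hm := hP w (by omega) A f hA hav
    have hA0 : A = ∅ := by
      rw [← Finset.card_eq_zero]
      omega
    subst hA0
    rw [Finset.biUnion_empty, Finset.union_empty] at hsub
    have hc := Finset.card_le_card hsub
    -- The `h ^ 2` edges are covered by `h` stars of at most `h` edges each. So the stars are
    -- edge-disjoint, which excludes edges between neighbours of `w`, and all of them are full.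
    have hs : ∑ u ∈ Γ.neighborFinset w, #(Γ.incidenceFinset u) ≤ h ^ 2 := by
      refine (Finset.sum_le_card_nsmul _ _ h fun u _ => ?_).trans_eq ?_
      · rw [Γ.card_incidenceFinset_eq_degree, ← hdh]
        exact hmax u
      · rw [Γ.card_neighborFinset_eq_degree, hw, smul_eq_mul, sq]
    refine ⟨fun p r hpr => ?_, fun p r hp hr hpr => ?_, fun p hp => ?_⟩
    · have := hsub ((SimpleGraph.mem_edgeFinset (e := s(p, r))).2 hpr)
      simp only [Finset.mem_biUnion, SimpleGraph.mem_neighborFinset,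
        SimpleGraph.mem_incidenceFinset, SimpleGraph.mk'_mem_incidenceSet_iff] at this
      obtain ⟨a, hwa, -, rfl | rfl⟩ := this
      · exact .inl hwa
      · exact .inr hwa
    · have hlt : #((Γ.neighborFinset w).biUnion fun u => Γ.incidenceFinset u) <
          ∑ u ∈ Γ.neighborFinset w, #(Γ.incidenceFinset u) := by
        have hr' : r ∈ (Γ.neighborFinset w).erase p := by simp [hr, hpr.ne']
        rw [← Finset.insert_erase ((Γ.mem_neighborFinset w p).2 hp), Finset.biUnion_insert,
          Finset.sum_insert (Finset.notMem_erase _ _)]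
        have h1 : s(p, r) ∈ Γ.incidenceFinset p ∩
            (((Γ.neighborFinset w).erase p).biUnion fun u => Γ.incidenceFinset u) := by
          rw [Finset.mem_inter, Finset.mem_biUnion]
          refine ⟨?_, r, hr', ?_⟩ <;> simp [SimpleGraph.mk'_mem_incidenceSet_iff, hpr]
        have h2 := Finset.card_union_add_card_inter (Γ.incidenceFinset p)
          (((Γ.neighborFinset w).erase p).biUnion fun u => Γ.incidenceFinset u)
        have h3 := Finset.card_pos.2 ⟨_, h1⟩
        have h4 : #(((Γ.neighborFinset w).erase p).biUnion fun u => Γ.incidenceFinset u) ≤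
          ∑ u ∈ (Γ.neighborFinset w).erase p, #(Γ.incidenceFinset u) := Finset.card_biUnion_le
        omega
      omega
    · by_contra hne
      have hlt : ∑ u ∈ Γ.neighborFinset w, #(Γ.incidenceFinset u) <
          ∑ u ∈ Γ.neighborFinset w, h := by
        refine Finset.sum_lt_sum (fun u _ => ?_) ⟨p, (Γ.mem_neighborFinset w p).2 hp, ?_⟩
        · rw [Γ.card_incidenceFinset_eq_degree, ← hdh]
          exact hmax u
        · rw [Γ.card_incidenceFinset_eq_degree]
          exact lt_of_le_of_ne (hdh ▸ hmax p) hne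
      rw [Finset.sum_const, Γ.card_neighborFinset_eq_degree, hw, smul_eq_mul, ← sq] at hlt
      have : #((Γ.neighborFinset w).biUnion fun u => Γ.incidenceFinset u) ≤ _ := Finset.card_biUnion_le
      omega
  obtain ⟨k1, k2, k3⟩ := key v hdh
  obtain ⟨u, hu⟩ : ∃ u, Γ.Adj v u := by
    rw [← Γ.card_neighborFinset_eq_degree, Finset.card_pos] at hv0
    obtain ⟨u, hu⟩ := hv0
    exact ⟨u, by simpa using hu⟩
  have hud := k3 u hu
  obtain ⟨l1, l2, l3⟩ := key u hud
  have hdisj : ∀ w, Γ.Adj v w → ¬Γ.Adj u w := fun w hw huw => k2 u w hu hw huw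
  have hfw : ∀ a b, Γ.Adj a b → (Γ.Adj v a ∧ Γ.Adj u b) ∨ (Γ.Adj u a ∧ Γ.Adj v b) := by
    intro a b hab
    have := k1 a b hab
    have := l1 a b hab
    have := hdisj a
    have := hdisj b
    tauto
  -- For an edge `vu` both ends have the property just proved, so every edge runs between the
  -- disjoint sets `N(v)` and `N(u)`, and full degrees make the pair complete.
  refine ⟨Γ.neighborFinset v, Γ.neighborFinset u, ?_, ?_, ?_, ?_⟩
  · rw [Finset.disjoint_left]
    simpa using hdisj
  · rw [Γ.card_neighborFinset_eq_degree, hdh]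
  · rw [Γ.card_neighborFinset_eq_degree, hud]
  · have hcomp : ∀ a b, Γ.Adj v a → Γ.Adj u b → Γ.Adj a b := by
      intro a b ha hb
      have h1 : Γ.neighborFinset a ⊆ Γ.neighborFinset u := by
        intro c hc
        rw [SimpleGraph.mem_neighborFinset] at hc ⊢
        have := hfw a c hc
        have := hdisj a ha
        tauto
      have h2 := Finset.eq_of_subset_of_card_le h1
        (by rw [Γ.card_neighborFinset_eq_degree, Γ.card_neighborFinset_eq_degree, hud, k3 a ha])
      rw [← SimpleGraph.mem_neighborFinset, h2]
      simpa using hb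
    intro a b
    simp only [SimpleGraph.mem_neighborFinset]
    exact ⟨hfw a b, fun h => h.elim (fun h => hcomp a b h.1 h.2) fun h => (hcomp b a h.2 h.1).symm⟩

end SquareBound

/-! ### Edges inside the classes against missing edges between them -/

section ClassEdges

theorem numEdges_eq_card_edgeFinset {V : Type*} (G : SimpleGraph V) [Fintype G.edgeSet] :
    numEdges G = #G.edgeFinset := by
  rw [numEdges, Set.ncard_eq_toFinset_card', SimpleGraph.edgeFinset]

theorem ncard_neighborSet {V : Type*} (G : SimpleGraph V) (v : V) [Fintype (G.neighborSet v)] :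
    (G.neighborSet v).ncard = G.degree v := by
  rw [Set.ncard_eq_toFinset_card', SimpleGraph.degree, SimpleGraph.neighborFinset]

variable {V : Type*}

/-- The edges of `G` with both ends in `S`. -/
def within (G : SimpleGraph V) (S : Set V) : SimpleGraph V where
  Adj a b := G.Adj a b ∧ a ∈ S ∧ b ∈ S
  symm := ⟨fun _ _ h => ⟨h.1.symm, h.2.2, h.2.1⟩⟩
  loopless := ⟨fun _ h => G.irrefl h.1⟩

@[simp]
theorem within_adj {G : SimpleGraph V} {S : Set V} {a b : V} :
    (within G S).Adj a b ↔ G.Adj a b ∧ a ∈ S ∧ b ∈ S := Iff.rfl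

/-- The edges of `G` inside one of the two classes. -/
abbrev mono (G : SimpleGraph V) (P : Bool → Set V) : SimpleGraph V :=
  within G (P false) ⊔ within G (P true)

/-- The missing edges between the two classes. -/
def missing (G : SimpleGraph V) (P : Bool → Set V) : Set (V × V) :=
  {p | p.1 ∈ P false ∧ p.2 ∈ P true ∧ ¬G.Adj p.1 p.2}

/-- The matching has, in the class opposite to that of `v ∈ P i`, only edges with an end adjacent
to `v`. -/
def ReachableFrom (G : SimpleGraph V) (P : Bool → Set V) (i : Bool) (v : V) (A : Finset V)
    (f : V → V) : Prop :=
  ∀ a ∈ A, a ∈ P (!i) → G.Adj v a ∨ G.Adj v (f a)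

/-- Any `h + 1` edges inside the classes that are attached to `v` or can be reached from `v`
are too many. -/
def FewGadgets (G : SimpleGraph V) (P : Bool → Set V) (h : ℕ) : Prop :=
  ∀ i, ∀ v ∈ P i, ∀ (A : Finset V) (f : V → V), OrientedMatching (mono G P) A f →
    AvoidsNeighbors (mono G P) v A f → ReachableFrom G P i v A f →
    ((mono G P).neighborSet v).ncard + #A ≤ h

theorem mono_adj_iff {G : SimpleGraph V} {P : Bool → Set V} (hdisj : Disjoint (P false) (P true))
    {i : Bool} {a b : V} (ha : a ∈ P i) : (mono G P).Adj a b ↔ (within G (P i)).Adj a b := by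
  have := Set.disjoint_left.1 hdisj
  cases i <;> simp only [SimpleGraph.sup_adj, within_adj] <;> grind

variable [Fintype V] [LinearOrder V]

/-- A matching inside the class of `v` has no edge in the opposite class, so the reachability
condition is vacuous. -/
theorem numEdges_within_le_sq {G : SimpleGraph V} {P : Bool → Set V} {h : ℕ}
    (hdisj : Disjoint (P false) (P true)) (hG : FewGadgets G P h) (i : Bool) :
    numEdges (within G (P i)) ≤ h ^ 2 ∧ (numEdges (within G (P i)) = h ^ 2 →
      ∃ X Y : Finset V, Disjoint X Y ∧ #X = h ∧
      #Y = h ∧ ∀ a b, (within G (P i)).Adj a b ↔ (a ∈ X ∧ b ∈ Y) ∨ (a ∈ Y ∧ b ∈ X)) := by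
  classical
  rw [numEdges_eq_card_edgeFinset]
  refine card_edgeFinset_le_sq _ fun v hv A f hA hav => ?_
  have hvP : v ∈ P i := by
    rw [← (within G (P i)).card_neighborFinset_eq_degree, Finset.card_pos] at hv
    obtain ⟨u, hu⟩ := hv
    rw [SimpleGraph.mem_neighborFinset] at hu
    exact hu.2.1
  have hle : within G (P i) ≤ mono G P := by
    cases i
    · exact le_sup_left
    · exact le_sup_right
  have h1 := hG i v hvP A f ⟨hA.inj, fun a ha => hle (hA.adj a ha), hA.disj⟩
    (fun a ha => by
      rw [mono_adj_iff hdisj hvP, mono_adj_iff hdisj hvP]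
      exact hav a ha)
    (fun a ha ha' => by
      have h2 := (hA.adj a ha).2.1
      have h3 := Set.disjoint_left.1 hdisj
      cases i
      · exact (h3 h2 ha').elim
      · exact (h3 ha' h2).elim)
  rwa [show (mono G P).neighborSet v = (within G (P i)).neighborSet v from
    Set.ext fun b => mono_adj_iff hdisj hvP, ncard_neighborSet] at h1

/-- With edges in both classes and some, but few, missing edges, the number of edges inside the
classes does not reach the bound. -/
theorem numEdges_mono_lt {G : SimpleGraph V} {P : Bool → Set V} {h : ℕ}
    (hdisj : Disjoint (P false) (P true)) (hG : FewGadgets G P h)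
    {w : V} (hw : w ∈ P false) (hw0 : ∀ b, ¬(mono G P).Adj w b) (hwP : ∀ b ∈ P true, G.Adj w b)
    {a₀ b₀ a₁ b₁ : V} (hab₀ : (within G (P false)).Adj a₀ b₀)
    (hab₁ : (within G (P true)).Adj a₁ b₁) (hm : (missing G P).Nonempty) :
    numEdges (mono G P) < h ^ 2 + (missing G P).ncard := by
  classical
  set Γ := mono G P with hΓ
  have hle : ∀ i, within G (P i) ≤ Γ := fun i => by
    cases i
    · exact le_sup_left
    · exact le_sup_right
  have hdj := Set.disjoint_left.1 hdisj
  -- As `w` is isolated inside its class and joined to the whole opposite class, every matching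
  -- avoids it and is reachable from it. Thus the matching number is at most `h`.
  have hw1 : ∀ A f, OrientedMatching Γ A f → #A ≤ h := by
    intro A f hA
    have hne : ∀ a b, Γ.Adj a b → a ≠ w := fun a b hab h => hw0 b (h ▸ hab)
    have := hG false w hw A f hA
      (fun a ha => ⟨hne a _ (hA.adj a ha), hne _ _ (hA.adj a ha).symm, hw0 _, hw0 _⟩)
      (fun a ha ha' => .inl (hwP a ha'))
    omega
  have hdeg : ∀ v, Γ.degree v ≤ h := by
    intro v
    by_cases hv : ∃ i, v ∈ P i
    · obtain ⟨i, hi⟩ := hv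
      have := hG i v hi ∅ id ⟨by simp, by simp, by simp⟩ (by simp [AvoidsNeighbors])
        (by simp [ReachableFrom])
      rwa [ncard_neighborSet, Finset.card_empty, add_zero] at this
    · push Not at hv
      rw [(SimpleGraph.degree_eq_zero _ _).2]
      · exact Nat.zero_le _
      · intro b hb
        rcases hb with hb | hb
        · exact hv _ hb.2.1
        · exact hv _ hb.2.1
  -- One edge from each class form a matching of size two.
  have h2 : 2 ≤ h := by
    have hne : a₀ ≠ a₁ ∧ a₀ ≠ b₁ ∧ b₀ ≠ a₁ ∧ b₀ ≠ b₁ := by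
      refine ⟨?_, ?_, ?_, ?_⟩ <;> rintro rfl
      exacts [hdj hab₀.2.1 hab₁.2.1, hdj hab₀.2.1 hab₁.2.2, hdj hab₀.2.2 hab₁.2.1,
        hdj hab₀.2.2 hab₁.2.2]
    have h0 : OrientedMatching Γ ∅ id := ⟨by simp, by simp, by simp⟩
    have h1 := h0.insert_update (hle _ hab₀) (by simp) (by simp)
    have h2 := hw1 _ _ (h1.insert_update (hle _ hab₁) (by simp; tauto) (by simp; tauto))
    rwa [Finset.card_insert_of_notMem (by simp; tauto), Finset.card_insert_of_notMem (by simp),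
      Finset.card_empty] at h2
  -- `R` collects the vertices of full degree and `U` the nonisolated ones. If `x ∈ R i` were
  -- adjacent to `a ∈ U (!i)`, an edge at `a` inside its class would be one gadget too many for `x`;
  -- so all pairs between `R i` and `U (!i)` are missing.
  set R : Bool → Finset V := fun i => {v | v ∈ P i ∧ Γ.degree v = h} with hR
  set U : Bool → Finset V := fun i => {v | v ∈ P i ∧ 0 < Γ.degree v} with hU
  have hRU : ∀ i, R i ⊆ U i := by
    intro i v hv
    simp only [hR, hU, Finset.mem_filter, Finset.mem_univ, true_and] at hv ⊢
    exact ⟨hv.1, by omega⟩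
  have hmiss : ∀ i, ∀ x ∈ R i, ∀ a ∈ U (!i), ¬G.Adj x a := by
    intro i x hx a ha hxa
    simp only [hR, hU, Finset.mem_filter, Finset.mem_univ, true_and] at hx ha
    obtain ⟨b, hb⟩ : ∃ b, Γ.Adj a b := by
      rw [← Γ.card_neighborFinset_eq_degree a, Finset.card_pos] at ha
      obtain ⟨b, hb⟩ := ha.2
      exact ⟨b, by simpa using hb⟩
    have hb' := (mono_adj_iff hdisj ha.1).1 hb
    have h0 : OrientedMatching Γ ∅ id := ⟨by simp, by simp, by simp⟩
    have h1 := h0.insert_update hb (by simp) (by simp)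
    have hno : ∀ c ∈ P (!i), ¬Γ.Adj x c ∧ c ≠ x := by
      intro c hc
      rw [mono_adj_iff hdisj hx.1]
      constructor
      · intro h
        have := h.2.2
        cases i <;> simp at hc this <;> grind
      · rintro rfl
        have := hx.1
        cases i <;> simp at hc this <;> grind
    have := hG i x hx.1 _ _ h1
      (by
        intro c hc
        obtain rfl : c = a := by simpa using hc
        rw [Function.update_self]
        exact ⟨(hno c ha.1).2, (hno b hb'.2.2).2, (hno c ha.1).1, (hno b hb'.2.2).1⟩) (by simpa [ReachableFrom] using fun _ => .inl hxa)
    rw [ncard_neighborSet, hx.2] at this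
    simp at this
  -- The maximum degree is taken to be `h - 1` with `R` exceptional, so the bound reads `h * h +
  -- |R|`.
  have hvz := card_edgeFinset_le_of_matching_le (Δ := h - 1) (ν := h) Γ (R := R false ∪ R true) ?_ ?_ ?_
  rotate_left
  · intro v hv
    have := hdeg v
    by_contra hcon
    refine hv ?_
    have hvh : Γ.degree v = h := by omega
    obtain ⟨b, hb⟩ : ∃ b, Γ.Adj v b := by
      have : 0 < Γ.degree v := by omega
      rw [← Γ.card_neighborFinset_eq_degree v, Finset.card_pos] at this
      obtain ⟨b, hb⟩ := this
      exact ⟨b, by simpa using hb⟩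
    simp only [hR, Finset.mem_union, Finset.mem_filter, Finset.mem_univ, true_and]
    rcases hb with hb | hb
    · exact .inl ⟨hb.2.1, hvh⟩
    · exact .inr ⟨hb.2.1, hvh⟩
  · intro v _
    have := hdeg v
    omega
  · intro f hf
    rw [hf.card_moved]
    have := hw1 _ f hf.orientedMatching
    omega
  rw [Nat.sub_add_cancel (by omega), ← sq] at hvz
  have hRc := Finset.card_union_le (R false) (R true)
  have hD1 : #(R false) * #(U true) ≤ (missing G P).ncard := by
    rw [← Finset.card_product, ← Set.ncard_coe_finset]
    refine Set.ncard_le_ncard (fun p hp => ?_) (Set.toFinite _)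
    rw [Finset.mem_coe, Finset.mem_product] at hp
    have h1 := hmiss false _ hp.1 _ hp.2
    simp only [hR, hU, Finset.mem_filter, Finset.mem_univ, true_and] at hp
    exact ⟨hp.1.1, hp.2.1, h1⟩
  have hD2 : #(U false) * #(R true) ≤ (missing G P).ncard := by
    rw [← Finset.card_product, ← Set.ncard_coe_finset]
    refine Set.ncard_le_ncard (fun p hp => ?_) (Set.toFinite _)
    rw [Finset.mem_coe, Finset.mem_product] at hp
    have h1 := hmiss true _ hp.2 _ hp.1
    simp only [hR, hU, Finset.mem_filter, Finset.mem_univ, true_and] at hp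
    exact ⟨hp.1.1, hp.2.1, fun h => h1 h.symm⟩
  have hDpos : 0 < (missing G P).ncard := (Set.ncard_pos).2 hm
  have hU2 : ∀ i a b, (within G (P i)).Adj a b → 2 ≤ #(U i) := by
    intro i a b hab
    have h1 : ({a, b} : Finset V) ⊆ U i := by
      intro c hc
      simp only [Finset.mem_insert, Finset.mem_singleton] at hc
      simp only [hU, Finset.mem_filter, Finset.mem_univ, true_and]
      rcases hc with rfl | rfl
      · exact ⟨hab.2.1, (SimpleGraph.degree_pos_iff_exists_adj _ _).2 ⟨_, hle i hab⟩⟩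
      · exact ⟨hab.2.2, (SimpleGraph.degree_pos_iff_exists_adj _ _).2 ⟨_, hle i hab.symm⟩⟩
    have h2 := Finset.card_le_card h1
    rwa [Finset.card_pair hab.1.ne] at h2
  have hU3 : ∀ i, 0 < #(R i) → 3 ≤ #(U i) := by
    intro i hi
    obtain ⟨x, hx⟩ := Finset.card_pos.1 hi
    have hx' := hx
    simp only [hR, Finset.mem_filter, Finset.mem_univ, true_and] at hx
    have h1 : insert x (Γ.neighborFinset x) ⊆ U i := by
      intro c hc
      rw [Finset.mem_insert, SimpleGraph.mem_neighborFinset] at hc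
      rcases hc with rfl | hc
      · exact hRU i hx'
      · simp only [hU, Finset.mem_filter, Finset.mem_univ, true_and]
        exact ⟨((mono_adj_iff hdisj hx.1).1 hc).2.2,
          (SimpleGraph.degree_pos_iff_exists_adj _ _).2 ⟨_, hc.symm⟩⟩
    have h2 := Finset.card_le_card h1
    rw [Finset.card_insert_of_notMem (by simp), Γ.card_neighborFinset_eq_degree, hx.2] at h2
    omega
  have hu0 := hU2 false _ _ hab₀
  have hu1 := hU2 true _ _ hab₁
  rw [← numEdges_eq_card_edgeFinset] at hvz
  refine hvz.trans_lt (Nat.add_lt_add_left (hRc.trans_lt ?_) _)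
  -- Missing pairs number at least `|R i| * |U (!i)|`. If just one `R i` is nonempty, the factor `|U
  -- (!i)| ≥ 2` suffices; if both are, each `U` has at least three elements and averaging the two
  -- estimates gives `3/2 * |R|`.
  rcases Nat.eq_zero_or_pos #(R false) with h0 | h0 <;>
    rcases Nat.eq_zero_or_pos #(R true) with h1 | h1
  · omega
  · nlinarith
  · nlinarith
  · have := hU3 false h0
    have := hU3 true h1
    nlinarith

/-- The edges inside the two classes outnumber the missing edges between them by at most `h ^ 2`,
with equality only if they form a `K_{h,h}` and no edge is missing. -/
theorem numEdges_mono_le {G : SimpleGraph V} {P : Bool → Set V} {h : ℕ}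
    (hdisj : Disjoint (P false) (P true)) (hG : FewGadgets G P h) {W : Set V}
    (hW : W ⊆ P false) (hW0 : ∀ w ∈ W, ∀ b, ¬(mono G P).Adj w b) (hWc : 2 * h ^ 2 < W.ncard) :
    numEdges (mono G P) ≤ h ^ 2 + (missing G P).ncard ∧
      (numEdges (mono G P) = h ^ 2 + (missing G P).ncard → missing G P = ∅ ∧
        ∃ X Y : Finset V, Disjoint X Y ∧ #X = h ∧ #Y = h ∧
          ∀ a b, (mono G P).Adj a b ↔ (a ∈ X ∧ b ∈ Y) ∨ (a ∈ Y ∧ b ∈ X)) := by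
  classical
  have hside := numEdges_within_le_sq hdisj hG
  have hsub : numEdges (mono G P) ≤
      numEdges (within G (P false)) + numEdges (within G (P true)) := by
    rw [numEdges, SimpleGraph.edgeSet_sup]
    exact Set.ncard_union_le _ _
  have hzero : ∀ i, mono G P = within G (P i) → numEdges (mono G P) ≤ h ^ 2 + (missing G P).ncard ∧
      (numEdges (mono G P) = h ^ 2 + (missing G P).ncard → missing G P = ∅ ∧
        ∃ X Y : Finset V, Disjoint X Y ∧ #X = h ∧ #Y = h ∧
          ∀ a b, (mono G P).Adj a b ↔ (a ∈ X ∧ b ∈ Y) ∨ (a ∈ Y ∧ b ∈ X)) := by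
    intro i hi
    rw [hi]
    have := hside i
    refine ⟨by omega, fun he => ⟨?_, this.2 (by omega)⟩⟩
    rw [← Set.ncard_eq_zero (Set.toFinite _)]
    omega
  by_cases h0 : within G (P false) = ⊥
  · exact hzero true (by rw [mono, h0, bot_sup_eq])
  by_cases h1 : within G (P true) = ⊥
  · exact hzero false (by rw [mono, h1, sup_bot_eq])
  rcases (missing G P).eq_empty_or_nonempty with hm | hm
  -- Without missing pairs every matching edge is reachable, so the square bound applies to both
  -- classes at once.
  · have hall := card_edgeFinset_le_sq (h := h) (mono G P) fun v hv A f hA hav => by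
      rw [← SimpleGraph.card_neighborFinset_eq_degree, Finset.card_pos] at hv
      obtain ⟨u, hu⟩ := hv
      rw [SimpleGraph.mem_neighborFinset] at hu
      obtain ⟨i, hi⟩ : ∃ i, v ∈ P i := hu.elim (fun h => ⟨_, h.2.1⟩) fun h => ⟨_, h.2.1⟩
      rw [← ncard_neighborSet]
      refine hG i v hi A f hA hav fun a _ ha' => .inl ?_
      by_contra hcon
      have : (v, a) ∈ missing G P ∨ (a, v) ∈ missing G P := by
        cases i
        · exact .inl ⟨hi, ha', hcon⟩
        · exact .inr ⟨ha', hi, fun h => hcon h.symm⟩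
      simp [hm] at this
    rw [← numEdges_eq_card_edgeFinset] at hall
    rw [hm, Set.ncard_empty, add_zero]
    exact ⟨hall.1, fun he => ⟨rfl, hall.2 he⟩⟩
  · have hlt : numEdges (mono G P) < h ^ 2 + (missing G P).ncard := by
      -- With more than `2 * h ^ 2` missing pairs the bounds for the single classes suffice.
      -- Otherwise `W` has more vertices than there are missing pairs, so some `w ∈ W` lies in none.
      by_cases hD : 2 * h ^ 2 < (missing G P).ncard
      · have := (hside false).1
        have := (hside true).1
        omega
      · obtain ⟨w, hw, hwm⟩ : ∃ w ∈ W, w ∉ Prod.fst '' missing G P :=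
          Set.exists_mem_notMem_of_ncard_lt_ncard
            ((Set.ncard_image_le (Set.toFinite _)).trans_lt (by omega)) (Set.toFinite _)
        obtain ⟨a₀, b₀, hab₀⟩ := SimpleGraph.ne_bot_iff_exists_adj.1 h0
        obtain ⟨a₁, b₁, hab₁⟩ := SimpleGraph.ne_bot_iff_exists_adj.1 h1
        refine numEdges_mono_lt hdisj hG (hW hw) (hW0 w hw) (fun b hb => ?_) hab₀ hab₁ hm
        by_contra hcon
        exact hwm ⟨(w, b), ⟨hW hw, hb, hcon⟩, rfl⟩
    exact ⟨hlt.le, fun he => absurd he hlt.ne⟩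

end ClassEdges

/-! ### Extending partial embeddings by Hall's theorem -/

section Hosts

/-- Partial embeddings extend if the remaining vertices have enough candidates. -/
theorem isContained_of_candidates {α β : Type*} [Finite α] [Finite β] {L : SimpleGraph α}
    {G : SimpleGraph β} (fix : α → Option β) (cand : α → Set β)
    (hinj : ∀ a a' b, fix a = some b → fix a' = some b → a = a')
    (hadj : ∀ a a' b b', L.Adj a a' → fix a = some b → fix a' = some b' → G.Adj b b')
    (hfree : ∀ a a', L.Adj a a' → fix a = none → fix a' = none →
      ∀ w ∈ cand a, ∀ w' ∈ cand a', G.Adj w w')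
    (hmix : ∀ a a' b, L.Adj a a' → fix a = none → fix a' = some b → ∀ w ∈ cand a, G.Adj w b)
    (hcard : ∀ a, fix a = none → Nat.card α ≤ (cand a).ncard) : L.IsContained G := by
  classical
  have := Fintype.ofFinite α
  have := Fintype.ofFinite β
  let T : α → Finset β := fun a => (fix a).elim (cand a).toFinset singleton
  have hsome : ∀ a b, fix a = some b → T a = {b} := fun a b h => by simp [T, h]
  have hnone : ∀ a, fix a = none → T a = (cand a).toFinset := fun a h => by simp [T, h]
  -- Hall's condition: one free vertex already has as many candidates as there are vertices in all,
  -- and a set of fixed vertices is covered by injectivity.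
  obtain ⟨f, hf, hfT⟩ := (Finset.all_card_le_biUnion_card_iff_exists_injective T).1 (by
    intro A
    by_cases hA : ∃ a ∈ A, fix a = none
    · obtain ⟨a, ha, hfa⟩ := hA
      calc #A ≤ Nat.card α := by
            rw [Nat.card_eq_fintype_card]
            exact Finset.card_le_univ A
        _ ≤ #(T a) := by
            rw [hnone a hfa, ← Set.ncard_eq_toFinset_card']
            exact hcard a hfa
        _ ≤ _ := Finset.card_le_card (Finset.subset_biUnion_of_mem T ha)
    · push Not at hA
      rcases A.eq_empty_or_nonempty with rfl | ⟨a₀, ha₀⟩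
      · simp
      obtain ⟨b₀, -⟩ := Option.ne_none_iff_exists'.1 (hA a₀ ha₀)
      have : Nonempty β := ⟨b₀⟩
      choose! g hg using fun a ha => Option.ne_none_iff_exists'.1 (hA a ha)
      rw [← Finset.card_image_of_injOn (f := g) (s := A)]
      · refine Finset.card_le_card fun b hb => ?_
        obtain ⟨a, ha, rfl⟩ := Finset.mem_image.1 hb
        exact Finset.mem_biUnion.2 ⟨a, ha, by rw [hsome a _ (hg a ha)]; simp⟩
      · intro a ha a' ha' haa
        exact hinj a a' (g a) (hg a ha) (haa ▸ hg a' ha'))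
  have hfs : ∀ a b, fix a = some b → f a = b := fun a b h => by
    have := hfT a
    rwa [hsome a b h, Finset.mem_singleton] at this
  have hfn : ∀ a, fix a = none → f a ∈ cand a := fun a h => by
    have := hfT a
    rwa [hnone a h, Set.mem_toFinset] at this
  refine ⟨⟨⟨f, fun {a a'} haa => ?_⟩, hf⟩⟩
  rcases ha : fix a with _ | b <;> rcases ha' : fix a' with _ | b'
  · exact hfree a a' haa ha ha' _ (hfn a ha) _ (hfn a' ha')
  · rw [hfs a' b' ha']
    exact hmix a a' b' haa ha ha' _ (hfn a ha)
  · rw [hfs a b ha]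
    exact (hmix a' a b haa.symm ha' ha _ (hfn a' ha')).symm
  · rw [hfs a b ha, hfs a' b' ha']
    exact hadj a a' b b' haa ha ha'

/-- A graph with vertex set `V₀ ∪ P false ∪ P true` in which `V₀` is joined to the large complete
bipartite graph with classes `W i ⊆ P i`. -/
structure Host {β : Type*} (G : SimpleGraph β) (V₀ : Set β) (P W : Bool → Set β) (m : ℕ) :
    Prop where
  disj : Disjoint (P false) (P true)
  disj₀ : ∀ i, Disjoint V₀ (P i)
  cover : ∀ v, v ∈ V₀ ∨ ∃ i, v ∈ P i
  sub : ∀ i, W i ⊆ P i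
  nonempty : ∀ i, (W i).Nonempty
  isolated : ∀ i, ∀ w ∈ W i, ∀ p ∈ P i, ¬G.Adj w p
  complete : ∀ i j, i ≠ j → ∀ w ∈ W i, ∀ w' ∈ W j, G.Adj w w'
  complete₀ : ∀ z ∈ V₀, ∀ i, ∀ w ∈ W i, G.Adj z w
  pair : ∀ i, ∀ p ∈ P (!i), ∀ p' ∈ P (!i), m ≤ {w ∈ W i | G.Adj w p ∧ G.Adj w p'}.ncard

/-- Compatibility of the prescriptions (a value, or a side to be mapped to) for two neighbours. -/
def Compat {β : Type*} (G : SimpleGraph β) (V₀ : Set β) (P : Bool → Set β) :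
    Option β → Bool → Option β → Bool → Prop
  | some b, _, some b', _ => G.Adj b b'
  | some b, _, none, i' => b ∈ V₀ ∨ b ∈ P (!i')
  | none, i, some b', _ => b' ∈ V₀ ∨ b' ∈ P (!i)
  | none, i, none, i' => i ≠ i'

theorem Compat.symm {β : Type*} {G : SimpleGraph β} {V₀ : Set β} {P : Bool → Set β}
    {o o' : Option β} {i i' : Bool} (h : Compat G V₀ P o i o' i') : Compat G V₀ P o' i' o i := by
  rcases o with _ | b <;> rcases o' with _ | b' <;> simp only [Compat] at h ⊢
  · exact h.symm
  · exact h
  · exact h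
  · exact h.symm

/-- A vertex without prescribed image goes to `W` on its side. Its prescribed neighbours lie in
`V₀`, which is joined to `W`, with at most two exceptions; those have at least `m` common neighbours
there by `pair`. -/
theorem Host.isContained {α β : Type*} [Finite α] [Finite β] {L : SimpleGraph α}
    {G : SimpleGraph β} {V₀ : Set β} {P W : Bool → Set β} {m : ℕ} (hG : Host G V₀ P W m)
    (hm : Nat.card α ≤ m) (fix : α → Option β) (side : α → Bool)
    (hinj : ∀ a a' b, fix a = some b → fix a' = some b → a = a')
    (hcompat : ∀ a a', L.Adj a a' → Compat G V₀ P (fix a) (side a) (fix a') (side a'))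
    (hnbr : ∀ a, fix a = none → ∃ p p', ∀ a' b, L.Adj a a' → fix a' = some b →
      b ∈ V₀ ∨ b = p ∨ b = p') : L.IsContained G := by
  classical
  refine isContained_of_candidates fix
    (fun a => {w ∈ W (side a) | ∀ a' b, L.Adj a a' → fix a' = some b → G.Adj w b}) hinj ?_ ?_ ?_ ?_
  · intro a a' b b' haa ha ha'
    have := hcompat a a' haa
    rwa [ha, ha'] at this
  · intro a a' haa ha ha' w hw w' hw'
    have := hcompat a a' haa
    rw [ha, ha'] at this
    exact hG.complete _ _ this w hw.1 w' hw'.1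
  · intro a a' b haa ha ha' w hw
    exact hw.2 a' b haa ha'
  · intro a ha
    obtain ⟨p, p', hp⟩ := hnbr a ha
    obtain ⟨w₀, hw₀⟩ := hG.nonempty (!side a)
    -- An exception outside the opposite class imposes no condition and is replaced by an arbitrary
    -- vertex of that class, so that `pair` applies.
    have h1 : ∀ p, ∃ r ∈ P (!side a), ∀ b ∈ P (!side a), b = p → b = r := fun p => by
      by_cases h : p ∈ P (!side a)
      · exact ⟨p, h, fun b _ hb => hb⟩
      · exact ⟨w₀, hG.sub _ hw₀, fun b hb hbp => (h (hbp ▸ hb)).elim⟩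
    obtain ⟨r, hr, hpr⟩ := h1 p
    obtain ⟨r', hr', hpr'⟩ := h1 p'
    refine hm.trans ((hG.pair (side a) r hr r' hr').trans (Set.ncard_le_ncard ?_ (Set.toFinite _)))
    rintro w ⟨hw, hwr, hwr'⟩
    refine ⟨hw, fun a' b haa hb => ?_⟩
    have h2 := hcompat a a' haa
    rw [ha, hb] at h2
    rcases h2 with h2 | h2
    · exact (hG.complete₀ b h2 _ w hw).symm
    · rcases hp a' b haa hb with h3 | h3 | h3
      · exact (hG.complete₀ b h3 _ w hw).symm
      · rwa [hpr b h2 h3]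
      · rwa [hpr' b h2 h3]

section Ballooning

variable {V : Type*} {H : SimpleGraph V} {ℓ : H.edgeSet → ℕ}

/-- The odd-ballooning with the new path of the edge `e` running from `s e` to `t e`. -/
def orientedBallooning (H : SimpleGraph V) (ℓ : H.edgeSet → ℕ) (s t : H.edgeSet → V) :
    SimpleGraph (V ⊕ (Σ e : H.edgeSet, Fin (ℓ e - 2))) :=
  SimpleGraph.fromRel fun x y =>
    match x, y with
    | Sum.inl u, Sum.inl v => H.Adj u v
    | Sum.inl u, Sum.inr ⟨e, i⟩ => (u = s e ∧ (i : ℕ) = 0) ∨ (u = t e ∧ (i : ℕ) + 1 = ℓ e - 2)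
    | Sum.inr ⟨e, i⟩, Sum.inr ⟨f, j⟩ => e = f ∧ (i : ℕ) + 1 = (j : ℕ)
    | Sum.inr _, Sum.inl _ => False

variable {s t : H.edgeSet → V}

@[simp]
theorem orientedBallooning_adj_inl_inl {u v : V} :
    (orientedBallooning H ℓ s t).Adj (.inl u) (.inl v) ↔ H.Adj u v := by
  simp only [orientedBallooning, SimpleGraph.fromRel_adj, ne_eq, Sum.inl.injEq]
  exact ⟨fun h => h.2.elim id fun h => h.symm, fun h => ⟨h.ne, .inl h⟩⟩

@[simp]
theorem orientedBallooning_adj_inl_inr {u : V} {e : H.edgeSet} {i : Fin (ℓ e - 2)} :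
    (orientedBallooning H ℓ s t).Adj (.inl u) (.inr ⟨e, i⟩) ↔
      (u = s e ∧ (i : ℕ) = 0) ∨ (u = t e ∧ (i : ℕ) + 1 = ℓ e - 2) := by
  simp [orientedBallooning, SimpleGraph.fromRel_adj]

@[simp]
theorem orientedBallooning_adj_inr_inl {u : V} {e : H.edgeSet} {i : Fin (ℓ e - 2)} :
    (orientedBallooning H ℓ s t).Adj (.inr ⟨e, i⟩) (.inl u) ↔
      (u = s e ∧ (i : ℕ) = 0) ∨ (u = t e ∧ (i : ℕ) + 1 = ℓ e - 2) := by
  rw [SimpleGraph.adj_comm, orientedBallooning_adj_inl_inr]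

@[simp]
theorem orientedBallooning_adj_inr_inr {e f : H.edgeSet} {i : Fin (ℓ e - 2)} {j : Fin (ℓ f - 2)} :
    (orientedBallooning H ℓ s t).Adj (.inr ⟨e, i⟩) (.inr ⟨f, j⟩) ↔
      e = f ∧ ((i : ℕ) + 1 = j ∨ (j : ℕ) + 1 = i) := by
  simp only [orientedBallooning, SimpleGraph.fromRel_adj, ne_eq, Sum.inr.injEq]
  constructor
  · rintro ⟨-, h | h⟩
    · exact ⟨h.1, .inl h.2⟩
    · exact ⟨h.1.symm, .inr h.2⟩
  · rintro ⟨rfl, h⟩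
    refine ⟨?_, by simpa using h⟩
    simp only [Sigma.mk.injEq, heq_eq_eq, true_and]
    rintro rfl
    omega

theorem ballooning_eq_oriented (H : SimpleGraph V) (ℓ : H.edgeSet → ℕ) :
    ballooning H ℓ = orientedBallooning H ℓ (fun e => (Quot.out e.1).1) fun e => (Quot.out e.1).2 :=
  rfl

/-- Reversing the new paths whose ends are exchanged identifies the two graphs. Hence the paths may
be oriented to suit the set `I`. -/
theorem orientedBallooning_isContained {s' t' : H.edgeSet → V} (h : ∀ e, e.1 = s(s e, t e))
    (h' : ∀ e, e.1 = s(s' e, t' e)) :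
    (orientedBallooning H ℓ s t).IsContained (orientedBallooning H ℓ s' t') := by
  classical
  let g : ∀ e : H.edgeSet, Fin (ℓ e - 2) → Fin (ℓ e - 2) := fun e i =>
    if s e = s' e then i else i.rev
  have hg : ∀ e i, g e (g e i) = i := fun e i => by
    by_cases hs : s e = s' e <;> simp [g, hs]
  have hcase : ∀ e, (s e = s' e ∧ t e = t' e ∧ ∀ i, g e i = i) ∨
      (s e = t' e ∧ t e = s' e ∧ ∀ i, g e i = i.rev) := by
    intro e
    have hst := (h e).symm.trans (h' e)
    by_cases hs : s e = s' e
    · refine .inl ⟨hs, ?_, fun i => by simp [g, hs]⟩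
      rw [hs] at hst
      rcases Sym2.eq_iff.1 hst with hst | hst
      · exact hst.2
      · exact hst.2.trans hst.1
    · rcases Sym2.eq_iff.1 hst with hst | hst
      · exact (hs hst.1).elim
      · exact .inr ⟨hst.1, hst.2, fun i => by simp [g, hs]⟩
  refine ⟨⟨⟨Sum.map id fun p => ⟨p.1, g p.1 p.2⟩, ?_⟩, ?_⟩⟩
  · rintro (u | ⟨e, i⟩) (v | ⟨f, j⟩) hadj
    · simpa using hadj
    · simp only [orientedBallooning_adj_inl_inr, Sum.map_inl, Sum.map_inr, id] at hadj ⊢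
      rcases hcase f with ⟨h1, h2, h3⟩ | ⟨h1, h2, h3⟩
      · rw [h3, ← h1, ← h2]
        exact hadj
      · rw [h3, ← h1, ← h2, Fin.val_rev]
        have := j.2
        rcases hadj with ⟨h4, h5⟩ | ⟨h4, h5⟩
        · exact .inr ⟨h4, by omega⟩
        · exact .inl ⟨h4, by omega⟩
    · simp only [orientedBallooning_adj_inr_inl, Sum.map_inl, Sum.map_inr, id] at hadj ⊢
      rcases hcase e with ⟨h1, h2, h3⟩ | ⟨h1, h2, h3⟩
      · rw [h3, ← h1, ← h2]
        exact hadj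
      · rw [h3, ← h1, ← h2, Fin.val_rev]
        have := i.2
        rcases hadj with ⟨h4, h5⟩ | ⟨h4, h5⟩
        · exact .inr ⟨h4, by omega⟩
        · exact .inl ⟨h4, by omega⟩
    · simp only [orientedBallooning_adj_inr_inr, Sum.map_inr] at hadj ⊢
      obtain ⟨rfl, hadj⟩ := hadj
      refine ⟨rfl, ?_⟩
      rcases hcase e with ⟨h1, h2, h3⟩ | ⟨h1, h2, h3⟩
      · rw [h3, h3]
        exact hadj
      · rw [h3, h3, Fin.val_rev, Fin.val_rev]
        have := i.2
        have := j.2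
        omega
  · refine Function.Injective.sumMap Function.injective_id ?_
    rintro ⟨e, i⟩ ⟨f, j⟩ hij
    obtain ⟨rfl, hij⟩ := Sigma.mk.inj_iff.1 hij
    rw [heq_eq_eq] at hij
    rw [← hg e i, hij, hg]

variable {β : Type*} [Finite V] [Finite β] {G : SimpleGraph β} {V₀ : Set β} {P W : Bool → Set β}
  {m : ℕ}

/-- Embedding of a ballooning from prescriptions for the old vertices (`fixH`, `sideH`) and for
the new ones (`fixP`, `sideP`). -/
theorem Host.isContained_ballooning (hG : Host G V₀ P W m)
    (hm : Nat.card (V ⊕ (Σ e : H.edgeSet, Fin (ℓ e - 2))) ≤ m)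
    (fixH : V → Option β) (sideH : V → Bool) (fixP : H.edgeSet → ℕ → Option β)
    (sideP : H.edgeSet → ℕ → Bool)
    (injH : ∀ u u' b, fixH u = some b → fixH u' = some b → u = u')
    (injHP : ∀ u e j b, fixH u = some b → fixP e j ≠ some b)
    (injP : ∀ e j e' j' b, fixP e j = some b → fixP e' j' = some b → e = e' ∧ j = j')
    (hH : ∀ u u', H.Adj u u' → Compat G V₀ P (fixH u) (sideH u) (fixH u') (sideH u'))
    (hs : ∀ e, Compat G V₀ P (fixH (s e)) (sideH (s e)) (fixP e 0) (sideP e 0))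
    (ht : ∀ e, Compat G V₀ P (fixH (t e)) (sideH (t e)) (fixP e (ℓ e - 3)) (sideP e (ℓ e - 3)))
    (hp : ∀ e j, j + 1 < ℓ e - 2 →
      Compat G V₀ P (fixP e j) (sideP e j) (fixP e (j + 1)) (sideP e (j + 1)))
    (hnbr : ∀ u, fixH u = none → ∃ p p',
      (∀ u' b, H.Adj u u' → fixH u' = some b → b ∈ V₀ ∨ b = p ∨ b = p') ∧
      (∀ e b, s e = u → fixP e 0 = some b → b ∈ V₀ ∨ b = p ∨ b = p') ∧
      (∀ e b, t e = u → fixP e (ℓ e - 3) = some b → b ∈ V₀ ∨ b = p ∨ b = p')) :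
    (orientedBallooning H ℓ s t).IsContained G := by
  have hHP : ∀ u e (j : Fin (ℓ e - 2)),
      (u = s e ∧ (j : ℕ) = 0) ∨ (u = t e ∧ (j : ℕ) + 1 = ℓ e - 2) →
      Compat G V₀ P (fixH u) (sideH u) (fixP e j) (sideP e j) := by
    rintro u e j (⟨rfl, hj⟩ | ⟨rfl, hj⟩)
    · rw [hj]
      exact hs e
    · rw [show (j : ℕ) = ℓ e - 3 by omega]
      exact ht e
  refine hG.isContained hm (Sum.elim fixH fun p => fixP p.1 p.2)
    (Sum.elim sideH fun p => sideP p.1 p.2) ?_ ?_ ?_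
  · rintro (u | ⟨e, i⟩) (u' | ⟨e', i'⟩) b hb hb'
    · rw [injH u u' b hb hb']
    · exact (injHP u e' i' b hb hb').elim
    · exact (injHP u' e i b hb' hb).elim
    · obtain ⟨rfl, h⟩ := injP e i e' i' b hb hb'
      rw [Fin.ext h]
  · rintro (u | ⟨e, i⟩) (u' | ⟨e', i'⟩) hadj
    · exact hH u u' (by simpa using hadj)
    · exact hHP u e' i' (by simpa using hadj)
    · exact (hHP u' e i (by simpa using hadj)).symm
    · obtain ⟨rfl, h | h⟩ := orientedBallooning_adj_inr_inr.1 hadj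
      · have := hp e i (by omega)
        rwa [h] at this
      · have := (hp e i' (by omega)).symm
        rwa [h] at this
  · rintro (u | ⟨e, i⟩) hu
    · obtain ⟨p, p', h1, h2, h3⟩ := hnbr u hu
      refine ⟨p, p', ?_⟩
      rintro (u' | ⟨e', i'⟩) b hadj hb
      · exact h1 u' b (by simpa using hadj) hb
      · rw [orientedBallooning_adj_inl_inr] at hadj
        rcases hadj with ⟨hu', h⟩ | ⟨hu', h⟩
        · exact h2 e' b hu'.symm (by simpa [h] using hb)
        · refine h3 e' b hu'.symm ?_
          rwa [show ℓ e' - 3 = i' by omega]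
    · obtain ⟨w₀, -⟩ := hG.nonempty true
      -- the neighbour before and the neighbour after
      let o₁ : Option β := if (i : ℕ) = 0 then fixH (s e) else fixP e (i - 1)
      let o₂ : Option β := if (i : ℕ) + 1 = ℓ e - 2 then fixH (t e) else fixP e (i + 1)
      refine ⟨o₁.getD w₀, o₂.getD w₀, ?_⟩
      have key : ∀ b, o₁ = some b ∨ o₂ = some b → b ∈ V₀ ∨ b = o₁.getD w₀ ∨ b = o₂.getD w₀ := by
        rintro b (h | h)
        · exact .inr (.inl (by rw [h]; rfl))
        · exact .inr (.inr (by rw [h]; rfl))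
      rintro (u' | ⟨e', i'⟩) b hadj hb
      · rw [orientedBallooning_adj_inr_inl] at hadj
        refine key b ?_
        rcases hadj with ⟨rfl, h⟩ | ⟨rfl, h⟩
        · exact .inl (by simpa [o₁, h] using hb)
        · exact .inr (by simpa [o₂, h] using hb)
      · obtain ⟨rfl, h | h⟩ := orientedBallooning_adj_inr_inr.1 hadj
        · refine key b (.inr ?_)
          have := i'.2
          simp only [o₂]
          rw [if_neg (by omega), h]
          exact hb
        · refine key b (.inl ?_)
          simp only [o₁, show ¬(i : ℕ) = 0 by omega, if_false, show (i : ℕ) - 1 = i' by omega]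
          exact hb

end Ballooning

end Hosts

/-! ### Parity gadgets at a vertex of a class -/

section Gadgets

/-- The ways in which a cycle through a vertex `v` of one class uses an edge inside a class: an
edge at `v`, an edge inside the opposite class with an end adjacent to `v`, and an edge inside the
class of `v`. -/
inductive Gadget (β : Type*)
  | pendant (u : β)
  | far (a b : β)
  | near (a b : β)

namespace Gadget

variable {β : Type*}

/-- The prescribed vertices of the cycle, counted from the neighbour of `v`. -/
def fix : Gadget β → ℕ → Option β
  | pendant u, 0 => some u
  | far a _, 0 => some a
  | far _ b, 1 => some b
  | near a _, 1 => some a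
  | near _ b, 2 => some b
  | _, _ => none

/-- The classes of the other vertices of the cycle, if `v` lies in the class `i`. -/
def side (i : Bool) : Gadget β → ℕ → Bool
  -- To use an edge in its own class away from `v`, the cycle first steps into the opposite class.
  -- Past the prescribed vertices, all three types have their even positions in the class `i`.
  | near _ _, 0 => !i
  | _, j => xor i j.bodd

variable {G : SimpleGraph β} {V₀ : Set β} {P : Bool → Set β} {i : Bool} {v : β} {g : Gadget β}

/-- The conditions on a gadget at the vertex `v` of the class `i`. -/
def Valid (G : SimpleGraph β) (P : Bool → Set β) (i : Bool) (v : β) : Gadget β → Prop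
  | pendant u => u ∈ P i ∧ G.Adj v u
  | far a b => a ∈ P (!i) ∧ b ∈ P (!i) ∧ G.Adj v a ∧ G.Adj a b
  | near a b => a ∈ P i ∧ b ∈ P i ∧ G.Adj a b

theorem Valid.compat_start (hg : g.Valid G P i v) (hv : v ∈ P i) (σ : Bool) :
    Compat G V₀ P (some v) σ (g.fix 0) (g.side i 0) := by
  rcases g with u | ⟨a, b⟩ | ⟨a, b⟩
  · exact hg.2
  · exact hg.2.2.1
  · exact .inr (by simpa [side] using hv)

theorem Valid.compat_step (hg : g.Valid G P i v) (j : ℕ) :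
    Compat G V₀ P (g.fix j) (g.side i j) (g.fix (j + 1)) (g.side i (j + 1)) := by
  rcases g with u | ⟨a, b⟩ | ⟨a, b⟩
  · match j with
    | 0 => exact .inr (by simpa [side] using hg.1)
    | j + 1 => simp [fix, side, Compat]
  · match j with
    | 0 => exact hg.2.2.2
    | 1 => exact .inr (by simpa [side] using hg.2.1)
    | j + 2 => simp [fix, side, Compat]
  · match j with
    | 0 => exact .inr (by simpa [side] using hg.1)
    | 1 => exact hg.2.2
    | 2 => exact .inr (by simpa [side] using hg.2.1)
    | j + 3 => simp [fix, side, Compat]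

/-- The prescribed vertices occupy positions up to 2 and the last position of the path is `ℓ e - 3`,
which is even. Cycle lengths of at least 5 leave enough room for the parity to be corrected before
the path returns to the class opposite to `v`. -/
theorem Valid.compat_end (hg : g.Valid G P i v) {j : ℕ} (hj : 2 ≤ j) (hodd : j.bodd = false) :
    Compat G V₀ P none (!i) (g.fix j) (g.side i j) := by
  obtain ⟨j, rfl⟩ := Nat.exists_eq_add_of_le' hj
  rcases g with u | ⟨a, b⟩ | ⟨a, b⟩
  · simp_all [fix, side, Compat]
  · simp_all [fix, side, Compat]
  · match j with
    | 0 => exact .inr (by simpa [side] using hg.2.1)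
    | j + 1 => simp_all [fix, side, Compat]

theorem far_fix_injective {a c : β} (hac : a ≠ c) {j j' : ℕ} {b : β}
    (h : (far a c).fix j = some b) (h' : (far a c).fix j' = some b) : j = j' := by
  match j, j' with
  | 0, 0 => rfl
  | 1, 1 => rfl
  | 0, 1 => simp_all [fix]
  | 1, 0 => simp_all [fix]
  | j + 2, _ => simp [fix] at h
  | _, j + 2 => simp [fix] at h'

theorem Valid.fix_injective (hg : g.Valid G P i v) {j j' : ℕ} {b : β} (h : g.fix j = some b)
    (h' : g.fix j' = some b) : j = j' := by
  rcases g with u | ⟨a, c⟩ | ⟨a, c⟩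
  · match j, j' with
    | 0, 0 => rfl
    | j + 1, _ => simp [fix] at h
    | _, j + 1 => simp [fix] at h'
  · exact far_fix_injective hg.2.2.2.ne h h'
  · have := hg.2.2.ne
    match j, j' with
    | 1, 1 => rfl
    | 2, 2 => rfl
    | 1, 2 => simp_all [fix]
    | 2, 1 => simp_all [fix]
    | 0, _ => simp [fix] at h
    | _, 0 => simp [fix] at h'
    | j + 3, _ => simp [fix] at h
    | _, j + 3 => simp [fix] at h'

/-- The vertices of a gadget. -/
def verts : Gadget β → Set β
  | pendant u => {u}
  | far a b => {a, b}
  | near a b => {a, b}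

theorem mem_verts_of_fix {j : ℕ} {b : β} (h : g.fix j = some b) : b ∈ g.verts := by
  rcases g with u | ⟨a, c⟩ | ⟨a, c⟩
  · match j with
    | 0 => simp_all [fix, verts]
    | j + 1 => simp [fix] at h
  · match j with
    | 0 => simp_all [fix, verts]
    | 1 => simp_all [fix, verts]
    | j + 2 => simp [fix] at h
  · match j with
    | 0 => simp [fix] at h
    | 1 => simp_all [fix, verts]
    | 2 => simp_all [fix, verts]
    | j + 3 => simp [fix] at h

theorem Valid.verts_subset (hg : g.Valid G P i v) : ∀ b ∈ g.verts, ∃ j, b ∈ P j := by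
  rcases g with u | ⟨a, c⟩ | ⟨a, c⟩
  · rintro b rfl
    exact ⟨i, hg.1⟩
  · rintro b (rfl | rfl)
    · exact ⟨!i, hg.1⟩
    · exact ⟨!i, hg.2.1⟩
  · rintro b (rfl | rfl)
    · exact ⟨i, hg.1⟩
    · exact ⟨i, hg.2.1⟩

end Gadget

theorem Host.notMem_zero {β : Type*} {G : SimpleGraph β} {V₀ : Set β} {P W : Bool → Set β}
    {m : ℕ} (hG : Host G V₀ P W m) {i : Bool} {b : β} (hb : b ∈ P i) : b ∉ V₀ :=
  fun h => Set.disjoint_left.1 (hG.disj₀ i) h hb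

/-- An edge has at most one end in `I`, which is chosen as its start. Then `s e ∈ I` expresses that
`I` covers `e`. -/
theorem exists_orientation {V : Type*} (H : SimpleGraph V) {I : Set V} (hI : H.IsIndepSet I) :
    ∃ s t : H.edgeSet → V, (∀ e, e.1 = s(s e, t e)) ∧ ∀ e, t e ∉ I := by
  have : ∀ e : H.edgeSet, ∃ p : V × V, e.1 = s(p.1, p.2) ∧ p.2 ∉ I := by
    rintro ⟨e, he⟩
    induction e with | h u w => ?_
    by_cases hw : w ∈ I
    · exact ⟨(w, u), Sym2.eq_swap, fun hu => hI hu hw (SimpleGraph.ne_of_adj H he) he⟩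
    · exact ⟨(u, w), rfl, hw⟩
  choose p hp using this
  exact ⟨fun e => (p e).1, fun e => (p e).2, fun e => (hp e).1, fun e => (hp e).2⟩

variable {V β : Type*} [Finite V] [Finite β] {H : SimpleGraph V} {ℓ : H.edgeSet → ℕ}
  {G : SimpleGraph β} {V₀ : Set β} {P W : Bool → Set β} {m : ℕ}

theorem bodd_sub_three {n : ℕ} (hn : Odd n) (h5 : 5 ≤ n) : (n - 3).bodd = false := by
  obtain ⟨k, rfl⟩ := hn
  rw [show 2 * k + 1 - 3 = 2 * (k - 1) by omega]
  simp

/-- If an independent covering of `H` has a vertex `x`, and the other vertices of it can be placed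
in `V₀`, then `d_H(x)` gadgets yield the ballooning. -/
theorem Host.isContained_of_gadgets (hG : Host G V₀ P W m)
    (hm : Nat.card (V ⊕ (Σ e : H.edgeSet, Fin (ℓ e - 2))) ≤ m) (hℓ : ∀ e, 5 ≤ ℓ e ∧ Odd (ℓ e))
    {s t : H.edgeSet → V} (hst : ∀ e, e.1 = s(s e, t e)) {I : Set V}
    (hsI : ∀ e, s e ∈ I) (htI : ∀ e, t e ∉ I) {x : V} (hx : x ∈ I)
    {ψ : V → β} (hψ : ∀ u ∈ I, u ≠ x → ψ u ∈ V₀) (hψi : Set.InjOn ψ (I \ {x}))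
    {i : Bool} {v : β} (hv : v ∈ P i) (gad : V → Gadget β)
    (hval : ∀ u, H.Adj x u → (gad u).Valid G P i v)
    (hvgad : ∀ u, H.Adj x u → v ∉ (gad u).verts)
    (hdisj : ∀ u u', H.Adj x u → H.Adj x u' → u ≠ u' → Disjoint (gad u).verts (gad u').verts) :
    (orientedBallooning H ℓ s t).IsContained G := by
  classical
  have hadj : ∀ e, H.Adj (s e) (t e) := fun e => by
    have := e.2
    rwa [hst e] at this
  have hcov : ∀ u u', H.Adj u u' → (u ∈ I ∧ u' ∉ I) ∨ (u ∉ I ∧ u' ∈ I) := by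
    have hgen : ∀ e : H.edgeSet, ∀ u u', e.1 = s(u, u') →
        (u ∈ I ∧ u' ∉ I) ∨ (u ∉ I ∧ u' ∈ I) := by
      intro e u u' he
      rw [hst e] at he
      rcases Sym2.eq_iff.1 he with ⟨rfl, rfl⟩ | ⟨rfl, rfl⟩
      · exact .inl ⟨hsI e, htI e⟩
      · exact .inr ⟨htI e, hsI e⟩
    exact fun u u' h => hgen ⟨s(u, u'), h⟩ u u' rfl
  have hinj : ∀ e e', s e = s e' → t e = t e' → e = e' := fun e e' h h' =>
    Subtype.ext (by rw [hst e, hst e', h, h'])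
  set fixH : V → Option β := fun u => if u = x then some v else if u ∈ I then some (ψ u) else none
    with hfixH
  have hfx : fixH x = some v := by simp [hfixH]
  have hfI : ∀ u ∈ I, u ≠ x → fixH u = some (ψ u) := fun u hu hux => by simp [hfixH, hu, hux]
  have hfn : ∀ u ∉ I, fixH u = none := fun u hu => by
    simp [hfixH, hu, show u ≠ x from fun h => hu (h ▸ hx)]
  have hfs : ∀ u b, fixH u = some b → (u = x ∧ b = v) ∨ (u ∈ I ∧ u ≠ x ∧ b = ψ u) := by
    intro u b h
    by_cases hux : u = x
    · subst hux
      rw [hfx] at h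
      exact .inl ⟨rfl, (Option.some.inj h).symm⟩
    · by_cases hu : u ∈ I
      · rw [hfI u hu hux] at h
        exact .inr ⟨hu, hux, (Option.some.inj h).symm⟩
      · rw [hfn u hu] at h
        cases h
  set fixP : H.edgeSet → ℕ → Option β := fun e j => if s e = x then (gad (t e)).fix j else none
    with hfixP
  set sideP : H.edgeSet → ℕ → Bool := fun e j =>
    if s e = x then (gad (t e)).side i j else xor i j.bodd with hsideP
  have hPs : ∀ e j b, fixP e j = some b → s e = x ∧ H.Adj x (t e) ∧ (gad (t e)).fix j = some b := by
    intro e j b h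
    by_cases hse : s e = x
    · refine ⟨hse, hse ▸ hadj e, ?_⟩
      simpa [hfixP, hse] using h
    · simp [hfixP, hse] at h
  have hv0 := hG.notMem_zero hv
  -- `x` goes to `v`, the rest of `I` to `V₀`, and the remaining vertices of `H` to the class
  -- opposite to `v`. A cycle not through `x` passes through `V₀`, where its parity is corrected
  -- without a gadget.
  refine hG.isContained_ballooning hm fixH (fun _ => !i) fixP sideP ?_ ?_ ?_ ?_ ?_ ?_ ?_ ?_
  · intro u u' b h h'
    rcases hfs u b h with ⟨h1, h2⟩ | ⟨h1, h2, h3⟩ <;>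
      rcases hfs u' b h' with ⟨h1', h2'⟩ | ⟨h1', h2', h3'⟩
    · rw [h1, h1']
    · have := hψ u' h1' h2'
      rw [← h3', h2] at this
      exact (hv0 this).elim
    · have := hψ u h1 h2
      rw [← h3, h2'] at this
      exact (hv0 this).elim
    · exact hψi ⟨h1, h2⟩ ⟨h1', h2'⟩ (h3.symm.trans h3')
  · intro u e j b h h'
    obtain ⟨-, h2, h3⟩ := hPs e j b h'
    have h4 := Gadget.mem_verts_of_fix h3
    rcases hfs u b h with ⟨-, rfl⟩ | ⟨h5, h6, rfl⟩
    · exact hvgad _ h2 h4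
    · obtain ⟨k, hk⟩ := (hval _ h2).verts_subset _ h4
      exact hG.notMem_zero hk (hψ u h5 h6)
  · intro e j e' j' b h h'
    obtain ⟨h1, h2, h3⟩ := hPs e j b h
    obtain ⟨h1', h2', h3'⟩ := hPs e' j' b h'
    have htt : t e = t e' := by
      by_contra hne
      exact Set.disjoint_left.1 (hdisj _ _ h2 h2' hne) (Gadget.mem_verts_of_fix h3)
        (Gadget.mem_verts_of_fix h3')
    refine ⟨hinj e e' (h1.trans h1'.symm) htt, ?_⟩
    rw [← htt] at h3'
    exact (hval _ h2).fix_injective h3 h3'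
  · have key : ∀ u u', u ∈ I → u' ∉ I → Compat G V₀ P (fixH u) (!i) (fixH u') (!i) := by
      intro u u' hu hu'
      rw [hfn u' hu']
      by_cases hux : u = x
      · rw [hux, hfx]
        exact .inr (by simpa using hv)
      · rw [hfI u hu hux]
        exact .inl (hψ u hu hux)
    intro u u' h
    rcases hcov u u' h with ⟨h1, h2⟩ | ⟨h1, h2⟩
    · exact key u u' h1 h2
    · exact (key u' u h2 h1).symm
  · intro e
    by_cases hse : s e = x
    · simp only [hse, hfx, hfixP, hsideP, if_true]
      exact (hval _ (hse ▸ hadj e)).compat_start hv _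
    · rw [hfI _ (hsI e) hse]
      simp only [hfixP, hse, if_false]
      exact .inl (hψ _ (hsI e) hse)
  · intro e
    rw [hfn _ (htI e)]
    have hodd := bodd_sub_three (hℓ e).2 (hℓ e).1
    by_cases hse : s e = x
    · simp only [hse, hfixP, hsideP, if_true]
      exact (hval _ (hse ▸ hadj e)).compat_end (by have := (hℓ e).1; omega) hodd
    · simp [hfixP, hsideP, hse, Compat, hodd]
  · intro e j _
    by_cases hse : s e = x
    · simp only [hse, hfixP, hsideP, if_true]
      exact (hval _ (hse ▸ hadj e)).compat_step j
    · simp [hfixP, hsideP, hse, Compat]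
  · intro u hu
    have huI : u ∉ I := by
      intro huI
      by_cases hux : u = x
      · rw [hux, hfx] at hu
        cases hu
      · rw [hfI u huI hux] at hu
        cases hu
    -- For `ℓ e = 5` a near gadget ends right next to `t e`. Only the edge from `x` to `u` can do
    -- this at `u`, so `v` and `p'` are the only prescribed neighbours of `u` outside `V₀`.
    obtain ⟨p', hp'⟩ : ∃ p', ∀ e b, t e = u → fixP e (ℓ e - 3) = some b → b = p' := by
      by_cases hex : ∃ e b, t e = u ∧ fixP e (ℓ e - 3) = some b
      · obtain ⟨e, b, he, hb⟩ := hex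
        refine ⟨b, fun e' b' he' hb' => ?_⟩
        obtain rfl := hinj e' e ((hPs _ _ _ hb').1.trans (hPs _ _ _ hb).1.symm)
          (he'.trans he.symm)
        rw [hb] at hb'
        exact (Option.some.inj hb').symm
      · exact ⟨v, fun e b he hb => (hex ⟨e, b, he, hb⟩).elim⟩
    refine ⟨v, p', ?_, ?_, fun e b he hb => .inr (.inr (hp' e b he hb))⟩
    · intro u' b _ hb
      rcases hfs u' b hb with ⟨-, h⟩ | ⟨h1, h2, rfl⟩
      · exact .inr (.inl h)
      · exact .inl (hψ u' h1 h2)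
    · intro e b he
      exact (huI (he ▸ hsI e)).elim

theorem exists_injOn_mapsTo {α β : Type*} [Finite α] [Finite β] {S : Set α} {T : Set β}
    (h : S.ncard ≤ T.ncard) (hS : S.Nonempty) : ∃ f : α → β, (∀ a ∈ S, f a ∈ T) ∧ Set.InjOn f S := by
  have hT : T.Nonempty := by
    rw [← Set.ncard_pos]
    exact ((Set.ncard_pos).2 hS).trans_le h
  have : Nonempty β := hT.to_type
  obtain ⟨f, hf, hi⟩ := (Set.toFinite S).exists_injOn_of_encard_le (t := T) (by
    rw [← (Set.toFinite S).cast_ncard_eq, ← (Set.toFinite T).cast_ncard_eq]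
    exact_mod_cast h)
  exact ⟨f, hf, hi⟩

/-- With more than `h` edges available, each of the at most `h + 1` edges of `H` at `x` receives its
own gadget. The gadgets are disjoint because the matching avoids `v` and its neighbours. -/
theorem Host.fewGadgets_of_indepCovering (hG : Host G V₀ P W m)
    (hm : Nat.card (V ⊕ (Σ e : H.edgeSet, Fin (ℓ e - 2))) ≤ m) (hℓ : ∀ e, 5 ≤ ℓ e ∧ Odd (ℓ e))
    {s t : H.edgeSet → V} (hst : ∀ e, e.1 = s(s e, t e)) {I : Set V}
    (hsI : ∀ e, s e ∈ I) (htI : ∀ e, t e ∉ I) {x : V} (hx : x ∈ I)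
    (hcard : I.ncard ≤ V₀.ncard + 1) {h : ℕ} (hdeg : (H.neighborSet x).ncard ≤ h + 1)
    (hfree : (orientedBallooning H ℓ s t).Free G) : FewGadgets G P h := by
  classical
  intro i v hv A f hA hav hreach
  by_contra hcon
  refine hfree ?_
  obtain ⟨ψ, hψ, hψi⟩ : ∃ ψ : V → β, (∀ u ∈ I, u ≠ x → ψ u ∈ V₀) ∧ Set.InjOn ψ (I \ {x}) := by
    rcases (I \ {x}).eq_empty_or_nonempty with h0 | h0
    · exact ⟨fun _ => v, fun u hu hux => (Set.notMem_empty u (h0 ▸ ⟨hu, hux⟩)).elim, by simp [h0]⟩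
    · obtain ⟨ψ, h1, h2⟩ := exists_injOn_mapsTo (T := V₀)
        (by rw [Set.ncard_sdiff_singleton_of_mem hx]; omega) h0
      exact ⟨ψ, fun u hu hux => h1 u ⟨hu, hux⟩, h2⟩
  set N := (mono G P).neighborSet v with hN
  have hdj : Disjoint N A := by
    rw [Set.disjoint_left]
    exact fun a ha haA => (hav a haA).2.2.1 ha
  obtain ⟨κ, hκ, hκi⟩ : ∃ κ : V → β, (∀ u, H.Adj x u → κ u ∈ N ∨ κ u ∈ A) ∧
      Set.InjOn κ (H.neighborSet x) := by
    rcases (H.neighborSet x).eq_empty_or_nonempty with h0 | h0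
    · exact ⟨fun _ => v, fun u hu => (Set.notMem_empty u (h0 ▸ hu)).elim, by simp [h0]⟩
    · obtain ⟨κ, h1, h2⟩ := exists_injOn_mapsTo (T := N ∪ A)
        (by rw [Set.ncard_union_eq hdj, Set.ncard_coe_finset]; omega) h0
      exact ⟨κ, h1, h2⟩
  have hNP : ∀ a ∈ N, a ∈ P i ∧ G.Adj v a := fun a ha => by
    have := (mono_adj_iff hG.disj hv).1 ha
    exact ⟨this.2.2, this.1⟩
  have hAP : ∀ a ∈ A, a ∉ P i → a ∈ P (!i) := by
    intro a ha hai
    have := hA.adj a ha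
    cases i <;> rcases this with h | h
    · exact (hai h.2.1).elim
    · exact h.2.1
    · exact h.2.1
    · exact (hai h.2.1).elim
  -- A matching edge in the opposite class is traversed starting from an end adjacent to `v`, which
  -- exists by reachability.
  let gad : β → Gadget β := fun a => if a ∈ N then .pendant a else if a ∈ P i then .near a (f a)
    else if G.Adj v a then .far a (f a) else .far (f a) a
  have hval : ∀ a, a ∈ N ∨ a ∈ A → (gad a).Valid G P i v := by
    intro a ha
    by_cases haN : a ∈ N
    · simp only [gad, haN, if_true]
      exact hNP a haN
    · have haA := ha.resolve_left haN
      by_cases hai : a ∈ P i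
      · simp only [gad, haN, hai, if_true, if_false]
        have := (mono_adj_iff hG.disj hai).1 (hA.adj a haA)
        exact ⟨hai, this.2.2, this.1⟩
      · have hai' := hAP a haA hai
        have h1 := (mono_adj_iff hG.disj hai').1 (hA.adj a haA)
        by_cases hva : G.Adj v a
        · simp only [gad, haN, hai, hva, if_true, if_false]
          exact ⟨hai', h1.2.2, hva, h1.1⟩
        · simp only [gad, haN, hai, hva, if_false]
          exact ⟨h1.2.2, hai', (hreach a haA hai').resolve_left hva, h1.1.symm⟩
  have hverts : ∀ a, a ∈ N ∨ a ∈ A → ∀ b ∈ (gad a).verts, b = a ∨ (a ∈ A ∧ b = f a) := by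
    intro a ha b hb
    by_cases haN : a ∈ N
    · simp only [gad, haN, if_true] at hb
      exact .inl hb
    · have haA := ha.resolve_left haN
      by_cases hai : a ∈ P i
      · simp only [gad, haN, hai, if_true, if_false] at hb
        exact hb.imp_right fun h => ⟨haA, h⟩
      · by_cases hva : G.Adj v a
        · simp only [gad, haN, hai, hva, if_true, if_false] at hb
          exact hb.imp_right fun h => ⟨haA, h⟩
        · simp only [gad, haN, hai, hva, if_false] at hb
          exact hb.symm.imp_right fun h => ⟨haA, h⟩
  refine hG.isContained_of_gadgets hm hℓ hst hsI htI hx hψ hψi hv (fun u => gad (κ u))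
    (fun u hu => hval _ (hκ u hu)) ?_ ?_
  · intro u hu hvu
    rcases hverts _ (hκ u hu) v hvu with h1 | ⟨h1, h2⟩
    · rcases hκ u hu with h3 | h3
      · exact (hNP _ h3).2.ne h1
      · exact (hav _ h3).1 h1.symm
    · exact (hav _ h1).2.1 h2.symm
  · intro u u' hu hu' hne
    rw [Set.disjoint_left]
    intro b hb hb'
    have hfar : ∀ a a', a ∈ A → a' ∈ N ∨ a' ∈ A → f a ≠ a' := by
      rintro a a' ha (ha' | ha') rfl
      · exact (hav a ha).2.2.2 ha'
      · exact hA.disj a ha ha'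
    rcases hverts _ (hκ u hu) b hb with h1 | ⟨h1, h2⟩ <;>
      rcases hverts _ (hκ u' hu') b hb' with h1' | ⟨h1', h2'⟩
    · exact hne (hκi hu hu' (h1.symm.trans h1'))
    · exact hfar _ _ h1' (hκ u hu) (h2'.symm.trans h1)
    · exact hfar _ _ h1 (hκ u' hu') (h2.symm.trans h1')
    · exact hne (hκi hu hu' (hA.inj h1 h1' (h2.symm.trans h2')))

end Gadgets

/-! ### The case of an edge of `H` not covered by `I` -/

section Uncovered

variable {V β : Type*} [Finite V] [Finite β] {H : SimpleGraph V} {ℓ : H.edgeSet → ℕ}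
  {G : SimpleGraph β} {V₀ : Set β} {P W : Bool → Set β} {m : ℕ}

theorem exists_bool_coloring {V : Type*} {H : SimpleGraph V} (hH : H.IsBipartite) (u : V)
    (σ : Bool) :
    ∃ c : V → Bool, c u = σ ∧ ∀ a b, H.Adj a b → c a ≠ c b := by
  obtain ⟨C⟩ := hH
  refine ⟨fun w => xor (decide (C w = C u)) !σ, by simp, fun a b hab h => C.valid hab ?_⟩
  have h1 : (C a = C u) ↔ (C b = C u) := by simpa using h
  have := (C a).2
  have := (C b).2
  have := (C u).2
  simp only [Fin.ext_iff] at h1 ⊢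
  omega

/-- If `I` and one new vertex for each edge not covered by `I` can be placed in `V₀`, with the
exception of the edge `e₀`, then an edge inside a class yields the ballooning. -/
theorem Host.isContained_of_edge (hG : Host G V₀ P W m) (hH : H.IsBipartite)
    (hm : Nat.card (V ⊕ (Σ e : H.edgeSet, Fin (ℓ e - 2))) ≤ m) (hℓ : ∀ e, 5 ≤ ℓ e ∧ Odd (ℓ e))
    {s t : H.edgeSet → V} (hst : ∀ e, e.1 = s(s e, t e)) {I : Set V}
    (htI : ∀ e, t e ∉ I) {e₀ : H.edgeSet} (he₀ : s e₀ ∉ I)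
    {ψ : V ⊕ H.edgeSet → β} (hψ : ∀ u ∈ I, ψ (.inl u) ∈ V₀)
    (hψ' : ∀ e, s e ∉ I → e ≠ e₀ → ψ (.inr e) ∈ V₀)
    (hψi : Set.InjOn ψ {p | p.elim (· ∈ I) fun e => s e ∉ I ∧ e ≠ e₀})
    {i : Bool} {a b : β} (ha : a ∈ P i) (hb : b ∈ P i) (hab : G.Adj a b) :
    (orientedBallooning H ℓ s t).IsContained G := by
  classical
  -- The 2-colouring places `s e₀` opposite to `ab`, so that the path of `e₀` can start with `a`,
  -- `b`. Every other cycle passes through `V₀`, at a vertex of `I` or at its first new vertex, and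
  -- has no parity obstruction.
  obtain ⟨c, hc₀, hc⟩ := exists_bool_coloring hH (s e₀) (!i)
  have hadj : ∀ e, H.Adj (s e) (t e) := fun e => by
    have := e.2
    rwa [hst e] at this
  have hct : c (t e₀) = i := by
    have := hc _ _ (hadj e₀)
    rw [hc₀] at this
    cases i <;> simpa using this.symm
  set fixH : V → Option β := fun u => if u ∈ I then some (ψ (.inl u)) else none with hfixH
  have hfI : ∀ u ∈ I, fixH u = some (ψ (.inl u)) := fun u hu => by simp [hfixH, hu]
  have hfn : ∀ u ∉ I, fixH u = none := fun u hu => by simp [hfixH, hu]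
  have hfs : ∀ u b, fixH u = some b → u ∈ I ∧ b = ψ (.inl u) := by
    intro u b h
    by_cases hu : u ∈ I
    · rw [hfI u hu] at h
      exact ⟨hu, (Option.some.inj h).symm⟩
    · rw [hfn u hu] at h
      cases h
  set fixP : H.edgeSet → ℕ → Option β := fun e j =>
    if e = e₀ then (Gadget.far a b).fix j else if j = 0 ∧ s e ∉ I then some (ψ (.inr e)) else none
    with hfixP
  have hP₀ : ∀ j, fixP e₀ j = (Gadget.far a b).fix j := fun j => by simp [hfixP]
  have hPs : ∀ e, e ≠ e₀ → ∀ j b, fixP e j = some b → j = 0 ∧ s e ∉ I ∧ b = ψ (.inr e) := by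
    intro e he j b h
    simp only [hfixP, he, if_false] at h
    split_ifs at h with hj
    exact ⟨hj.1, hj.2, (Option.some.inj h).symm⟩
  have hPn : ∀ e, e ≠ e₀ → ∀ j, fixP e (j + 1) = none := fun e he j => by simp [hfixP, he]
  have hPi : ∀ j b', (Gadget.far a b).fix j = some b' → b' ∈ P i := by
    intro j b' h
    rcases Gadget.mem_verts_of_fix h with rfl | rfl
    · exact ha
    · exact hb
  have hPV : ∀ e j b', fixP e j = some b' → b' ∈ V₀ ∨ (e = e₀ ∧ b' ∈ P i) := by
    intro e j b' h
    by_cases he : e = e₀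
    · subst he
      exact .inr ⟨rfl, hPi j b' (by rwa [hP₀] at h)⟩
    · obtain ⟨-, h1, rfl⟩ := hPs e he j b' h
      exact .inl (hψ' e h1 he)
  refine hG.isContained_ballooning hm fixH c fixP (fun e j => xor (!c (t e)) j.bodd)
    ?_ ?_ ?_ ?_ ?_ ?_ ?_ ?_
  · intro u u' b' h h'
    obtain ⟨h1, h2⟩ := hfs u b' h
    obtain ⟨h1', h2'⟩ := hfs u' b' h'
    exact Sum.inl.inj (hψi (show Sum.inl u ∈ _ from h1) (show Sum.inl u' ∈ _ from h1')
      (h2.symm.trans h2'))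
  · intro u e j b' h h'
    obtain ⟨h1, h2⟩ := hfs u b' h
    by_cases he : e = e₀
    · subst he
      rw [hP₀] at h'
      exact hG.notMem_zero (hPi j b' h') (h2 ▸ hψ u h1)
    · obtain ⟨-, h3, h4⟩ := hPs e he j b' h'
      have := hψi (show Sum.inl u ∈ _ from h1) (show Sum.inr e ∈ _ from ⟨h3, he⟩)
        (h2.symm.trans h4)
      cases this
  · intro e j e' j' b' h h'
    by_cases he : e = e₀ <;> by_cases he' : e' = e₀
    · subst he he'
      rw [hP₀] at h h'
      exact ⟨rfl, Gadget.far_fix_injective hab.ne h h'⟩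
    · subst he
      rw [hP₀] at h
      obtain ⟨-, h3, h4⟩ := hPs e' he' j' b' h'
      exact (hG.notMem_zero (hPi j b' h) (h4 ▸ hψ' e' h3 he')).elim
    · subst he'
      rw [hP₀] at h'
      obtain ⟨-, h3, h4⟩ := hPs e he j b' h
      exact (hG.notMem_zero (hPi j' b' h') (h4 ▸ hψ' e h3 he)).elim
    · obtain ⟨h1, h3, h4⟩ := hPs e he j b' h
      obtain ⟨h1', h3', h4'⟩ := hPs e' he' j' b' h'
      exact ⟨Sum.inr.inj (hψi (show Sum.inr e ∈ _ from ⟨h3, he⟩)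
        (show Sum.inr e' ∈ _ from ⟨h3', he'⟩) (h4.symm.trans h4')), h1.trans h1'.symm⟩
  · have hnot : ∀ u u', H.Adj u u' → u ∈ I → u' ∉ I := by
      have hgen : ∀ e : H.edgeSet, ∀ u u', e.1 = s(u, u') → u ∈ I → u' ∉ I := by
        intro e u u' he hu hu'
        rw [hst e] at he
        rcases Sym2.eq_iff.1 he with ⟨rfl, rfl⟩ | ⟨rfl, rfl⟩
        · exact htI e hu'
        · exact htI e hu
      exact fun u u' h => hgen ⟨s(u, u'), h⟩ u u' rfl
    intro u u' h
    by_cases hu : u ∈ I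
    · rw [hfI u hu, hfn u' (hnot u u' h hu)]
      exact .inl (hψ u hu)
    · by_cases hu' : u' ∈ I
      · rw [hfI u' hu', hfn u hu]
        exact .inl (hψ u' hu')
      · rw [hfn u hu, hfn u' hu']
        exact hc u u' h
  · intro e
    by_cases he : e = e₀
    · subst he
      rw [hP₀, hfn _ he₀, hc₀]
      exact .inr (by simpa using ha)
    · by_cases hs : s e ∈ I
      · rw [hfI _ hs]
        simp only [hfixP, he, hs, if_false, not_true, and_false]
        exact .inl (hψ _ hs)
      · rw [hfn _ hs]
        simp only [hfixP, he, hs, if_false, not_false_eq_true, and_self, if_true]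
        exact .inl (hψ' e hs he)
  · intro e
    have hodd := bodd_sub_three (hℓ e).2 (hℓ e).1
    obtain ⟨j, hj⟩ : ∃ j, ℓ e - 3 = j + 2 := ⟨ℓ e - 5, by have := (hℓ e).1; omega⟩
    have : fixP e (ℓ e - 3) = none := by
      rw [hj]
      by_cases he : e = e₀
      · rw [he, hP₀]
        rfl
      · exact hPn e he _
    rw [hfn _ (htI e), this]
    simp [Compat, hodd]
  · intro e j _
    by_cases he : e = e₀
    · subst he
      rw [hP₀, hP₀, hct]
      match j with
      | 0 => exact hab
      | 1 => exact .inr (by simpa using hb)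
      | j + 2 => simp [Gadget.fix, Compat]
    · rw [hPn e he]
      rcases h : fixP e j with _ | b'
      · simp [Compat]
      · obtain ⟨-, h1, rfl⟩ := hPs e he j b' h
        exact .inl (hψ' e h1 he)
  · intro u _
    refine ⟨a, a, ?_, ?_, ?_⟩
    · intro u' b' _ h
      obtain ⟨h1, rfl⟩ := hfs u' b' h
      exact .inl (hψ u' h1)
    · intro e b' _ h
      by_cases he : e = e₀
      · subst he
        rw [hP₀] at h
        exact .inr (.inl (Option.some.inj h).symm)
      · obtain ⟨-, h1, rfl⟩ := hPs e he 0 b' h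
        exact .inl (hψ' e h1 he)
    · intro e b' _ h
      obtain ⟨j, hj⟩ : ∃ j, ℓ e - 3 = j + 2 := ⟨ℓ e - 5, by have := (hℓ e).1; omega⟩
      by_cases he : e = e₀
      · rw [he, hP₀, ← he, hj] at h
        cases h
      · rw [hj, hPn e he] at h
        cases h

/-- `V₀` has room for the whole transversal except the new vertex of `e₀`, so one edge inside a
class would complete the ballooning. Hence the classes are independent and any `h` will do. -/
theorem Host.fewGadgets_of_uncovered (hG : Host G V₀ P W m) (hH : H.IsBipartite)
    (hm : Nat.card (V ⊕ (Σ e : H.edgeSet, Fin (ℓ e - 2))) ≤ m) (hℓ : ∀ e, 5 ≤ ℓ e ∧ Odd (ℓ e))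
    {s t : H.edgeSet → V} (hst : ∀ e, e.1 = s(s e, t e)) {I : Set V}
    (htI : ∀ e, t e ∉ I) {e₀ : H.edgeSet} (he₀ : s e₀ ∉ I)
    (hcard : I.ncard + {e | s e ∉ I}.ncard ≤ V₀.ncard + 1) (h : ℕ)
    (hfree : (orientedBallooning H ℓ s t).Free G) : FewGadgets G P h := by
  classical
  have hno : ∀ a b, ¬(mono G P).Adj a b := by
    intro a b hab
    obtain ⟨i, hab⟩ : ∃ i, (within G (P i)).Adj a b := by
      rcases hab with h | h
      exacts [⟨_, h⟩, ⟨_, h⟩]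
    refine hfree ?_
    set T : Set (V ⊕ H.edgeSet) := {p | p.elim (· ∈ I) fun e => s e ∉ I ∧ e ≠ e₀} with hT
    have hTc : T.ncard ≤ V₀.ncard := by
      have h1 : T ⊆ Sum.inl '' I ∪ Sum.inr '' ({e | s e ∉ I} \ {e₀}) := by
        rintro (u | e) hu
        · exact .inl ⟨u, hu, rfl⟩
        · exact .inr ⟨e, hu, rfl⟩
      have h2 := Set.ncard_le_ncard h1 (Set.toFinite _)
      have h3 := Set.ncard_union_le (Sum.inl '' I : Set (V ⊕ H.edgeSet))
        (Sum.inr '' ({e | s e ∉ I} \ {e₀}))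
      rw [Set.ncard_image_of_injective _ Sum.inl_injective,
        Set.ncard_image_of_injective _ Sum.inr_injective,
        Set.ncard_sdiff_singleton_of_mem (show e₀ ∈ {e | s e ∉ I} from he₀)] at h3
      have h4 : 0 < {e | s e ∉ I}.ncard := (Set.ncard_pos).2 ⟨e₀, he₀⟩
      omega
    obtain ⟨ψ, hψ, hψi⟩ : ∃ ψ : V ⊕ H.edgeSet → β, (∀ p ∈ T, ψ p ∈ V₀) ∧ Set.InjOn ψ T := by
      rcases T.eq_empty_or_nonempty with h0 | h0
      · exact ⟨fun _ => a, by simp [h0], by simp [h0]⟩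
      · exact exists_injOn_mapsTo hTc h0
    exact hG.isContained_of_edge hH hm hℓ hst htI he₀ (fun u hu => hψ (.inl u) hu)
      (fun e h1 h2 => hψ (.inr e) ⟨h1, h2⟩) hψi hab.2.1 hab.2.2 hab.1
  intro i v _ A f hA _ _
  have h1 : (mono G P).neighborSet v = ∅ := Set.eq_empty_iff_forall_notMem.2 fun u hu => hno v u hu
  have h2 : A = ∅ := Finset.eq_empty_iff_forall_notMem.2 fun a ha => hno a _ (hA.adj a ha)
  simp [h1, h2]

end Uncovered

/-! ### Decomposition family and independent transversals of odd cycles -/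

section DecompositionFamily

section Join

variable {V W : Type*} {G : SimpleGraph V} {H : SimpleGraph W}

@[simp]
theorem join_adj_inl_inl {a b : V} : (join G H).Adj (.inl a) (.inl b) ↔ G.Adj a b := by
  simp [join]

@[simp]
theorem join_adj_inr_inr {a b : W} : (join G H).Adj (.inr a) (.inr b) ↔ H.Adj a b := by
  simp [join]

@[simp]
theorem join_adj_inl_inr {a : V} {b : W} : (join G H).Adj (.inl a) (.inr b) := by
  simp [join]

@[simp]
theorem join_adj_inr_inl {a : V} {b : W} : (join G H).Adj (.inr b) (.inl a) := by
  simp [join]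

end Join

theorem numEdges_congr {V W : Type*} {G : SimpleGraph V} {H : SimpleGraph W} (φ : G ≃g H) :
    numEdges G = numEdges H :=
  Nat.card_congr φ.mapEdgeSet

theorem exists_finGraph_iso {W : Type*} [Finite W] (N : SimpleGraph W) :
    ∃ M : FinGraph, Nonempty (M.2 ≃g N) ∧ M.1 = Nat.card W :=
  ⟨⟨Nat.card W, N.comap (Finite.equivFin W).symm⟩, ⟨SimpleGraph.Iso.comap _ N⟩, rfl⟩

variable {α W : Type*} {L : SimpleGraph α}

theorem Completes.mono {W' : Type*} {M : SimpleGraph W} {M' : SimpleGraph W'} (h : Completes L M)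
    (hM : M.IsContained M') : Completes L M' := by
  obtain ⟨s, hs⟩ := h
  obtain ⟨g⟩ := hM
  refine ⟨s, hs.trans ⟨⟨⟨Sum.map (Sum.map g id) id, ?_⟩, ?_⟩⟩⟩
  · rintro ((a | a) | a) ((b | b) | b) <;> simp
    exact g.toHom.map_adj
  · exact ((g.injective.sumMap Function.injective_id).sumMap Function.injective_id)

theorem decompFamily_congr {α' : Type*} {L' : SimpleGraph α'} (h : L.IsContained L')
    (h' : L'.IsContained L) : decompFamily L = decompFamily L' := by
  have : ∀ {m : Type} (M : SimpleGraph m), Completes L M ↔ Completes L' M := fun M =>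
    ⟨fun ⟨s, hs⟩ => ⟨s, h'.trans hs⟩, fun ⟨s, hs⟩ => ⟨s, h.trans hs⟩⟩
  ext M
  simp only [decompFamily, Set.mem_ofPred_eq, this]

/-- Among the completing graphs contained in `N`, one with fewest vertices plus edges has no proper
completing subgraph. -/
theorem exists_mem_decompFamily [Finite W] {N : SimpleGraph W} (hN : Completes L N) :
    ∃ M ∈ decompFamily L, M.2.IsContained N := by
  obtain ⟨N₀, ⟨φ⟩, -⟩ := exists_finGraph_iso N
  obtain ⟨M, ⟨hM, hMN⟩, hmin⟩ := (measure fun M : FinGraph => M.1 + numEdges M.2).wf.has_min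
    {M : FinGraph | Completes L M.2 ∧ M.2.IsContained N}
    ⟨N₀, hN.mono φ.isContained', φ.isContained⟩
  refine ⟨M, ⟨hM, fun M' hM' => ?_⟩, hMN⟩
  obtain ⟨K, ⟨ψ⟩, hK⟩ := exists_finGraph_iso M'.coe
  have h1 := hmin K ⟨hM'.mono ψ.isContained', ψ.isContained.trans
    (M'.coe_isContained.trans hMN)⟩
  have h2 : numEdges K.2 = M'.edgeSet.ncard := by
    rw [numEdges_congr ψ, numEdges, ← M'.image_coe_edgeSet_coe,
      Set.ncard_image_of_injective _ (Sym2.map.injective Subtype.val_injective)]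
  have h3 : M'.edgeSet.ncard ≤ numEdges M.2 := Set.ncard_le_ncard M'.edgeSet_subset (Set.toFinite _)
  have h4 : K.1 = M'.verts.ncard := hK
  have h5 : M'.verts.ncard ≤ M.1 := by
    have := Set.ncard_le_ncard (Set.subset_univ M'.verts) (Set.toFinite _)
    rwa [Set.ncard_univ, Nat.card_eq_fintype_card, Fintype.card_fin] at this
  replace h1 : ¬K.1 + numEdges K.2 < M.1 + numEdges M.2 := h1
  have h6 : M'.verts = Set.univ := Set.eq_of_subset_of_ncard_le (Set.subset_univ _)
    (by rw [Set.ncard_univ, Nat.card_eq_fintype_card, Fintype.card_fin]; omega) (Set.toFinite _)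
  have h7 : M'.edgeSet = M.2.edgeSet := Set.eq_of_subset_of_ncard_le M'.edgeSet_subset
    (by rw [← numEdges]; omega) (Set.toFinite _)
  refine SimpleGraph.Subgraph.ext (by simpa using h6) ?_
  ext a b
  rw [← SimpleGraph.Subgraph.mem_edgeSet, h7]
  simp

/-- `S` is independent and `c` is a proper 2-colouring of the rest of the graph. -/
structure TransversalColoring (L : SimpleGraph α) (S : Set α) (c : α → Bool) : Prop where
  indep : ∀ a b, L.Adj a b → a ∈ S → b ∉ S
  proper : ∀ a b, L.Adj a b → a ∉ S → b ∉ S → c a ≠ c b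

/-- The number of neighbours of `z` outside `S` of colour `true`. -/
noncomputable def colorDegree (L : SimpleGraph α) (S : Set α) (c : α → Bool) (z : α) : ℕ :=
  {b | L.Adj z b ∧ b ∉ S ∧ c b = true}.ncard

/-- The vertices of colour `false` outside `S` form an independent set and go to the joined `I_s`;
all others stay in the induced graph. -/
theorem TransversalColoring.completes [Finite α] {S : Set α} {c : α → Bool}
    (h : TransversalColoring L S c) : Completes L (L.induce (S ∪ {a | c a = true})) := by
  classical
  obtain ⟨A, hA⟩ : ∃ A, A = S ∪ {a | c a = true} := ⟨_, rfl⟩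
  rw [← hA]
  refine ⟨Nat.card α, ⟨⟨⟨fun a => if ha : a ∈ A then .inl (.inl ⟨a, ha⟩)
    else .inr (Finite.equivFin α a), ?_⟩, ?_⟩⟩⟩
  · intro a b hab
    by_cases ha : a ∈ A <;> by_cases hb : b ∈ A
    · simpa [dif_pos ha, dif_pos hb] using hab
    · simp [dif_pos ha, dif_neg hb]
    · simp [dif_neg ha, dif_pos hb]
    · have ha' := ha
      have hb' := hb
      simp only [hA, Set.mem_union, Set.mem_ofPred_eq, not_or, Bool.not_eq_true] at ha' hb'
      exact (h.proper a b hab ha'.1 hb'.1 (ha'.2.trans hb'.2.symm)).elim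
  · intro a b hab
    by_cases ha : a ∈ A <;> by_cases hb : b ∈ A <;>
      simp_all

theorem IsIndepCovering.isBipartite {M : SimpleGraph W} {T : Set W} (h : IsIndepCovering M T) :
    M.IsBipartite := by
  classical
  refine ⟨SimpleGraph.Coloring.mk (fun a => if a ∈ T then 0 else 1) fun {a b} hab => ?_⟩
  by_cases ha : a ∈ T <;> by_cases hb : b ∈ T
  · exact (h.1 ha hb hab.ne hab).elim
  · simp [ha, hb]
  · simp [ha, hb]
  · exact ((h.2 hab).elim ha hb).elim

theorem exists_isIndepCovering {M : SimpleGraph W} (h : M.IsBipartite) :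
    ∃ T, IsIndepCovering M T := by
  obtain ⟨C⟩ := h
  refine ⟨{a | C a = 0}, ?_, ?_⟩
  · intro a ha b hb _ hab
    exact C.valid hab (ha.trans hb.symm)
  · intro a b hab
    have := C.valid hab
    simp only [Set.mem_ofPred_eq]
    omega

theorem indepCoverNum_le {M : SimpleGraph W} {T : Set W} (h : IsIndepCovering M T) :
    indepCoverNum M ≤ T.ncard :=
  Nat.sInf_le ⟨T, h, rfl⟩

theorem qNum_le {𝓛 : Set FinGraph} {M : FinGraph} (hM : M ∈ 𝓛) {T : Set (Fin M.1)}
    (h : IsIndepCovering M.2 T) : qNum 𝓛 ≤ T.ncard :=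
  (Nat.sInf_le ⟨M, hM, h.isBipartite, rfl⟩ : qNum 𝓛 ≤ _).trans (indepCoverNum_le h)

/-- In the graph induced on `S` and the colour `true`, the vertices outside `S` are independent. So
`S` is an independent covering, and it restricts to one of a minimal subgraph. -/
theorem TransversalColoring.exists_mem_decompFamily [Finite α] {S : Set α} {c : α → Bool}
    (h : TransversalColoring L S c) :
    ∃ M ∈ decompFamily L, ∃ T : Set (Fin M.1), IsIndepCovering M.2 T ∧ T.ncard ≤ S.ncard := by
  obtain ⟨M, hM, ⟨g⟩⟩ := OddBalloon.exists_mem_decompFamily h.completes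
  have hg : ∀ {a b}, M.2.Adj a b → L.Adj (g a).1 (g b).1 := fun hab => g.toHom.map_adj hab
  have hinj : Function.Injective fun m => (g m).1 := Subtype.val_injective.comp g.injective
  set T : Set (Fin M.1) := {m | (g m).1 ∈ S}
  refine ⟨M, hM, T, ⟨?_, ?_⟩, ?_⟩
  · intro a ha b hb _ hab
    exact h.indep _ _ (hg hab) ha hb
  · intro a b hab
    by_contra hcon
    rw [not_or] at hcon
    refine h.proper _ _ (hg hab) hcon.1 hcon.2 ?_
    rw [(g a).2.resolve_left hcon.1, (g b).2.resolve_left hcon.2]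
  · rw [← Set.ncard_image_of_injective _ hinj]
    refine Set.ncard_le_ncard ?_ (Set.toFinite _)
    rintro _ ⟨m, hm, rfl⟩
    exact hm

theorem TransversalColoring.qNum_le [Finite α] {S : Set α} {c : α → Bool}
    (h : TransversalColoring L S c) : qNum (decompFamily L) ≤ S.ncard := by
  obtain ⟨M, hM, T, hT, hc⟩ := h.exists_mem_decompFamily
  exact (OddBalloon.qNum_le hM hT).trans hc

/-- The converse passage: `S` is the preimage of `T` under a copy of `L`, and the colour records the
side of the join. If `T` is fully used, a neighbour of colour `true` outside `S` stays on the side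
of `M`, hence maps to a neighbour of `x` in `M`. -/
theorem Completes.exists_transversalColoring [Finite α] [Finite W] {M : SimpleGraph W} {T : Set W}
    (h : Completes L M) (hT : IsIndepCovering M T) :
    ∃ S c, TransversalColoring L S c ∧ S.ncard ≤ T.ncard ∧ (S.ncard = T.ncard → ∀ x ∈ T,
      ∃ z ∈ S, colorDegree L S c z ≤ (M.neighborSet x).ncard) := by
  obtain ⟨s, ⟨f⟩⟩ := h
  have hf : ∀ {a b}, L.Adj a b → _ := fun hab => f.toHom.map_adj hab
  set S : Set α := {z | ∃ m ∈ T, f z = .inl (.inl m)} with hS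
  let c : α → Bool := fun z => (f z).isLeft
  have him : f '' S ⊆ (fun m => .inl (.inl m)) '' T := by
    rintro _ ⟨z, ⟨m, hm, hz⟩, rfl⟩
    exact ⟨m, hm, hz.symm⟩
  have hinj : Function.Injective fun m : W => (Sum.inl (Sum.inl m) : (W ⊕ Fin s) ⊕ Fin s) :=
    Sum.inl_injective.comp Sum.inl_injective
  have h1 : S.ncard = (f '' S).ncard := (Set.ncard_image_of_injective _ f.injective).symm
  have h2 : T.ncard = ((fun m => (Sum.inl (Sum.inl m) : (W ⊕ Fin s) ⊕ Fin s)) '' T).ncard :=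
    (Set.ncard_image_of_injective _ hinj).symm
  have hindep : ∀ a b, L.Adj a b → a ∈ S → b ∉ S := by
    rintro a b hab ⟨m, hm, hma⟩ ⟨m', hm', hmb⟩
    have := hf hab
    simp only [SimpleGraph.Copy.toHom_apply, hma, hmb, join_adj_inl_inl,
      SimpleGraph.sum_adj_inl] at this
    exact hT.1 hm hm' this.ne this
  refine ⟨S, c, ⟨hindep, ?_⟩, ?_, fun hST x hx => ?_⟩
  · intro a b hab ha hb
    have h3 := hf hab
    simp only [SimpleGraph.Copy.toHom_apply] at h3
    simp only [hS, Set.mem_ofPred_eq, not_exists, not_and] at ha hb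
    simp only [c]
    rcases hfa : f a with (p | p) | p <;> rcases hfb : f b with (r | r) | r <;>
      simp [hfa, hfb] at h3 ⊢
    rcases hT.2 h3 with h4 | h4
    · exact ha p h4 hfa
    · exact hb r h4 hfb
  · rw [h1, h2]
    exact Set.ncard_le_ncard him (Set.toFinite _)
  · have h3 := Set.eq_of_subset_of_ncard_le him (by rw [← h1, ← h2, hST]) (Set.toFinite _)
    have h4 : (Sum.inl (Sum.inl x) : (W ⊕ Fin s) ⊕ Fin s) ∈ f '' S := h3 ▸ ⟨x, hx, rfl⟩
    obtain ⟨z, hz, hfz⟩ := h4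
    refine ⟨z, hz, ?_⟩
    rw [colorDegree, ← Set.ncard_image_of_injective _ f.injective,
      ← Set.ncard_image_of_injective (M.neighborSet x) hinj]
    refine Set.ncard_le_ncard ?_ (Set.toFinite _)
    rintro _ ⟨b, ⟨hb, -, hcb⟩, rfl⟩
    have h5 := hf hb
    simp only [SimpleGraph.Copy.toHom_apply, hfz] at h5
    simp only [c] at hcb
    rcases hfb : f b with (r | r) | r <;> simp [hfb] at h5 hcb
    exact ⟨r, h5, rfl⟩

/-- As `sInf ∅ = 0`, the assumption on `q` ensures that the minima defining `q` and `k` are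
attained. -/
theorem exists_transversalColoring_eq_qNum [Finite α] (hq : qNum (decompFamily L) ≠ 0) :
    ∃ S c, TransversalColoring L S c ∧ S.ncard = qNum (decompFamily L) ∧
      ∃ z ∈ S, colorDegree L S c z ≤ kNum (decompFamily L) := by
  have hne : {c | ∃ M ∈ decompFamily L, M.2.IsBipartite ∧ indepCoverNum M.2 = c}.Nonempty :=
    Nat.nonempty_of_sInf_eq_succ (Nat.succ_pred_eq_of_ne_zero hq).symm
  obtain ⟨M, hM, hbip, hMq⟩ := Nat.sInf_mem hne
  obtain ⟨T₀, hT₀⟩ := exists_isIndepCovering hbip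
  obtain ⟨T, hT, hTc⟩ := Nat.sInf_mem (⟨_, T₀, hT₀, rfl⟩ :
    {c | ∃ S : Set (Fin M.1), IsIndepCovering M.2 S ∧ S.ncard = c}.Nonempty)
  have hTq : T.ncard = qNum (decompFamily L) := hTc.trans hMq
  obtain ⟨x, hx⟩ : T.Nonempty := by
    rw [← Set.ncard_pos]
    omega
  obtain ⟨M', T', ⟨hM', -, hT', hTq'⟩, x', hx', hd⟩ := Nat.sInf_mem (⟨_, M, T,
    ⟨hM, hbip, hT, hTq⟩, x, hx, rfl⟩ : {d | ∃ (M : FinGraph) (S : Set (Fin M.1)),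
      IsMinIndepCovering (decompFamily L) M S ∧
        ∃ x ∈ S, (M.2.neighborSet x).ncard = d}.Nonempty)
  obtain ⟨S, c, hc, hle, hdeg⟩ := hM'.1.exists_transversalColoring hT'
  have hSq : S.ncard = qNum (decompFamily L) := le_antisymm (hle.trans hTq'.le) hc.qNum_le
  obtain ⟨z, hz, hzd⟩ := hdeg (hSq.trans hTq'.symm) x' hx'
  exact ⟨S, c, hc, hSq, z, hz, hzd.trans hd.le⟩

end DecompositionFamily

/-! ### The numbers `q` and `k` in terms of `H` -/

section CoveringNumbers

variable {V : Type*} {H : SimpleGraph V} {ℓ : H.edgeSet → ℕ} {s t : H.edgeSet → V}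

/-- An independent set `I` of `H` and the first new vertex of each edge not covered by `I`. -/
def standardTransversal (H : SimpleGraph V) (ℓ : H.edgeSet → ℕ) (s : H.edgeSet → V) (I : Set V) :
    Set (V ⊕ (Σ e : H.edgeSet, Fin (ℓ e - 2))) :=
  {z | z.elim (· ∈ I) fun p => s p.1 ∉ I ∧ (p.2 : ℕ) = 0}

/-- A colouring of the ballooning that extends the colouring `c` of `H` along the new paths. -/
def standardColoring (ℓ : H.edgeSet → ℕ) (t : H.edgeSet → V) (c : V → Bool) :
    (V ⊕ (Σ e : H.edgeSet, Fin (ℓ e - 2))) → Bool :=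
  Sum.elim c fun p => xor (!c (t p.1)) (p.2 : ℕ).bodd

theorem adj_ends (hst : ∀ e, e.1 = s(s e, t e)) (e : H.edgeSet) : H.Adj (s e) (t e) := by
  have := e.2
  rwa [hst e] at this

/-- The colour alternates along each new path so as to fit at `t e`, whose neighbour has even
position. The only conflict is at `s e`, where `s e` or the first new vertex belongs to the
transversal. -/
theorem transversalColoring_standard (hℓ : ∀ e, 5 ≤ ℓ e ∧ Odd (ℓ e)) {I : Set V}
    (hI : H.IsIndepSet I) (htI : ∀ e, t e ∉ I) {c : V → Bool} (hc : ∀ a b, H.Adj a b → c a ≠ c b) :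
    TransversalColoring (orientedBallooning H ℓ s t) (standardTransversal H ℓ s I)
      (standardColoring ℓ t c) := by
  have hlast : ∀ (e : H.edgeSet) (i : Fin (ℓ e - 2)), (i : ℕ) + 1 = ℓ e - 2 →
      (i : ℕ).bodd = false ∧ (i : ℕ) ≠ 0 := by
    intro e i hi
    have := (hℓ e).1
    have h1 := bodd_sub_three (hℓ e).2 (hℓ e).1
    rw [show (i : ℕ) = ℓ e - 3 by omega]
    exact ⟨h1, by omega⟩
  constructor
  · have key : ∀ u (e : H.edgeSet) (i : Fin (ℓ e - 2)),
        (u = s e ∧ (i : ℕ) = 0) ∨ (u = t e ∧ (i : ℕ) + 1 = ℓ e - 2) → u ∈ I → s e ∉ I →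
        (i : ℕ) ≠ 0 := by
      rintro u e i (⟨rfl, h⟩ | ⟨rfl, h⟩) hu hs
      · exact (hs hu).elim
      · exact (htI e hu).elim
    rintro (u | ⟨e, i⟩) (u' | ⟨e', i'⟩) hadj ha hb
    · rw [orientedBallooning_adj_inl_inl] at hadj
      exact hI ha hb hadj.ne hadj
    · rw [orientedBallooning_adj_inl_inr] at hadj
      exact key u e' i' hadj ha hb.1 hb.2
    · rw [orientedBallooning_adj_inr_inl] at hadj
      exact key u' e i hadj hb ha.1 ha.2
    · rw [orientedBallooning_adj_inr_inr] at hadj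
      have h1 : (i : ℕ) = 0 := ha.2
      have h2 : (i' : ℕ) = 0 := hb.2
      omega
  · have key : ∀ u (e : H.edgeSet) (i : Fin (ℓ e - 2)),
        (u = s e ∧ (i : ℕ) = 0) ∨ (u = t e ∧ (i : ℕ) + 1 = ℓ e - 2) → u ∉ I →
        ¬(s e ∉ I ∧ (i : ℕ) = 0) → c u ≠ xor (!c (t e)) (i : ℕ).bodd := by
      rintro u e i (⟨rfl, h⟩ | ⟨rfl, h⟩) hu hs
      · exact (hs ⟨hu, h⟩).elim
      · simp [(hlast e i h).1]
    rintro (u | ⟨e, i⟩) (u' | ⟨e', i'⟩) hadj ha hb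
    · exact hc u u' (by simpa using hadj)
    · rw [orientedBallooning_adj_inl_inr] at hadj
      exact key u e' i' hadj ha hb
    · rw [orientedBallooning_adj_inr_inl] at hadj
      exact (key u' e i hadj hb ha).symm
    · rw [orientedBallooning_adj_inr_inr] at hadj
      obtain ⟨rfl, h⟩ := hadj
      simp only [standardColoring, Sum.elim_inr]
      rcases h with h | h <;> rw [← h] <;> simp

theorem TransversalColoring.bodd_path {S : Set (V ⊕ (Σ e : H.edgeSet, Fin (ℓ e - 2)))}
    {c : (V ⊕ (Σ e : H.edgeSet, Fin (ℓ e - 2))) → Bool}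
    (h : TransversalColoring (orientedBallooning H ℓ s t) S c) {e : H.edgeSet}
    (he : ∀ i, .inr ⟨e, i⟩ ∉ S) (i : ℕ) (hi : i < ℓ e - 2) :
    c (.inr ⟨e, ⟨i, hi⟩⟩) = xor (c (.inr ⟨e, ⟨0, by omega⟩⟩)) i.bodd := by
  induction i with
  | zero => simp
  | succ i ih =>
    have h1 := h.proper (.inr ⟨e, ⟨i, by omega⟩⟩) (.inr ⟨e, ⟨i + 1, hi⟩⟩) (by simp) (he _) (he _)
    rw [ih (by omega)] at h1
    rw [Nat.bodd_succ]
    revert h1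
    generalize c (.inr ⟨e, ⟨i + 1, hi⟩⟩) = x
    generalize c (.inr ⟨e, ⟨0, _⟩⟩) = y
    cases x <;> cases y <;> cases i.bodd <;> simp

variable [Finite V]

theorem ncard_standardTransversal_le (I : Set V) :
    (standardTransversal H ℓ s I).ncard ≤ I.ncard + {e | s e ∉ I}.ncard := by
  set F : V ⊕ (Σ e : H.edgeSet, Fin (ℓ e - 2)) → V ⊕ H.edgeSet := Sum.map id Sigma.fst with hF
  have h1 : Set.InjOn F (standardTransversal H ℓ s I) := by
    rintro (u | ⟨e, i⟩) ha (u' | ⟨e', i'⟩) hb hab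
    · simpa [hF] using hab
    · simp [hF] at hab
    · simp [hF] at hab
    · obtain rfl : e = e' := by simpa [hF] using hab
      have h2 : (i : ℕ) = 0 := ha.2
      have h3 : (i' : ℕ) = 0 := hb.2
      rw [Fin.ext (h2.trans h3.symm)]
  rw [← h1.ncard_image]
  refine (Set.ncard_le_ncard (t := Sum.inl '' I ∪ Sum.inr '' {e | s e ∉ I}) ?_
    (Set.toFinite _)).trans ((Set.ncard_union_le _ _).trans_eq ?_)
  · rintro _ ⟨u | ⟨e, i⟩, hu, rfl⟩
    · exact .inl ⟨u, hu, rfl⟩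
    · exact .inr ⟨e, hu.1, rfl⟩
  · rw [Set.ncard_image_of_injective _ Sum.inl_injective,
      Set.ncard_image_of_injective _ Sum.inr_injective]

theorem qNum_le_of_indepSet (hH : H.IsBipartite) (hℓ : ∀ e, 5 ≤ ℓ e ∧ Odd (ℓ e)) {I : Set V}
    (hI : H.IsIndepSet I) (htI : ∀ e, t e ∉ I) :
    qNum (decompFamily (orientedBallooning H ℓ s t)) ≤ I.ncard + {e | s e ∉ I}.ncard := by
  obtain ⟨c, hc⟩ : ∃ c : V → Bool, ∀ a b, H.Adj a b → c a ≠ c b := by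
    rcases isEmpty_or_nonempty V with hV | ⟨⟨u⟩⟩
    · exact ⟨fun _ => true, fun a => hV.elim a⟩
    · obtain ⟨c, -, hc⟩ := exists_bool_coloring hH u true
      exact ⟨c, hc⟩
  exact (transversalColoring_standard (s := s) hℓ hI htI hc).qNum_le.trans
    (ncard_standardTransversal_le I)

/-- Let `I` be the part in `H` of a least transversal `S`. The odd cycle of an uncovered edge must
contain a new vertex of `S`, so `|S|` is at least the stated sum; the standard transversal of `I`
gives the reverse inequality. If `I` covers `H`, then `S` has no new vertices, and the colour degree
of `x` is at least `d_H(x)`. -/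
theorem exists_indepSet_of_qNum_ne_zero (hH : H.IsBipartite) (hℓ : ∀ e, 5 ≤ ℓ e ∧ Odd (ℓ e))
    (hst : ∀ e, e.1 = s(s e, t e)) {q k : ℕ}
    (hq : q = qNum (decompFamily (orientedBallooning H ℓ s t)))
    (hk : k = kNum (decompFamily (orientedBallooning H ℓ s t))) (hq0 : q ≠ 0) :
    ∃ (I : Set V) (s' t' : H.edgeSet → V), (∀ e, e.1 = s(s' e, t' e)) ∧ (∀ e, t' e ∉ I) ∧
      I.ncard + {e | s' e ∉ I}.ncard = q ∧
      ((∀ e, s' e ∈ I) → ∃ x ∈ I, (H.neighborSet x).ncard ≤ k) := by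
  classical
  obtain ⟨S, c, hc, hS, z, hz, hzd⟩ := exists_transversalColoring_eq_qNum (hq ▸ hq0)
  set I : Set V := {u | .inl u ∈ S} with hIdef
  have hI : H.IsIndepSet I := fun a ha b hb _ hab => hc.indep (.inl a) (.inl b) (by simpa) ha hb
  obtain ⟨s', t', hst', htI⟩ := exists_orientation H hI
  have hfam : decompFamily (orientedBallooning H ℓ s t) =
      decompFamily (orientedBallooning H ℓ s' t') :=
    decompFamily_congr (orientedBallooning_isContained hst hst')
      (orientedBallooning_isContained hst' hst)
  have hlt : ∀ e, ℓ e - 3 < ℓ e - 2 := fun e => by have := (hℓ e).1; omega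
  have h0lt : ∀ e, 0 < ℓ e - 2 := fun e => by have := (hℓ e).1; omega
  have hends : ∀ e, (∀ i, .inr ⟨e, i⟩ ∉ S) → c (.inr ⟨e, ⟨ℓ e - 3, hlt e⟩⟩) =
      c (.inr ⟨e, ⟨0, h0lt e⟩⟩) := by
    intro e he
    rw [hc.bodd_path he, bodd_sub_three (hℓ e).2 (hℓ e).1, Bool.xor_false]
  have hadjs : ∀ e, (orientedBallooning H ℓ s t).Adj (.inl (s e)) (.inr ⟨e, ⟨0, h0lt e⟩⟩) :=
    fun e => by simp
  have hadjt : ∀ e, (orientedBallooning H ℓ s t).Adj (.inl (t e))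
      (.inr ⟨e, ⟨ℓ e - 3, hlt e⟩⟩) := fun e => by
    have := (hℓ e).1
    simp
    omega
  have hcov : ∀ e, s' e ∉ I → s e ∉ I ∧ t e ∉ I := by
    intro e he
    have := htI e
    rcases Sym2.eq_iff.1 ((hst e).symm.trans (hst' e)) with h | h <;> rw [h.1, h.2]
    exacts [⟨he, this⟩, ⟨this, he⟩]
  have hmid : ∀ e, s' e ∉ I → ∃ i, .inr ⟨e, i⟩ ∈ S := by
    intro e he
    obtain ⟨hs, ht⟩ := hcov e he
    by_contra hcon
    push Not at hcon
    have h1 := hc.proper _ _ (hadjs e) hs (hcon _)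
    have h2 := hc.proper _ _ (hadjt e) ht (hcon _)
    have h3 := hc.proper (.inl (s e)) (.inl (t e)) (by simpa using adj_ends hst e) hs ht
    rw [hends e hcon] at h2
    revert h1 h2 h3
    generalize c (.inl (s e)) = x
    generalize c (.inl (t e)) = y
    generalize c (.inr ⟨e, ⟨0, _⟩⟩) = w
    cases x <;> cases y <;> cases w <;> simp
  have hup := qNum_le_of_indepSet (s := s') hH hℓ hI htI
  rw [← hfam, ← hq] at hup
  have hsub : Sum.inl '' I ∪ {z ∈ S | z.isRight} = S := by
    ext z
    constructor
    · rintro (⟨u, hu, rfl⟩ | hz)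
      · exact hu
      · exact hz.1
    · intro hz
      rcases z with u | p
      · exact .inl ⟨u, hz, rfl⟩
      · exact .inr ⟨hz, rfl⟩
  have hdisj : Disjoint (Sum.inl '' I) {z ∈ S | z.isRight} := by
    rw [Set.disjoint_left]
    rintro _ ⟨u, -, rfl⟩ h
    simp at h
  have hSc : S.ncard = I.ncard + {z ∈ S | z.isRight}.ncard := by
    rw [← Set.ncard_image_of_injective I (Sum.inl_injective (β := Σ e : H.edgeSet, Fin (ℓ e - 2))),
      ← Set.ncard_union_eq hdisj, hsub]
  have hUc : {e | s' e ∉ I}.ncard ≤ {z ∈ S | z.isRight}.ncard := by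
    have : ∀ e, Nonempty (Fin (ℓ e - 2)) := fun e => ⟨⟨0, h0lt e⟩⟩
    choose! i hi using hmid
    refine Set.ncard_le_ncard_of_injOn (fun e => .inr ⟨e, i e⟩) (fun e he => ⟨hi e he, rfl⟩) ?_
      (Set.toFinite _)
    intro e _ e' _ hee
    simpa using congrArg Sigma.fst (Sum.inr.inj hee)
  have heq : q = I.ncard + {e | s' e ∉ I}.ncard := by
    rw [← hq] at hS
    omega
  refine ⟨I, s', t', hst', htI, heq.symm, fun hall => ?_⟩
  have hR0 : {z ∈ S | z.isRight}.ncard = 0 := by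
    have : {e | s' e ∉ I} = ∅ := Set.eq_empty_iff_forall_notMem.2 fun e he => he (hall e)
    rw [this, Set.ncard_empty] at heq
    rw [← hq] at hS
    omega
  have hnoR : ∀ p, .inr p ∉ S := fun p hp => by
    rw [Set.ncard_eq_zero (Set.toFinite _)] at hR0
    have h1 : Sum.inr p ∈ {z ∈ S | z.isRight} := ⟨hp, rfl⟩
    rw [hR0] at h1
    exact h1
  obtain ⟨x, rfl⟩ : ∃ x, z = .inl x := by
    rcases z with x | p
    · exact ⟨x, rfl⟩
    · exact (hnoR p hz).elim
  refine ⟨x, hz, ?_⟩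
  rw [hk]
  refine le_trans ?_ hzd
  -- The two ends of the new path have the same colour, opposite to that of `y`. So `y` or the new
  -- neighbour of `x` on this cycle has colour `true`, and these choices differ for different `y`.
  have hchoose : ∀ y, H.Adj x y → ∃ b, b ∈ {b | (orientedBallooning H ℓ s t).Adj (.inl x) b ∧
      b ∉ S ∧ c b = true} ∧ (b = .inl y ∨ ∃ p, b = .inr p ∧ p.1.1 = s(x, y)) := by
    intro y hxy
    have hyI : .inl y ∉ S := fun hy => hI hz hy hxy.ne hxy
    by_cases hcy : c (.inl y) = true
    · exact ⟨.inl y, ⟨by simpa, hyI, hcy⟩, .inl rfl⟩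
    · obtain ⟨e, he⟩ : ∃ e : H.edgeSet, e.1 = s(x, y) := ⟨⟨s(x, y), hxy⟩, rfl⟩
      have hee := hends e fun i => hnoR _
      rcases Sym2.eq_iff.1 ((hst e).symm.trans he) with ⟨hs, ht⟩ | ⟨hs, ht⟩
      · refine ⟨.inr ⟨e, ⟨0, h0lt e⟩⟩, ⟨hs ▸ hadjs e, hnoR _, ?_⟩, .inr ⟨_, rfl, he⟩⟩
        have := hc.proper _ _ (hadjt e) (ht ▸ hyI) (hnoR _)
        rw [hee, ht, Bool.eq_false_iff.2 hcy] at this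
        simpa using this.symm
      · refine ⟨.inr ⟨e, ⟨ℓ e - 3, hlt e⟩⟩, ⟨ht ▸ hadjt e, hnoR _, ?_⟩, .inr ⟨_, rfl, he⟩⟩
        have := hc.proper _ _ (hadjs e) (hs ▸ hyI) (hnoR _)
        rw [← hee, hs, Bool.eq_false_iff.2 hcy] at this
        simpa using this.symm
  choose! F hF1 hF2 using hchoose
  refine Set.ncard_le_ncard_of_injOn F (fun y hy => hF1 y hy) ?_ (Set.toFinite _)
  intro y hy y' hy' hyy
  rcases hF2 y hy with h1 | ⟨p, h1, h2⟩ <;> rcases hF2 y' hy' with h3 | ⟨p', h3, h4⟩ <;>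
    rw [← hyy, h1] at h3
  · exact Sum.inl.inj h3
  · cases h3
  · cases h3
  · obtain rfl := Sum.inr.inj h3
    have := h2.symm.trans h4
    rcases Sym2.eq_iff.1 this with h | h
    · exact h.2
    · exact h.2.trans h.1

end CoveringNumbers

/-! ### Edge counts, and the host graph block by block -/

section EdgeCounts

section Counting

variable {V W : Type*}

theorem numEdges_bot : numEdges (⊥ : SimpleGraph V) = 0 := by
  rw [numEdges, SimpleGraph.edgeSet_bot, Set.ncard_empty]

theorem numEdges_mono [Finite V] {G G' : SimpleGraph V} (h : G ≤ G') : numEdges G ≤ numEdges G' :=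
  Set.ncard_le_ncard (SimpleGraph.edgeSet_subset_edgeSet.2 h) (Set.toFinite _)

theorem numEdges_sum [Finite V] [Finite W] (G : SimpleGraph (V ⊕ W)) :
    numEdges G = numEdges (G.comap Sum.inl) + numEdges (G.comap Sum.inr) +
      {p : V × W | G.Adj (.inl p.1) (.inr p.2)}.ncard := by
  set A := Sym2.map Sum.inl '' (G.comap Sum.inl).edgeSet with hA
  set B := Sym2.map Sum.inr '' (G.comap Sum.inr).edgeSet with hB
  set g : V × W → Sym2 (V ⊕ W) := fun p => s(.inl p.1, .inr p.2) with hg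
  set C := g '' {p : V × W | G.Adj (.inl p.1) (.inr p.2)} with hC
  have hginj : Function.Injective g := by
    rintro ⟨a, b⟩ ⟨a', b'⟩ h
    simpa [hg] using h
  have hU : G.edgeSet = A ∪ B ∪ C := by
    ext e
    induction e with | h x y => ?_
    constructor
    · intro h
      rw [SimpleGraph.mem_edgeSet] at h
      rcases x with x | x <;> rcases y with y | y
      · exact .inl (.inl ⟨s(x, y), h, rfl⟩)
      · exact .inr ⟨(x, y), h, rfl⟩
      · exact .inr ⟨(y, x), h.symm, Sym2.eq_swap⟩
      · exact .inl (.inr ⟨s(x, y), h, rfl⟩)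
    · rintro ((⟨e, he, h⟩ | ⟨e, he, h⟩) | ⟨p, hp, h⟩)
      · rw [← h]
        induction e with | h a b => exact he
      · rw [← h]
        induction e with | h a b => exact he
      · rw [← h]
        exact hp
  have hAB : Disjoint A B := by
    rw [Set.disjoint_left]
    rintro _ ⟨e, -, rfl⟩ ⟨e', -, h⟩
    induction e with | h a b => ?_
    induction e' with | h a' b' => ?_
    simp at h
  have hABC : Disjoint (A ∪ B) C := by
    rw [Set.disjoint_left]
    rintro _ (⟨e, -, rfl⟩ | ⟨e, -, rfl⟩) ⟨p, -, h⟩ <;>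
    · induction e with | h a b => ?_
      simp [hg] at h
  rw [numEdges, hU, Set.ncard_union_eq hABC, Set.ncard_union_eq hAB,
    Set.ncard_image_of_injective _ hginj,
    Set.ncard_image_of_injective _ (Sym2.map.injective Sum.inl_injective),
    Set.ncard_image_of_injective _ (Sym2.map.injective Sum.inr_injective), numEdges, numEdges]

theorem numEdges_join [Finite V] [Finite W] (G : SimpleGraph V) (H : SimpleGraph W) :
    numEdges (join G H) = numEdges G + numEdges H + Nat.card V * Nat.card W := by
  rw [numEdges_sum]
  congr 1
  · congr 2 <;> ext <;> simp
  · simp [Set.ncard_univ]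

theorem numEdges_completeBipartiteGraph [Finite V] [Finite W] :
    numEdges (completeBipartiteGraph V W) = Nat.card V * Nat.card W := by
  rw [numEdges_sum, show (completeBipartiteGraph V W).comap Sum.inl = ⊥ by ext; simp,
    show (completeBipartiteGraph V W).comap Sum.inr = ⊥ by ext; simp, numEdges_bot, numEdges_bot]
  simp [Set.ncard_univ]

theorem numEdges_comap_equiv (e : V ≃ W) (G : SimpleGraph W) : numEdges (G.comap e) = numEdges G :=
  numEdges_congr (SimpleGraph.Iso.comap e G)

theorem numEdges_map (f : V ↪ W) (G : SimpleGraph V) : numEdges (G.map f) = numEdges G := by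
  rw [numEdges, SimpleGraph.edgeSet_map, Set.ncard_image_of_injective _ f.sym2Map.injective,
    numEdges]

/-- The classes of even and of odd numbers below `m`. -/
def parityEquiv (m : ℕ) : Fin ((m + 1) / 2) ⊕ Fin (m / 2) ≃ Fin m where
  toFun := Sum.elim (fun j => ⟨2 * j, by omega⟩) fun j => ⟨2 * j + 1, by omega⟩
  invFun i := if h : (i : ℕ) % 2 = 0 then .inl ⟨i / 2, by omega⟩ else .inr ⟨i / 2, by omega⟩
  left_inv x := by
    rcases x with j | j
    · simp
    · have h : (2 * (j : ℕ) + 1) % 2 ≠ 0 := by omega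
      have h' : (2 * (j : ℕ) + 1) / 2 = j := by omega
      simp [h']
  right_inv i := by
    by_cases h : (i : ℕ) % 2 = 0
    · simp only [h, dite_true, Sum.elim_inl]
      ext
      simp only
      omega
    · simp only [h, dite_false, Sum.elim_inr]
      ext
      simp only
      omega

theorem numEdges_turanGraph_two (m : ℕ) :
    numEdges (SimpleGraph.turanGraph m 2) = (m + 1) / 2 * (m / 2) := by
  rw [← numEdges_comap_equiv (parityEquiv m), show (SimpleGraph.turanGraph m 2).comap
    (parityEquiv m) = completeBipartiteGraph _ _ from ?_, numEdges_completeBipartiteGraph,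
    Nat.card_eq_fintype_card, Nat.card_eq_fintype_card, Fintype.card_fin, Fintype.card_fin]
  ext a b
  rcases a with a | a <;> rcases b with b | b <;>
    simp [SimpleGraph.turanGraph_adj, parityEquiv, Nat.add_mod]

theorem fNum_eq (n q : ℕ) : fNum n q =
    (n - (q - 1) + 1) / 2 * ((n - (q - 1)) / 2) + (q - 1) * (n - (q - 1)) := by
  rw [fNum, numEdges_join, numEdges_bot, numEdges_turanGraph_two, zero_add]
  simp

/-- The `K_{h,h}` lies inside one residue class and hence shares no edge with the Turán graph. -/
theorem InF.numEdges_eq {n q h : ℕ} {𝓑 : Set FinGraph} {G : SimpleGraph V} (hG : InF n q h 𝓑 G) :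
    numEdges G = fNum n q + ex (q - 1) 𝓑 + h ^ 2 := by
  obtain ⟨Q, hQ, φ, ⟨r, hr⟩, ⟨ψ⟩⟩ := hG
  have hdisj : Disjoint (SimpleGraph.turanGraph (n - (q - 1)) 2)
      ((completeBipartiteGraph (Fin h) (Fin h)).map φ) := by
    rw [SimpleGraph.disjoint_left]
    rintro a b hab ⟨-, x, y, -, rfl, rfl⟩
    rw [SimpleGraph.turanGraph_adj, hr, hr] at hab
    exact hab rfl
  rw [numEdges_congr ψ, numEdges_join, hQ.2, fNum_eq, numEdges, SimpleGraph.edgeSet_sup,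
    Set.ncard_union_eq (SimpleGraph.disjoint_edgeSet.2 hdisj), ← numEdges, ← numEdges,
    numEdges_turanGraph_two, numEdges_map, numEdges_completeBipartiteGraph]
  simp only [Nat.card_eq_fintype_card, Fintype.card_fin]
  ring

theorem numEdges_le_ex {n : ℕ} {𝓑 : Set FinGraph} [Finite V] {G : SimpleGraph V}
    (hG : FamilyFree 𝓑 G) (hn : Nat.card V = n) : numEdges G ≤ ex n 𝓑 := by
  obtain ⟨M, ⟨φ⟩, hM⟩ := exists_finGraph_iso G
  obtain ⟨m, M⟩ := M
  obtain rfl : m = n := hM.trans hn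
  rw [← numEdges_congr φ]
  refine le_csSup ?_ ⟨M, fun L hL => (SimpleGraph.free_congr_right φ).2 (hG L hL), rfl⟩
  exact ⟨numEdges (⊤ : SimpleGraph (Fin m)), fun _ ⟨G, _, h⟩ => h ▸ numEdges_mono le_top⟩

end Counting

section Host

variable {β : Type*} {G : SimpleGraph β} {V₀ : Set β} {P W : Bool → Set β} {m : ℕ}

theorem Host.sum_elim_bijective (hG : Host G V₀ P W m) : Function.Bijective
    (Sum.elim Subtype.val (Sum.elim Subtype.val Subtype.val) :
      V₀ ⊕ (P false ⊕ P true) → β) := by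
  have h0 := Set.disjoint_left.1 (hG.disj₀ false)
  have h1 := Set.disjoint_left.1 (hG.disj₀ true)
  have h2 := Set.disjoint_left.1 hG.disj
  constructor
  · rintro (a | a | a) (b | b | b) h <;> simp only [Sum.elim_inl, Sum.elim_inr] at h
    · rw [Subtype.ext h]
    · exact (h0 a.2 (h ▸ b.2)).elim
    · exact (h1 a.2 (h ▸ b.2)).elim
    · exact (h0 b.2 (h ▸ a.2)).elim
    · rw [Subtype.ext h]
    · exact (h2 a.2 (h ▸ b.2)).elim
    · exact (h1 b.2 (h ▸ a.2)).elim
    · exact (h2 b.2 (h ▸ a.2)).elim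
    · rw [Subtype.ext h]
  · intro v
    rcases hG.cover v with h | ⟨i | i, h⟩
    · exact ⟨.inl ⟨v, h⟩, rfl⟩
    · exact ⟨.inr (.inl ⟨v, h⟩), rfl⟩
    · exact ⟨.inr (.inr ⟨v, h⟩), rfl⟩

/-- The partition of the vertices as an equivalence. -/
noncomputable def Host.equiv (hG : Host G V₀ P W m) : V₀ ⊕ (P false ⊕ P true) ≃ β :=
  Equiv.ofBijective _ hG.sum_elim_bijective

/-- The edges between `V₀` and the two classes. -/
def Host.cross (_ : Host G V₀ P W m) : Set (V₀ × (P false ⊕ P true)) :=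
  {p | G.Adj p.1 (p.2.elim Subtype.val Subtype.val)}

variable [Finite β]

/-- A copy of `M[C]` in `V₀` takes the place of `C`. The other vertices of `M` are independent,
since `C` is a covering, so the two sides of the join can be sent to the two classes. The graph
`K_q` does not fit into `q - 1` vertices. -/
theorem Host.familyFree_induce (hG : Host G V₀ P W m) {α : Type*} [Finite α] {L : SimpleGraph α}
    (hm : Nat.card α ≤ m) (hV : V₀.ncard + 1 = qNum (decompFamily L)) (hfree : L.Free G) :
    FamilyFree (coveringFamily (decompFamily L)) (G.induce V₀) := by
  classical
  intro Q hQ ⟨ψ⟩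
  unfold coveringFamily at hQ
  split_ifs at hQ with hβ
  · obtain rfl : Q = _ := hQ
    have := Nat.card_le_card_of_injective _ ψ.injective
    rw [Nat.card_eq_fintype_card, Fintype.card_fin, Nat.card_coe_set_eq] at this
    simp only at this
    omega
  · obtain ⟨M, hM, C, hC, -, ⟨e⟩⟩ := hQ
    obtain ⟨s, ⟨f⟩⟩ := hM.1
    have hf : ∀ {a b}, L.Adj a b → _ := fun hab => f.toHom.map_adj hab
    let g : Fin M.1 → Option β := fun x => if hx : x ∈ C then some (ψ (e.symm ⟨x, hx⟩)).1 else none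
    have hg : ∀ x b, g x = some b → ∃ hx : x ∈ C, b = (ψ (e.symm ⟨x, hx⟩)).1 := by
      intro x b h
      by_cases hx : x ∈ C
      · simp only [g, hx, dite_true] at h
        exact ⟨hx, (Option.some.inj h).symm⟩
      · simp [g, hx] at h
    let fix : α → Option β := fun z => (f z).elim (Sum.elim g fun _ => none) fun _ => none
    have hfix : ∀ z b, fix z = some b → ∃ (x : Fin M.1) (hx : x ∈ C), f z = .inl (.inl x) ∧
        b = (ψ (e.symm ⟨x, hx⟩)).1 := by
      intro z b h
      simp only [fix] at h
      rcases hfz : f z with (x | x) | x <;> rw [hfz] at h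
      · obtain ⟨hx, hb⟩ := hg x b h
        exact ⟨x, hx, rfl, hb⟩
      · cases h
      · cases h
    have hfixV : ∀ z b, fix z = some b → b ∈ V₀ := by
      intro z b h
      obtain ⟨x, hx, -, rfl⟩ := hfix z b h
      exact (ψ _).2
    have hnone : ∀ z, fix z = none → ∀ x, f z = .inl (.inl x) → x ∉ C := by
      intro z hz x hx hxC
      simp [fix, hx, g, hxC] at hz
    refine hfree (hG.isContained hm fix (fun z => (f z).isLeft) ?_ ?_ ?_)
    · intro a a' b h h'
      obtain ⟨x, hx, hax, rfl⟩ := hfix a b h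
      obtain ⟨x', hx', hax', hb⟩ := hfix a' _ h'
      have : (⟨x, hx⟩ : C) = ⟨x', hx'⟩ := e.symm.injective (ψ.injective (Subtype.ext hb))
      refine f.injective (hax.trans (Eq.trans ?_ hax'.symm))
      rw [Subtype.mk.inj this]
    · intro a a' haa
      have h1 := hf haa
      simp only [SimpleGraph.Copy.toHom_apply] at h1
      rcases ha : fix a with _ | b <;> rcases ha' : fix a' with _ | b'
      · simp only [Compat]
        have h2 := hnone a ha
        have h3 := hnone a' ha'
        rcases hfa : f a with (p | p) | p <;> rcases hfb : f a' with (r | r) | r <;>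
          simp [hfa, hfb] at h1 ⊢
        rcases hC h1 with h4 | h4
        · exact h2 p hfa h4
        · exact h3 r hfb h4
      · exact .inl (hfixV a' b' ha')
      · exact .inl (hfixV a b ha)
      · obtain ⟨x, hx, hax, rfl⟩ := hfix a b ha
        obtain ⟨x', hx', hax', rfl⟩ := hfix a' b' ha'
        rw [hax, hax'] at h1
        simp only [join_adj_inl_inl, SimpleGraph.sum_adj_inl] at h1
        have h2 : Q.2.Adj (e.symm ⟨x, hx⟩) (e.symm ⟨x', hx'⟩) := by
          rw [e.symm.map_adj_iff]
          exact h1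
        exact ψ.toHom.map_adj h2
    · intro a _
      obtain ⟨w, -⟩ := hG.nonempty true
      exact ⟨w, w, fun a' b _ hb => .inl (hfixV a' b hb)⟩

theorem Host.fewGadgets (hG : Host G V₀ P W m) {V : Type*} [Finite V] {H : SimpleGraph V}
    {ℓ : H.edgeSet → ℕ} (hH : H.IsBipartite) (hℓ : ∀ e, 5 ≤ ℓ e ∧ Odd (ℓ e))
    (hm : Nat.card (V ⊕ (Σ e : H.edgeSet, Fin (ℓ e - 2))) ≤ m)
    (hV : V₀.ncard + 1 = qNum (decompFamily (ballooning H ℓ))) (hfree : (ballooning H ℓ).Free G) :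
    FewGadgets G P (kNum (decompFamily (ballooning H ℓ)) - 1) := by
  have hout : ∀ e : H.edgeSet, e.1 = s((Quot.out e.1).1, (Quot.out e.1).2) := fun e =>
    (Quot.out_eq e.1).symm
  rw [ballooning_eq_oriented] at hV hfree ⊢
  obtain ⟨I, s, t, hst, htI, hq, hx⟩ := exists_indepSet_of_qNum_ne_zero hH hℓ hout hV rfl (by omega)
  replace hfree : (orientedBallooning H ℓ s t).Free G := fun h =>
    hfree ((orientedBallooning_isContained hout hst).trans h)
  by_cases hall : ∀ e, s e ∈ I
  · obtain ⟨x, hxI, hxd⟩ := hx hall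
    exact hG.fewGadgets_of_indepCovering hm hℓ hst hall htI hxI (by omega) (by omega) hfree
  · push Not at hall
    obtain ⟨e₀, he₀⟩ := hall
    exact hG.fewGadgets_of_uncovered hH hm hℓ hst htI he₀ hq.le _ hfree

/-- The blocks inside the classes agree for `G` and `mono G P`, and the block between them is
complementary to the missing pairs. -/
theorem Host.numEdges_le (hG : Host G V₀ P W m) :
    numEdges G + (missing G P).ncard ≤ numEdges (G.induce V₀) + numEdges (mono G P) +
      (P false).ncard * (P true).ncard + hG.cross.ncard := by
  have h1 := numEdges_comap_equiv hG.equiv G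
  rw [numEdges_sum, numEdges_sum] at h1
  have h2 := numEdges_comap_equiv hG.equiv (mono G P)
  rw [numEdges_sum, numEdges_sum] at h2
  have e0 : (G.comap hG.equiv).comap Sum.inl = G.induce V₀ := rfl
  have e2 : ((G.comap hG.equiv).comap Sum.inr).comap Sum.inl =
      (((mono G P).comap hG.equiv).comap Sum.inr).comap Sum.inl := by
    ext a b
    change G.Adj a.1 b.1 ↔ (mono G P).Adj a.1 b.1
    rw [mono_adj_iff hG.disj a.2, within_adj]
    simp
  have e3 : ((G.comap hG.equiv).comap Sum.inr).comap Sum.inr =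
      (((mono G P).comap hG.equiv).comap Sum.inr).comap Sum.inr := by
    ext a b
    change G.Adj a.1 b.1 ↔ (mono G P).Adj a.1 b.1
    rw [mono_adj_iff hG.disj a.2, within_adj]
    simp
  have e4 : {p : V₀ × (P false ⊕ P true) | (G.comap hG.equiv).Adj (.inl p.1) (.inr p.2)} =
      hG.cross := rfl
  have e5 : {p : P false × P true | ((G.comap hG.equiv).comap Sum.inr).Adj (.inl p.1)
      (.inr p.2)}.ncard + (missing G P).ncard ≤ (P false).ncard * (P true).ncard := by
    have h3 : missing G P = (fun p : P false × P true => (p.1.1, p.2.1)) ''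
        {p : P false × P true | ((G.comap hG.equiv).comap Sum.inr).Adj (.inl p.1) (.inr p.2)}ᶜ := by
      ext ⟨a, b⟩
      constructor
      · rintro ⟨ha, hb, hab⟩
        exact ⟨(⟨a, ha⟩, ⟨b, hb⟩), hab, rfl⟩
      · rintro ⟨⟨a', b'⟩, hab, h⟩
        obtain ⟨rfl, rfl⟩ := Prod.mk.inj h
        exact ⟨a'.2, b'.2, hab⟩
    rw [h3]
    refine (Nat.add_le_add_left (Set.ncard_image_le (Set.toFinite _)) _).trans_eq ?_
    rw [Set.ncard_add_ncard_compl, Nat.card_prod, Nat.card_coe_set_eq, Nat.card_coe_set_eq]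
  rw [e0, e2, e3, e4] at h1
  omega

theorem Host.ncard_add (hG : Host G V₀ P W m) :
    V₀.ncard + ((P false).ncard + (P true).ncard) = Nat.card β := by
  rw [← Nat.card_congr hG.equiv, Nat.card_sum, Nat.card_sum, Nat.card_coe_set_eq,
    Nat.card_coe_set_eq, Nat.card_coe_set_eq]

theorem Host.ncard_cross_le (hG : Host G V₀ P W m) :
    hG.cross.ncard ≤ V₀.ncard * ((P false).ncard + (P true).ncard) := by
  refine (Set.ncard_le_card _).trans_eq ?_
  rw [Nat.card_prod, Nat.card_sum, Nat.card_coe_set_eq, Nat.card_coe_set_eq, Nat.card_coe_set_eq]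

theorem Host.adj_of_ncard_cross (hG : Host G V₀ P W m)
    (h : V₀.ncard * ((P false).ncard + (P true).ncard) ≤ hG.cross.ncard) {a b : β} {i : Bool}
    (ha : a ∈ V₀) (hb : b ∈ P i) : G.Adj a b := by
  have h1 : hG.cross = Set.univ := by
    refine Set.eq_of_subset_of_ncard_le (Set.subset_univ _) ?_ (Set.toFinite _)
    rwa [Set.ncard_univ, Nat.card_prod, Nat.card_sum, Nat.card_coe_set_eq, Nat.card_coe_set_eq,
      Nat.card_coe_set_eq]
  have key : ∀ p, p ∈ hG.cross := fun p => h1 ▸ Set.mem_univ p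
  cases i
  · exact key (⟨a, ha⟩, .inl ⟨b, hb⟩)
  · exact key (⟨a, ha⟩, .inr ⟨b, hb⟩)

end Host

end EdgeCounts

/-! ### Extremal graphs and the main theorem -/

section Main

theorem mul_eq_of_add_eq {a b m : ℕ} (hs : a + b = m) (hp : a * b = (m + 1) / 2 * (m / 2)) :
    a = (m + 1) / 2 ∧ b = m / 2 ∨ a = m / 2 ∧ b = (m + 1) / 2 := by
  obtain ⟨c, hc | hc⟩ := Nat.even_or_odd' m
  · rw [show (m + 1) / 2 = c by omega, show m / 2 = c by omega] at *
    left
    have h : ((a : ℤ) - c) ^ 2 = 0 := by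
      have h1 : (a : ℤ) + b = 2 * c := by exact_mod_cast hs.trans hc
      have h2 : (a : ℤ) * b = c * c := by exact_mod_cast hp
      have h3 : (b : ℤ) = 2 * c - a := by linarith
      rw [h3] at h2
      linarith
    have := pow_eq_zero_iff (two_ne_zero) |>.1 h
    omega
  · rw [show (m + 1) / 2 = c + 1 by omega, show m / 2 = c by omega] at *
    have h : ((a : ℤ) - c) * (a - (c + 1)) = 0 := by
      have h1 : (a : ℤ) + b = 2 * c + 1 := by exact_mod_cast hs.trans hc
      have h2 : (a : ℤ) * b = (c + 1) * c := by exact_mod_cast hp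
      have h3 : (b : ℤ) = 2 * c + 1 - a := by linarith
      rw [h3] at h2
      linarith
    rcases mul_eq_zero.1 h with h | h <;> omega

theorem mul_le_of_add_eq {a b m : ℕ} (hs : a + b = m) : a * b ≤ (m + 1) / 2 * (m / 2) := by
  obtain ⟨c, hc | hc⟩ := Nat.even_or_odd' m
  · rw [show (m + 1) / 2 = c by omega, show m / 2 = c by omega]
    zify
    have h1 : (a : ℤ) + b = 2 * c := by exact_mod_cast hs.trans hc
    have h3 : (b : ℤ) = 2 * c - a := by linarith
    rw [h3]
    nlinarith [sq_nonneg ((a : ℤ) - c)]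
  · rw [show (m + 1) / 2 = c + 1 by omega, show m / 2 = c by omega]
    zify
    have h1 : (a : ℤ) + b = 2 * c + 1 := by exact_mod_cast hs.trans hc
    have h3 : (b : ℤ) = 2 * c + 1 - a := by linarith
    -- No integer lies strictly between `c` and `c + 1`.
    have h4 : 0 ≤ ((a : ℤ) - c) * (a - (c + 1)) := by
      rcases le_or_gt (a : ℤ) c with h | h
      · exact mul_nonneg_of_nonpos_of_nonpos (by linarith) (by linarith)
      · exact mul_nonneg (by linarith) (by linarith)
    rw [h3]
    linarith

theorem exists_equiv_parity {A B : Type*} [Finite A] [Finite B] {m : ℕ}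
    (hs : Nat.card A + Nat.card B = m) (hp : Nat.card A * Nat.card B = (m + 1) / 2 * (m / 2)) :
    ∃ F : A ⊕ B ≃ Fin m, ∀ x y, (F x : ℕ) % 2 = F y % 2 ↔ x.isLeft = y.isLeft := by
  have hpar : ∀ x y, (parityEquiv m x : ℕ) % 2 = parityEquiv m y % 2 ↔ x.isLeft = y.isLeft := by
    rintro (x | x) (y | y) <;> simp [parityEquiv, Nat.add_mod]
  rcases mul_eq_of_add_eq hs hp with ⟨hA, hB⟩ | ⟨hA, hB⟩
  · refine ⟨((Finite.equivFinOfCardEq hA).sumCongr (Finite.equivFinOfCardEq hB)).trans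
      (parityEquiv m), ?_⟩
    rintro (x | x) (y | y) <;> simp [hpar]
  · refine ⟨((Equiv.sumComm A B).trans ((Finite.equivFinOfCardEq hB).sumCongr
      (Finite.equivFinOfCardEq hA))).trans (parityEquiv m), ?_⟩
    rintro (x | x) (y | y) <;> simp [hpar]

/-- Once nothing is missing between the three parts, `G` is determined by `G[V₀]` and the edges
inside the classes. The `K_{h,h}` is connected and its edges stay within a class, so it lies in one
class. -/
theorem Host.inF {β : Type*} [Finite β] {G : SimpleGraph β} {V₀ : Set β} {P W : Bool → Set β}
    {m n q h : ℕ} {𝓑 : Set FinGraph} (hG : Host G V₀ P W m) (hn : Nat.card β = n)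
    (hq : V₀.ncard = q - 1) (hfree : FamilyFree 𝓑 (G.induce V₀))
    (hex : numEdges (G.induce V₀) = ex (q - 1) 𝓑) (hmiss : missing G P = ∅)
    {X Y : Finset β} (hXY : Disjoint X Y) (hX : #X = h) (hY : #Y = h)
    (hmono : ∀ a b, (mono G P).Adj a b ↔ (a ∈ X ∧ b ∈ Y) ∨ (a ∈ Y ∧ b ∈ X))
    (hcross : ∀ a ∈ V₀, ∀ i, ∀ b ∈ P i, G.Adj a b)
    (hbal : (P false).ncard * (P true).ncard = (n - (q - 1) + 1) / 2 * ((n - (q - 1)) / 2)) :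
    InF n q h 𝓑 G := by
  have hsum := hG.ncard_add
  obtain ⟨F, hF⟩ := exists_equiv_parity (A := P false) (B := P true) (m := n - (q - 1))
    (by rw [Nat.card_coe_set_eq, Nat.card_coe_set_eq]; omega)
    (by rw [Nat.card_coe_set_eq, Nat.card_coe_set_eq, hbal])
  let e : V₀ ≃ Fin (q - 1) := Finite.equivFinOfCardEq ((Nat.card_coe_set_eq V₀).trans hq)
  let u : P false ⊕ P true → β := Sum.elim Subtype.val Subtype.val
  have hu : Function.Injective u := fun x y hxy =>
    Sum.inr_injective (hG.sum_elim_bijective.1 (a₁ := .inr x) (a₂ := .inr y) hxy)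
  have hmem : ∀ x, u x ∈ P (!x.isLeft) := by
    rintro (x | x)
    exacts [x.2, x.2]
  have hsurj : ∀ i, ∀ b ∈ P i, ∃ x, u x = b := by
    rintro (i | i) b hb
    exacts [⟨.inl ⟨b, hb⟩, rfl⟩, ⟨.inr ⟨b, hb⟩, rfl⟩]
  have hsame : ∀ {x y}, (mono G P).Adj (u x) (u y) → x.isLeft = y.isLeft := by
    intro x y hxy
    rw [mono_adj_iff hG.disj (hmem x), within_adj] at hxy
    have h2 := hxy.2.2
    by_contra hne
    have h3 := hmem y
    have h4 := Set.disjoint_left.1 hG.disj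
    revert h2 h3 hne
    cases x.isLeft <;> cases y.isLeft <;> simp <;> grind
  have hadj : ∀ x y, G.Adj (u x) (u y) ↔ x.isLeft ≠ y.isLeft ∨ (mono G P).Adj (u x) (u y) := by
    intro x y
    by_cases hxy : x.isLeft = y.isLeft
    · have h1 := hmem y
      rw [← hxy] at h1
      rw [mono_adj_iff hG.disj (hmem x), within_adj, and_iff_left ⟨hmem x, h1⟩]
      exact ⟨.inr, fun h => h.resolve_left (not_not_intro hxy)⟩
    · simp only [ne_eq, hxy, not_false_eq_true, true_or, iff_true]
      by_contra hna
      have key : ∀ a ∈ P false, ∀ b ∈ P true, G.Adj a b := by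
        intro a ha b hb
        by_contra hab
        exact Set.eq_empty_iff_forall_notMem.1 hmiss (a, b) ⟨ha, hb, hab⟩
      rcases x with x | x <;> rcases y with y | y
      · exact hxy rfl
      · exact hna (key _ x.2 _ y.2)
      · exact hna (key _ y.2 _ x.2).symm
      · exact hxy rfl
  let eX := (X.equivFinOfCardEq hX).symm
  let eY := (Y.equivFinOfCardEq hY).symm
  let χ : Fin h ⊕ Fin h → β := Sum.elim (fun i => (eX i).1) fun i => (eY i).1
  have hχ : Function.Injective χ := by
    have h1 := Finset.disjoint_left.1 hXY
    rintro (i | i) (j | j) hij <;> simp only [χ, Sum.elim_inl, Sum.elim_inr] at hij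
    · rw [eX.injective (Subtype.ext hij)]
    · exact (h1 (eX i).2 (hij ▸ (eY j).2)).elim
    · exact (h1 (eX j).2 (hij ▸ (eY i).2)).elim
    · rw [eY.injective (Subtype.ext hij)]
  have hχadj : ∀ i j, (mono G P).Adj (χ (.inl i)) (χ (.inr j)) := fun i j =>
    (hmono _ _).2 (.inl ⟨(eX i).2, (eY j).2⟩)
  have hmonoP : ∀ {a b}, (mono G P).Adj a b → ∃ x, u x = a := by
    rintro a b (hab | hab) <;> rw [within_adj] at hab
    exacts [hsurj _ _ hab.2.1, hsurj _ _ hab.2.1]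
  have hc : ∀ z, ∃ x, u x = χ z := by
    rintro (i | i)
    exacts [hmonoP (hχadj i i), hmonoP (hχadj i i).symm]
  choose c hc using hc
  have hcadj : ∀ i j, (c (.inl i)).isLeft = (c (.inr j)).isLeft := fun i j =>
    hsame (by rw [hc, hc]; exact hχadj i j)
  have hcinj : Function.Injective c := fun z w hzw => hχ (by rw [← hc, ← hc, hzw])
  refine ⟨(G.induce V₀).comap e.symm, ⟨fun L hL => ?_, ?_⟩, ⟨F ∘ c, F.injective.comp hcinj⟩, ?_,
    ⟨(SimpleGraph.Iso.comap hG.equiv G).symm.trans ⟨e.sumCongr F, ?_⟩⟩⟩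
  · exact (SimpleGraph.free_congr_right (SimpleGraph.Iso.comap e.symm _)).2 (hfree L hL)
  · rw [numEdges_comap_equiv, hex]
  -- For `h = 0` there is no vertex to read the residue from, and any value serves.
  · rcases h with _ | h
    · exact ⟨0, fun z => z.elim (fun i => i.elim0) fun i => i.elim0⟩
    · refine ⟨F (c (.inl 0)) % 2, ?_⟩
      rintro (i | i)
      · exact (hF _ _).2 ((hcadj i 0).trans (hcadj 0 0).symm)
      · exact (hF _ _).2 (hcadj 0 i).symm
  · rintro (x | x) (y | y)
    · simp only [Equiv.sumCongr_apply, Sum.map_inl, join_adj_inl_inl, SimpleGraph.comap_adj,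
        Equiv.symm_apply_apply]
      rfl
    · simp only [Equiv.sumCongr_apply, Sum.map_inl, Sum.map_inr, join_adj_inl_inr, true_iff]
      exact hcross x.1 x.2 _ _ (hmem y)
    · simp only [Equiv.sumCongr_apply, Sum.map_inl, Sum.map_inr, join_adj_inr_inl, true_iff]
      exact (hcross y.1 y.2 _ _ (hmem x)).symm
    · change _ ↔ G.Adj (u x) (u y)
      rw [hadj, Equiv.sumCongr_apply, Equiv.sumCongr_apply, Sum.map_inr, Sum.map_inr,
        join_adj_inr_inr,
        SimpleGraph.sup_adj, SimpleGraph.turanGraph_adj, ne_eq, hF]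
      refine or_congr Iff.rfl ?_
      rw [hmono, SimpleGraph.map_adj]
      constructor
      · rintro ⟨z, w, hzw, hz, hw⟩
        have hz : u x = χ z := by rw [← hc, ← F.injective hz]
        have hw : u y = χ w := by rw [← hc, ← F.injective hw]
        rw [hz, hw]
        rcases z with i | i <;> rcases w with j | j <;> simp at hzw
        · exact .inl ⟨(eX i).2, (eY j).2⟩
        · exact .inr ⟨(eY i).2, (eX j).2⟩
      · have hXs : ∀ {a}, a ∈ X → ∃ i, χ (.inl i) = a := fun {a} ha =>
          ⟨eX.symm ⟨a, ha⟩, by simp [χ]⟩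
        have hYs : ∀ {a}, a ∈ Y → ∃ i, χ (.inr i) = a := fun {a} ha =>
          ⟨eY.symm ⟨a, ha⟩, by simp [χ]⟩
        rintro (⟨hx, hy⟩ | ⟨hx, hy⟩)
        · obtain ⟨i, hi⟩ := hXs hx
          obtain ⟨j, hj⟩ := hYs hy
          rw [← hc] at hi hj
          exact ⟨.inl i, .inr j, by simp, congrArg F (hu hi), congrArg F (hu hj)⟩
        · obtain ⟨i, hi⟩ := hYs hx
          obtain ⟨j, hj⟩ := hXs hy
          rw [← hc] at hi hj
          exact ⟨.inr i, .inl j, by simp, congrArg F (hu hi), congrArg F (hu hj)⟩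

/-- Two subsets of size at least `c * b` in a set of size `b` share at least `(2 * c - 1) * b`
elements; this yields the common neighbours demanded by `pair`. -/
theorem Host.of_degree_le {β : Type*} [Finite β] {G : SimpleGraph β} {V₀ : Set β}
    {P W : Bool → Set β} {m b : ℕ} {c : ℝ} (hb : 0 < b) (hm : (m : ℝ) ≤ (2 * c - 1) * b)
    (hc : c ≤ 1) (disj : Disjoint (P false) (P true)) (disj₀ : ∀ i, Disjoint V₀ (P i))
    (cover : ∀ v, v ∈ V₀ ∨ ∃ i, v ∈ P i) (sub : ∀ i, W i ⊆ P i) (hW : ∀ i, (W i).ncard = b)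
    (indep : ∀ i, G.IsIndepSet (W i)) (complete : G.IsCompleteBetween (W false) (W true))
    (complete₀ : ∀ z ∈ V₀, ∀ i, ∀ w ∈ W i, G.Adj z w)
    (hdeg : ∀ i, ∀ v ∈ P i \ W i, c * b ≤ (G.neighborSet v ∩ W (!i)).ncard ∧
      ∀ w ∈ W i, ¬G.Adj v w) : Host G V₀ P W m := by
  have hcomp : ∀ i j, i ≠ j → ∀ w ∈ W i, ∀ w' ∈ W j, G.Adj w w' := by
    rintro (i | i) (j | j) hij w hw w' hw'
    exacts [(hij rfl).elim, complete hw hw', (complete hw' hw).symm, (hij rfl).elim]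
  have hdeg' : ∀ i, ∀ v ∈ P (!i), c * b ≤ (G.neighborSet v ∩ W i).ncard := by
    intro i v hv
    by_cases hvW : v ∈ W (!i)
    · have h : W i ⊆ G.neighborSet v := fun w hw => hcomp (!i) i (by simp) v hvW w hw
      rw [Set.inter_eq_self_of_subset_right h, hW]
      exact mul_le_of_le_one_left (Nat.cast_nonneg b) hc
    · simpa using (hdeg (!i) v ⟨hv, hvW⟩).1
  refine ⟨disj, disj₀, cover, sub, fun i => ?_, fun i w hw p hp hwp => ?_, hcomp, complete₀,
    fun i p hp p' hp' => ?_⟩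
  · exact (Set.ncard_pos (Set.toFinite _)).1 ((hW i).symm ▸ hb)
  · by_cases hpW : p ∈ W i
    · exact indep i hw hpW hwp.ne hwp
    · exact (hdeg i p ⟨hp, hpW⟩).2 w hw hwp.symm
  · have h1 := Set.ncard_union_add_ncard_inter (G.neighborSet p ∩ W i) (G.neighborSet p' ∩ W i)
    have h2 : (G.neighborSet p ∩ W i ∪ G.neighborSet p' ∩ W i).ncard ≤ b :=
      (Set.ncard_le_ncard (Set.union_subset Set.inter_subset_right Set.inter_subset_right)
        (Set.toFinite _)).trans_eq (hW i)
    have h3 : G.neighborSet p ∩ W i ∩ (G.neighborSet p' ∩ W i) =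
        {w ∈ W i | G.Adj w p ∧ G.Adj w p'} := by
      ext w
      simp only [Set.mem_inter_iff, SimpleGraph.mem_neighborSet, Set.mem_ofPred_eq,
        G.adj_comm w]
      tauto
    rw [h3] at h1
    have h4 := hdeg' i p hp
    have h5 := hdeg' i p' hp'
    have h6 : ((G.neighborSet p ∩ W i).ncard : ℝ) + (G.neighborSet p' ∩ W i).ncard ≤
        b + {w ∈ W i | G.Adj w p ∧ G.Adj w p'}.ncard := by
      exact_mod_cast (by omega)
    have h7 : (m : ℝ) ≤ {w ∈ W i | G.Adj w p ∧ G.Adj w p'}.ncard := by linarith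
    exact_mod_cast h7

end Main

end OddBalloon

theorem mainTheorem2 {V : Type*} [Finite V] (H : SimpleGraph V) (hH : H.IsBipartite)
    (t : ℕ) (ht : 5 ≤ t) (htodd : Odd t)
    (ℓ : H.edgeSet → ℕ) (hℓ : ∀ e, t ≤ ℓ e ∧ Odd (ℓ e))
    (c₀ : ℝ) (hc₀ : 1 / 2 < c₀) (hc₀' : c₀ ≤ 1)
    (𝓜 : Set OddBalloon.FinGraph)
    (h𝓜 : 𝓜 = OddBalloon.decompFamily (OddBalloon.ballooning H ℓ))
    (q : ℕ) (hq : q = OddBalloon.qNum 𝓜)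
    (k : ℕ) (hk : k = OddBalloon.kNum 𝓜)
    (𝓑 : Set OddBalloon.FinGraph) (h𝓑 : 𝓑 = OddBalloon.coveringFamily 𝓜) :
    ∃ N : ℕ, ∀ n b : ℕ, N ≤ n → N ≤ b →
      ∀ (G : SimpleGraph (Fin n)) (V₀ V₁ V₂ W₁ W₂ : Set (Fin n)),
        -- `V(G) = V₀ ∪ V₁ ∪ V₂` is a partition
        V₀ ∪ V₁ ∪ V₂ = Set.univ → Disjoint V₀ V₁ → Disjoint V₀ V₂ → Disjoint V₁ V₂ →
        -- `G[W₁ ∪ W₂]` is `T_2(2b)` with classes `W₁ ⊆ V₁`, `W₂ ⊆ V₂`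
        W₁ ⊆ V₁ → W₂ ⊆ V₂ → W₁.ncard = b → W₂.ncard = b →
        G.IsIndepSet W₁ → G.IsIndepSet W₂ → G.IsCompleteBetween W₁ W₂ →
        -- `|V₀| = q - 1` and `V₀` is complete to `W₁ ∪ W₂`
        V₀.ncard + 1 = q → G.IsCompleteBetween V₀ (W₁ ∪ W₂) →
        -- adjacency of the remaining vertices of `V₁` and of `V₂`
        (∀ v ∈ V₁ \ W₁, c₀ * (W₂.ncard : ℝ) ≤ ((G.neighborSet v ∩ W₂).ncard : ℝ) ∧
          ∀ w ∈ W₁, ¬ G.Adj v w) →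
        (∀ v ∈ V₂ \ W₂, c₀ * (W₁.ncard : ℝ) ≤ ((G.neighborSet v ∩ W₁).ncard : ℝ) ∧
          ∀ w ∈ W₂, ¬ G.Adj v w) →
        (OddBalloon.ballooning H ℓ).Free G →
        OddBalloon.numEdges G ≤
            OddBalloon.fNum n q + OddBalloon.ex (q - 1) 𝓑 + (k - 1) ^ 2 ∧
          (OddBalloon.numEdges G =
              OddBalloon.fNum n q + OddBalloon.ex (q - 1) 𝓑 + (k - 1) ^ 2 ↔
            OddBalloon.InF n q (k - 1) 𝓑 G) := by
  classical
  subst h𝓑 h𝓜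
  set m := Nat.card (V ⊕ (Σ e : H.edgeSet, Fin (ℓ e - 2))) with hm
  have hc : 0 < 2 * c₀ - 1 := by linarith
  -- The first summand gives `m ≤ (2 * c₀ - 1) * b`; the other two make `b` positive and larger than
  -- `2 * (k - 1) ^ 2`, as `numEdges_mono_le` requires.
  refine ⟨⌈(m : ℝ) / (2 * c₀ - 1)⌉₊ + 2 * (k - 1) ^ 2 + 1, fun n b _ hb G V₀ V₁ V₂ W₁ W₂ hcover
    h01 h02 h12 hW₁ hW₂ hb₁ hb₂ hi₁ hi₂ hcomp hV₀ hcomp₀ hd₁ hd₂ hfree => ?_⟩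
  have hmb : (m : ℝ) ≤ (2 * c₀ - 1) * b := by
    rw [← div_le_iff₀' hc]
    refine (Nat.le_ceil _).trans ?_
    exact_mod_cast (by omega)
  let P : Bool → Set (Fin n) := fun i => cond i V₂ V₁
  let W : Bool → Set (Fin n) := fun i => cond i W₂ W₁
  rw [hb₁] at hd₂
  rw [hb₂] at hd₁
  have hG : OddBalloon.Host G V₀ P W m := by
    refine OddBalloon.Host.of_degree_le (b := b) (by omega) hmb hc₀' h12 ?_ (fun v => ?_) ?_ ?_ ?_
      hcomp (fun z hz i w hw => ?_) ?_
    · rintro (i | i)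
      exacts [h01, h02]
    · have hv : v ∈ V₀ ∪ V₁ ∪ V₂ := hcover ▸ Set.mem_univ v
      rcases hv with (h | h) | h
      exacts [.inl h, .inr ⟨false, h⟩, .inr ⟨true, h⟩]
    · rintro (i | i)
      exacts [hW₁, hW₂]
    · rintro (i | i)
      exacts [hb₁, hb₂]
    · rintro (i | i)
      exacts [hi₁, hi₂]
    · cases i
      exacts [hcomp₀ hz (.inl hw), hcomp₀ hz (.inr hw)]
    · rintro (i | i)
      exacts [hd₁, hd₂]
  have hVq : V₀.ncard = q - 1 := by omega
  rw [hq] at hV₀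
  have hgad := hG.fewGadgets hH (fun e => ⟨ht.trans (hℓ e).1, (hℓ e).2⟩) le_rfl hV₀ hfree
  have hfree₀ := hG.familyFree_induce le_rfl hV₀ hfree
  rw [← hk] at hgad
  have hex := OddBalloon.numEdges_le_ex hfree₀ ((Nat.card_coe_set_eq V₀).trans hVq)
  obtain ⟨hmono, hmonoEq⟩ := OddBalloon.numEdges_mono_le h12 hgad (hG.sub false)
    (fun w hw p hwp => by
      rw [OddBalloon.mono_adj_iff h12 (hG.sub false hw), OddBalloon.within_adj] at hwp
      exact hG.isolated false w hw p hwp.2.2 hwp.1)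
    (by rw [show (W false).ncard = b from hb₁]; omega)
  have hle := hG.numEdges_le
  have hcr := hG.ncard_cross_le
  have hadd := hG.ncard_add
  rw [Nat.card_eq_fintype_card, Fintype.card_fin] at hadd
  have hPs : (P false).ncard + (P true).ncard = n - (q - 1) := by omega
  have hbal := OddBalloon.mul_le_of_add_eq hPs
  have hF := OddBalloon.fNum_eq n q
  rw [hPs, hVq] at hcr
  refine ⟨by omega, fun heq => ?_, OddBalloon.InF.numEdges_eq⟩
  -- The total is a sum of separately bounded terms, so equality makes each estimate tight: inside
  -- `V₀`, at `V₀`, in the balance of the classes, and inside the classes.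
  obtain ⟨hmiss, X, Y, hXY, hX, hY, hXYadj⟩ := hmonoEq (by omega)
  refine hG.inF (by simp) hVq hfree₀ (by omega) hmiss hXY hX hY hXYadj
    (fun a ha i b hb => hG.adj_of_ncard_cross ?_ ha hb) (by omega)
  rw [hPs, hVq]
  omega
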